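/- **Setting.** Let $A$, $O$ and $R\subset[0,1]$ be finite sets of actions, observations and rewards ($A\neq\emptyset$), and let $\gamma\in(0,1)$. An environment $\nu$ assigns to every finite history $h\in(A\times O\times R)^*$ and next action $a$ a probability distribution on the next pair in $O\times R$; a policy is a map $\pi:(A\times O\times R)^*\to A$; $P_{\nu,\pi}$ is the law of the infinite history generated by $\nu$ and $\pi$, and $P_{\nu,\pi}(\cdot\mid h)$ the law of its continuation from $h$. $V^\pi_\nu(h;n)$ is the $P_{\nu,\pi}(\cdot\mid h)$-expectation of $\sum_{k=0}^{n-1}\gamma^k r_{k}$, where $r_0,r_1,\dots$ are the rewards received after $h$; $V^\pi_\nu(h)=\lim_n V^\pi_\nu(h;n)$, $V^*_\nu(h)=\sup_\pi V^\pi_\nu(h)$, and $\pi^*_\nu$ is a policy attaining the supremum in every history. Let $L^\epsilon_{\nu,\pi}\in\mathbb N\cup\{\infty\}$ be the number of time-steps $t\ge 0$ with $V^*_\nu(h_t)-V^\pi_\nu(h_t)>\epsilon$, where $h_t$ is the prefix of length $t$ of the infinite history. $\Lambda$ is a *sample-complexity* of $\pi$ in $\mathcal M$, with accuracy $\epsilon$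 and confidence $1-\delta$, if $P_{\mu,\pi}(L^\epsilon_{\mu,\pi}>\Lambda)<\delta$ for all $\mu\in\mathcal M$. **Constants.** Let $N\ge1$, $\delta\in(0,1)$, $\epsilon>0$ with $\epsilon(1-\gamma)\le 1$, and $$d=\tfrac1{1-\gamma}\log\tfrac{8}{(1-\gamma)\epsilon},\quad \mathcal K=\{\kappa\in\mathbb N:\kappa\le\log_2\tfrac1{\epsilon(1-\gamma)}+2\},\quad \delta_1=\tfrac{\delta}{32|\mathcal K|N^{3/2}},\quad \alpha=\tfrac{4\sqrt N}{4\sqrt N-1},\quad \alpha_j=\lceil\alpha^j\rceil,$$ $$E_{\max}=\tfrac{2^{16}N}{\epsilon^2(1-\gamma)^2}\log^2\tfrac{2^9N}{\epsilon^2(1-\gamma)^2\delta_1},\qquad G_{\max}=|\mathcal K|\,E_{\max}.$$ **Algorithm (MERL)** with inputs $\epsilon$, $\delta$ and $\nu_1,\dots,\nu_N$. It keeps a model class $\mathcal M$, initially $\{\nu_1,\dots,\nu_N\}$, and for all $\nu$ and $\kappa\in\mathbb N$ a counter $E(\nu,\kappa)$, initially $0$. Put $D=\lceil d\rceil$. At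 a history $h$ outside an exploration phase it picks $\overline\nu,\underline\nu\in\mathcal M$ and $\pi\in\{\pi^*_\nu:\nu\in\mathcal M\}$ that maximise $\Delta=V^\pi_{\overline\nu}(h;D)-V^\pi_{\underline\nu}(h;D)$. If $\Delta\le\epsilon/4$, it takes one action by $\pi^*_{\nu_i}$, with $i$ minimal such that $\nu_i\in\mathcal M$. If $\Delta>\epsilon/4$, it follows $\pi$ for an exploration phase of $D$ time-steps and receives there the discounted return $\rho=\sum_{k<D}\gamma^kr_k$; at the end of the phase, with $\kappa\in\mathbb N$ such that $\Delta\in[\epsilon2^{\kappa-2},\epsilon2^{\kappa-1})$, it increments $E(\overline\nu,\kappa)$ and $E(\underline\nu,\kappa)$, records $X(\overline\nu,\kappa)_{E(\overline\nu,\kappa)}=(1-\gamma)(V^\pi_{\overline\nu}(h;D)-\rho)$ and $X(\underline\nu,\kappa)_{E(\underline\nu,\kappa)}=(1-\gamma)(\rho-V^\pi_{\underline\nu}(h;D))$, and removes from $\mathcal M$ every $\nu$ for which there are $\kappa,j\in\mathbb N$ with $E(\nu,\kappa)=\alpha_j$ and $\sum_{i=1}^{E(\nu,\kappa)}X(\nu,\kappa)_i\ge\sqrt{2E(\nu,\kappa)\log(E(\nu,\kappa)/\delta_1)}$.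 The choice of the optimal policies, ties in the maximisation, and the behaviour after $\mathcal M$ has become empty are arbitrary. **Theorem 1.** Let $\nu_1,\dots,\nu_N$ be arbitrary environments. The optimal policies $\pi^*_{\nu_i}$ exist, so that MERL is well defined, and for every policy $\pi$ of MERL and every true environment $\mu\in\{\nu_1,\dots,\nu_N\}$, $$P_{\mu,\pi}\bigl(L^\epsilon_{\mu,\pi}\ge d\cdot(G_{\max}+E_{\max})\bigr)\le\delta .$$ Moreover $d\cdot(G_{\max}+E_{\max})$ is a sample-complexity of $\pi$ in $\{\nu_1,\dots,\nu_N\}$ with accuracy $\epsilon$ and confidence $1-\delta$, and it is $\tilde O\bigl(\frac{N}{\epsilon^2(1-\gamma)^3}\log^2\frac{N}{\delta\epsilon(1-\gamma)}\bigr)$ in the following sense: there is a universal constant $C$ such that for all $N\ge1$, $\gamma\in(0,1)$, $\delta\in(0,1)$ and $\epsilon>0$ with $\epsilon(1-\gamma)\le\frac12$, $$d\cdot(G_{\max}+E_{\max})\le C\,\frac{N}{\epsilon^2(1-\gamma)^3}\,\log^2\frac{N}{\delta\epsilon(1-\gamma)}\cdot\log^2\frac1{\epsilon(1-\gamma)}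 .$$ -/

import Mathlib

open MeasureTheory ProbabilityTheory Filter Topology
open scoped ENNReal

noncomputable section

namespace GeneralRL

/-! ### Histories, environments, policies, and the measure of their interaction -/

/-- One time-step: an action, an observation and a reward (from the finite reward set `R`). -/
@[ext]
structure Step (A O : Type*) (R : Finset ℝ) where
  act : A
  obs : O
  rew : R

variable {A O : Type*} {R : Finset ℝ}

instance : MeasurableSpace (Step A O R) := ⊤

instance : DiscreteMeasurableSpace (Step A O R) := ⟨fun _ => trivial⟩

instance [Finite A] [Finite O] : Finite (Step A O R) :=
  Finite.of_injective (fun s : Step A O R => (s.act, s.obs, s.rew)) (by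
    intro s s' h
    simp only [Prod.mk.injEq] at h
    exact Step.ext h.1 h.2.1 h.2.2)

/-- Finite histories, written with the NEWEST time-step first: `s :: h` is the history `h`
followed by the time-step `s`, and `g ++ h` is the history `h` followed by `g`. -/
abbrev History (A O : Type*) (R : Finset ℝ) := List (Step A O R)

/-- An environment: for every history and every action taken next, a probability distribution over
the next observation/reward pair. The dependence on the history is arbitrary. -/
abbrev Env (A O : Type*) (R : Finset ℝ) := History A O R → A → PMF (O × R)

/-- A (deterministic, history-dependent) policy. -/
abbrev Policy (A O : Type*) (R : Finset ℝ) := History A O R → A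

/-- The history made of `x 0, x 1, …, x (t - 1)` in this temporal order. -/
def histOf {t : ℕ} (x : Fin t → Step A O R) : History A O R := (List.ofFn x).reverse

/-- The prefix of length `t` of an infinite history. -/
def pref (ω : ℕ → Step A O R) (t : ℕ) : History A O R := histOf (fun i : Fin t => ω i)

/-- The distribution of the time-step which follows the history `h`. -/
def stepLaw (μ : Env A O R) (π : Policy A O R) (h : History A O R) : Measure (Step A O R) :=
  ((μ h (π h)).map (fun q => (⟨π h, q.1, q.2⟩ : Step A O R))).toMeasure

instance (μ : Env A O R) (π : Policy A O R) (h : History A O R) :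
    IsProbabilityMeasure (stepLaw μ π h) := by
  unfold stepLaw; infer_instance

variable [Finite A] [Finite O]

/-- The transition kernel, from the first `n + 1` time-steps after `h` to the next one. -/
def stepKernel (μ : Env A O R) (π : Policy A O R) (h : History A O R) (n : ℕ) :
    Kernel ((i : Finset.Iic n) → Step A O R) (Step A O R) :=
  Kernel.ofFunOfCountable fun x =>
    stepLaw μ π
      (histOf (fun i : Fin (n + 1) => x ⟨i, Finset.mem_Iic.2 (Nat.lt_succ_iff.1 i.2)⟩) ++ h)

instance (μ : Env A O R) (π : Policy A O R) (h : History A O R) (n : ℕ) :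
    IsMarkovKernel (stepKernel μ π h n) :=
  ⟨fun x => by unfold stepKernel; exact inferInstanceAs (IsProbabilityMeasure (stepLaw _ _ _))⟩

/-- `lawFrom μ π h` is the conditional law `P_{μ,π}(· | h)` of the infinite continuation of the
history `h`, when `π` interacts with `μ` from `h` on. -/
def lawFrom (μ : Env A O R) (π : Policy A O R) (h : History A O R) :
    Measure (ℕ → Step A O R) :=
  Kernel.trajMeasure (X := fun _ => Step A O R) (stepLaw μ π h) (stepKernel μ π h)

/-- The measure `P_{μ,π}` on infinite histories. -/
def law (μ : Env A O R) (π : Policy A O R) : Measure (ℕ → Step A O R) := lawFrom μ π []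

/-! ### Values, optimality, and the number of errors -/

/-- The discounted return of the first `d` time-steps of a continuation. -/
def ret (γ : ℝ) (d : ℕ) (ω : ℕ → Step A O R) : ℝ :=
  ∑ k ∈ Finset.range d, γ ^ k * ((ω k).rew : ℝ)

/-- The `d`-step value `V^π_μ(h; d)`. -/
def valueN (γ : ℝ) (μ : Env A O R) (π : Policy A O R) (h : History A O R) (d : ℕ) : ℝ :=
  ∫ ω, ret γ d ω ∂(lawFrom μ π h)

/-- The value `V^π_μ(h) = lim_d V^π_μ(h; d)` (the limit exists when `0 ≤ γ < 1`). -/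
def value (γ : ℝ) (μ : Env A O R) (π : Policy A O R) (h : History A O R) : ℝ :=
  limUnder atTop (fun d => valueN γ μ π h d)

/-- `π` is an optimal policy `π^*_μ` of `μ`: it has the largest value in every history. -/
def IsOptimal (γ : ℝ) (μ : Env A O R) (π : Policy A O R) : Prop :=
  ∀ (π' : Policy A O R) (h : History A O R), value γ μ π' h ≤ value γ μ π h

/-- The optimal value `V^*_μ(h)`. -/
def optValue (γ : ℝ) (μ : Env A O R) (h : History A O R) : ℝ :=
  ⨆ π : Policy A O R, value γ μ π h

/-- The number of time-steps (possibly infinite) at which `π` is not `ε`-optimal. -/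
def errorCount (γ ε : ℝ) (μ : Env A O R) (π : Policy A O R) (ω : ℕ → Step A O R) : ℕ∞ :=
  Set.encard {t : ℕ | ε < optValue γ μ (pref ω t) - value γ μ π (pref ω t)}

/-- `Λ` is a sample-complexity of `π` in the class `ν`, for accuracy `ε` and confidence `1 - δ`. -/
def HasSampleComplexity {N : ℕ} (γ ε δ : ℝ) (ν : Fin N → Env A O R) (π : Policy A O R)
    (Λ : ℝ) : Prop :=
  ∀ i : Fin N, law (ν i) π {ω | ENNReal.ofReal Λ < (errorCount γ ε (ν i) π ω : ℝ≥0∞)}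
    < ENNReal.ofReal δ

/-! ### The constants -/

/-- The effective horizon `d`. -/
def horizon (γ ε : ℝ) : ℝ := 1 / (1 - γ) * Real.log (8 / ((1 - γ) * ε))

/-- The number of time-steps of an exploration phase: `d`, rounded up to an integer. -/
def phaseLen (γ ε : ℝ) : ℕ := ⌈horizon γ ε⌉₊

/-- The set `𝒦 = {0, 1, 2, …, log₂ (1 / (ε (1 - γ))) + 2}`. -/
def kappas (γ ε : ℝ) : Finset ℕ :=
  Finset.range (⌊Real.logb 2 (1 / (ε * (1 - γ))) + 2⌋₊ + 1)

def delta1 (N : ℕ) (γ ε δ : ℝ) : ℝ :=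
  δ / (32 * (kappas γ ε).card * (N : ℝ) ^ (3 / 2 : ℝ))

def alpha (N : ℕ) : ℝ := 4 * √(N : ℝ) / (4 * √(N : ℝ) - 1)

def alphaSeq (N j : ℕ) : ℕ := ⌈alpha N ^ j⌉₊

def Emax (N : ℕ) (γ ε δ : ℝ) : ℝ :=
  2 ^ 16 * N / (ε ^ 2 * (1 - γ) ^ 2) *
    Real.log (2 ^ 9 * N / (ε ^ 2 * (1 - γ) ^ 2 * delta1 N γ ε δ)) ^ 2

def Gmax (N : ℕ) (γ ε δ : ℝ) : ℝ :=
  2 ^ 16 * N * (kappas γ ε).card / (ε ^ 2 * (1 - γ) ^ 2) *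
    Real.log (2 ^ 9 * N / (ε ^ 2 * (1 - γ) ^ 2 * delta1 N γ ε δ)) ^ 2

/-- The bound `d · (G_max + E_max)`. -/
def errorBound (N : ℕ) (γ ε δ : ℝ) : ℝ := horizon γ ε * (Gmax N γ ε δ + Emax N γ ε δ)

/-! ### The MERL algorithm -/

/-- A choice of an upper model, a lower model, and a model whose optimal policy is followed. -/
structure Choice (N : ℕ) where
  up : Fin N
  lo : Fin N
  pol : Fin N

/-- `Δ = V^π_{up}(h; d) - V^π_{lo}(h; d)`, where `π` is the optimal policy of the model `pol`. -/
def gap {N : ℕ} (γ ε : ℝ) (ν : Fin N → Env A O R) (πs : Fin N → Policy A O R)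
    (c : Choice N) (h : History A O R) : ℝ :=
  valueN γ (ν c.up) (πs c.pol) h (phaseLen γ ε) - valueN γ (ν c.lo) (πs c.pol) h (phaseLen γ ε)

/-- `sel` picks, from every nonempty model class `M` and in every history, a triple in `M` that
maximises `Δ` (ties are broken arbitrarily). -/
def IsArgmax {N : ℕ} (γ ε : ℝ) (ν : Fin N → Env A O R) (πs : Fin N → Policy A O R)
    (sel : Finset (Fin N) → History A O R → Choice N) : Prop :=
  ∀ (M : Finset (Fin N)) (h : History A O R), M.Nonempty →
    ((sel M h).up ∈ M ∧ (sel M h).lo ∈ M ∧ (sel M h).pol ∈ M) ∧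
    ∀ c : Choice N, c.up ∈ M → c.lo ∈ M → c.pol ∈ M →
      gap γ ε ν πs c h ≤ gap γ ε ν πs (sel M h) h

/-- An exploration phase in progress: the chosen triple, the history at its start, the number of
time-steps done so far, and the discounted return received so far. -/
structure Phase (N : ℕ) (A O : Type*) (R : Finset ℝ) where
  choice : Choice N
  start : History A O R
  elapsed : ℕ
  ret : ℝ

/-- The memory of the algorithm: the current model class, the counters `E(ν, κ)`, the sums
`X(ν, κ)_1 + ⋯ + X(ν, κ)_{E(ν, κ)}`, and the exploration phase in progress, if there is one. -/
structure State (N : ℕ) (A O : Type*) (R : Finset ℝ) where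
  models : Finset (Fin N)
  count : Fin N → ℕ → ℕ
  stat : Fin N → ℕ → ℝ
  phase : Option (Phase N A O R)

/-- The `κ` with `Δ ∈ [ε 2^(κ - 2), ε 2^(κ - 1))`, for `Δ > ε / 4`. -/
def bucket (ε Δ : ℝ) : ℕ := Nat.log 2 ⌊4 * Δ / ε⌋₊

/-- The model `i` fails its test: for some `κ`, the counter is one of the `α_j` and the sum of the
statistics is too large. -/
def Fails {N : ℕ} (γ ε δ : ℝ) (count : Fin N → ℕ → ℕ) (stat : Fin N → ℕ → ℝ) (i : Fin N) : Prop :=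
  ∃ κ j : ℕ, count i κ = alphaSeq N j ∧
    √(2 * (count i κ : ℝ) * Real.log ((count i κ : ℝ) / delta1 N γ ε δ)) ≤ stat i κ

/-- The exploration phase the algorithm is in at history `h`: the one in progress or, if there is
none and `Δ > ε / 4`, the one that starts now; `none` means that the algorithm exploits. -/
def currentPhase {N : ℕ} (γ ε : ℝ) (ν : Fin N → Env A O R) (πs : Fin N → Policy A O R)
    (sel : Finset (Fin N) → History A O R → Choice N) (σ : State N A O R) (h : History A O R) :
    Option (Phase N A O R) :=
  open Classical in
  match σ.phase with
  | some p => some p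
  | none =>
    if σ.models.Nonempty ∧ ε / 4 < gap γ ε ν πs (sel σ.models h) h then
      some ⟨sel σ.models h, h, 0, 0⟩
    else none

/-- The end of the exploration phase `p` with final return `p.ret`: counters and statistics are
updated, and all models that fail their test leave the model class. -/
def endPhase {N : ℕ} (γ ε δ : ℝ) (ν : Fin N → Env A O R) (πs : Fin N → Policy A O R)
    (σ : State N A O R) (p : Phase N A O R) : State N A O R :=
  open Classical in
  let c := p.choice
  let κ := bucket ε (gap γ ε ν πs c p.start)
  let V := fun i : Fin N => valueN γ (ν i) (πs c.pol) p.start (phaseLen γ ε)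
  let count' : Fin N → ℕ → ℕ := fun i k =>
    if k = κ ∧ (i = c.up ∨ i = c.lo) then σ.count i k + 1 else σ.count i k
  let stat' : Fin N → ℕ → ℝ := fun i k =>
    if k = κ ∧ i = c.up then σ.stat i k + (1 - γ) * (V c.up - p.ret)
    else if k = κ ∧ i = c.lo then σ.stat i k + (1 - γ) * (p.ret - V c.lo)
    else σ.stat i k
  { models := σ.models.filter (fun i => ¬ Fails γ ε δ count' stat' i)
    count := count'
    stat := stat'
    phase := none }

/-- The update of the memory when the time-step `s` follows the history `h`. The counters, and so
the outcomes of the tests, change only at the end of an exploration phase. -/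
def update {N : ℕ} (γ ε δ : ℝ) (ν : Fin N → Env A O R) (πs : Fin N → Policy A O R)
    (sel : Finset (Fin N) → History A O R → Choice N) (σ : State N A O R) (h : History A O R)
    (s : Step A O R) : State N A O R :=
  match currentPhase γ ε ν πs sel σ h with
  | none => σ
  | some p =>
    let p' : Phase N A O R :=
      { choice := p.choice, start := p.start, elapsed := p.elapsed + 1,
        ret := p.ret + γ ^ p.elapsed * (s.rew : ℝ) }
    if p'.elapsed < phaseLen γ ε then
      { models := σ.models, count := σ.count, stat := σ.stat, phase := some p' }
    else endPhase γ ε δ ν πs σ p'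

/-- The memory of the algorithm after the history `h`. -/
def stateAt {N : ℕ} (γ ε δ : ℝ) (ν : Fin N → Env A O R) (πs : Fin N → Policy A O R)
    (sel : Finset (Fin N) → History A O R → Choice N) : History A O R → State N A O R
  | [] => { models := Finset.univ, count := fun _ _ => 0, stat := fun _ _ => 0, phase := none }
  | s :: h => update γ ε δ ν πs sel (stateAt γ ε δ ν πs sel h) h s

/-- `π` is a policy of the MERL algorithm with inputs `ε`, `δ` and `ν_1, …, ν_N`. The optimal
policies `πs i` of the models and the maximising triples are chosen arbitrarily; what is done once
no model is left is unspecified. -/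
def IsMERL {N : ℕ} (γ ε δ : ℝ) (ν : Fin N → Env A O R) (π : Policy A O R) : Prop :=
  ∃ (πs : Fin N → Policy A O R) (sel : Finset (Fin N) → History A O R → Choice N),
    (∀ i, IsOptimal γ (ν i) (πs i)) ∧ IsArgmax γ ε ν πs sel ∧
    ∀ (h : History A O R) (hM : (stateAt γ ε δ ν πs sel h).models.Nonempty),
      π h = match currentPhase γ ε ν πs sel (stateAt γ ε δ ν πs sel h) h with
        | some p => πs p.choice.pol h
        | none => πs ((stateAt γ ε δ ν πs sel h).models.min' hM) h

end GeneralRL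

end

/-!
# The sample-complexity of MERL

Fix the true environment `μ = ν i₀`, and let `D` be the length of an exploration phase.

**Markov property.** All expectations over the next `n` time-steps are iterates of the one-step
expectation `stepMean` on functions of the history (`integral_pref`). This gives the Bellman
equations, the existence of optimal policies (`exists_isOptimal`), and Ville's maximal inequality
for functions of the history that are supermartingales along blocks of time-steps (`ville_block`).

**The tests.** In an exploration phase the policy of the phase is followed, so by Hoeffding's lemma
each recorded statistic `X`, whose range has length `1`, exceeds its expectation by a sub-Gaussian
amount. Ville's inequality bounds the probability that the sum of the centred statistics is beyond
the threshold of the test at `α_j` by `δ₁ / α_j`, and `∑ 1 / α_j ≤ 4 √N`. Hence, with high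
probability, no test is disturbed (`IsTypical`); then `μ` is never removed
(`IsTypical.mem_models`), and a model that has passed its test at `m` has a sum of expectations of at
most twice the threshold.

**Exploration phases.** As long as `μ` is in the class, the two statistics of a phase have
nonnegative expectations, which add up to `(1 - γ) Δ`. Summing over the models the bounds that the
last passed tests give shows that there are at most of the order of
`N log(⋯) / (ε² (1 - γ)² 4^κ)` phases with a given `κ` (`IsTypical.phaseCount_le`); the ratio
`α` of consecutive test times is small enough to make up for the increments since the last test. Both
the number of phases and the sum of their `Δ` are then bounded by geometric series in `κ`.

**Failures.** When the algorithm exploits, all models in the class agree up to `ε / 4` on all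
candidate policies, so the policy `π*` of the first model is `3 ε / 4`-optimal, and the actual policy
follows `π*` until the next exploration phase starts, where it loses at most `3 Δ`. So a failure to
be `ε`-optimal forces the expected `Δ` of the next phase within `D` time-steps to be at least `ε / 24`
(`IsFailure.le_firstGap`). The failures are covered by blocks of `D` time-steps, and a supermartingale
argument (`IsRun.failBlocks_tail`) bounds the number of blocks by the sum of all `Δ`, which is
already under control. The errors are at most `D` times the number of blocks and phases, which is
less than `d (Gmax + Emax)`.
-/

noncomputable section

namespace GeneralRL

set_option linter.unusedSectionVars false

variable {A O : Type*} {R : Finset ℝ}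

variable [Finite A] [Finite O]

/-! ### The one-step expectation operator -/

/-- The one-step expectation `E[f (s :: h)]`, where the time-step `s` follows the history `h`.
Its iterates compute all finite-horizon expectations, see `integral_pref`. -/
def stepMean (μ : Env A O R) (π : Policy A O R) (f : History A O R → ℝ) (h : History A O R) : ℝ :=
  ∫ s, f (s :: h) ∂(stepLaw μ π h)

section StepMean

variable (μ : Env A O R) (π : Policy A O R)

lemma stepMean_mono_at {f g : History A O R → ℝ} {h : History A O R}
    (hfg : ∀ s, f (s :: h) ≤ g (s :: h)) : stepMean μ π f h ≤ stepMean μ π g h :=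
  integral_mono (Integrable.of_finite) (Integrable.of_finite) hfg

lemma stepMean_congr_at {f g : History A O R → ℝ} {h : History A O R}
    (hfg : ∀ s, f (s :: h) = g (s :: h)) : stepMean μ π f h = stepMean μ π g h :=
  integral_congr_ae (Eventually.of_forall hfg)

lemma stepMean_const (c : ℝ) (h : History A O R) : stepMean μ π (fun _ => c) h = c := by
  simp [stepMean]

lemma stepMean_add (f g : History A O R → ℝ) (h : History A O R) :
    stepMean μ π (fun l => f l + g l) h = stepMean μ π f h + stepMean μ π g h :=
  integral_add (Integrable.of_finite) (Integrable.of_finite)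

lemma stepMean_sub (f g : History A O R → ℝ) (h : History A O R) :
    stepMean μ π (fun l => f l - g l) h = stepMean μ π f h - stepMean μ π g h :=
  integral_sub (Integrable.of_finite) (Integrable.of_finite)

lemma stepMean_mul (c : ℝ) (f : History A O R → ℝ) (h : History A O R) :
    stepMean μ π (fun l => c * f l) h = c * stepMean μ π f h :=
  integral_const_mul c _

lemma stepMean_sum {ι : Type*} (t : Finset ι) (f : ι → History A O R → ℝ) (h : History A O R) :
    stepMean μ π (fun l => ∑ k ∈ t, f k l) h = ∑ k ∈ t, stepMean μ π (f k) h :=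
  integral_finsetSum t fun _ _ => Integrable.of_finite

lemma stepMean_policy_congr {μ : Env A O R} {π π' : Policy A O R} {h : History A O R}
    (hπ : π h = π' h) (f : History A O R → ℝ) : stepMean μ π f h = stepMean μ π' f h := by
  simp only [stepMean, stepLaw, hπ]

lemma iterate_stepMean_mono_at {f g : History A O R → ℝ} (n : ℕ) {h : History A O R}
    (hfg : ∀ l, l.length = n → f (l ++ h) ≤ g (l ++ h)) :
    (stepMean μ π)^[n] f h ≤ (stepMean μ π)^[n] g h := by
  induction n generalizing h with
  | zero => exact hfg [] rfl
  | succ n ih =>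
    rw [Function.iterate_succ_apply', Function.iterate_succ_apply']
    refine stepMean_mono_at μ π fun s => ih fun l hl => ?_
    have := hfg (l ++ [s]) (by simp [hl])
    simpa using this

lemma iterate_stepMean_congr_at {f g : History A O R → ℝ} (n : ℕ) {h : History A O R}
    (hfg : ∀ l, l.length = n → f (l ++ h) = g (l ++ h)) :
    (stepMean μ π)^[n] f h = (stepMean μ π)^[n] g h :=
  le_antisymm (iterate_stepMean_mono_at μ π n fun l hl => (hfg l hl).le)
    (iterate_stepMean_mono_at μ π n fun l hl => (hfg l hl).ge)

lemma iterate_stepMean_const (n : ℕ) (c : ℝ) (h : History A O R) :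
    (stepMean μ π)^[n] (fun _ => c) h = c := by
  induction n generalizing h with
  | zero => rfl
  | succ n ih =>
    rw [Function.iterate_succ_apply', stepMean_congr_at μ π (g := fun _ => c) fun s => ih _,
      stepMean_const]

lemma iterate_stepMean_mul (n : ℕ) (c : ℝ) (f : History A O R → ℝ) (h : History A O R) :
    (stepMean μ π)^[n] (fun l => c * f l) h = c * (stepMean μ π)^[n] f h := by
  induction n generalizing h with
  | zero => rfl
  | succ n ih =>
    rw [Function.iterate_succ_apply', Function.iterate_succ_apply',
      stepMean_congr_at μ π (g := fun l => c * (stepMean μ π)^[n] f l) fun s => ih _, stepMean_mul]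

end StepMean

/-! ### The law of the interaction -/

lemma pref_zero (ω : ℕ → Step A O R) : pref ω 0 = [] := by simp [pref, histOf]

lemma pref_succ (ω : ℕ → Step A O R) (n : ℕ) : pref ω (n + 1) = ω n :: pref ω n := by
  rw [pref, histOf, List.ofFn_succ_last, List.reverse_append]
  simp [pref, histOf]

lemma exists_pref_eq (l : History A O R) (hl : l ≠ []) :
    ∃ ω : ℕ → Step A O R, pref ω l.length = l := by
  refine ⟨fun i => l.reverse.getD i (l.head hl), ?_⟩
  have h : (List.ofFn fun i : Fin l.length => l.reverse.getD i (l.head hl)) = l.reverse := by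
    apply List.ext_getElem
    · simp
    · intro i h1 h2
      simp only [List.getElem_ofFn]
      rw [List.getD_eq_getElem]
  simp only [pref, histOf]
  rw [h, List.reverse_reverse]

instance (μ : Env A O R) (π : Policy A O R) (h : History A O R) :
    IsProbabilityMeasure (lawFrom μ π h) := by
  unfold lawFrom; infer_instance

instance (μ : Env A O R) (π : Policy A O R) : IsProbabilityMeasure (law μ π) := by
  unfold law; infer_instance

lemma measurable_comp_pref {β : Type*} [MeasurableSpace β] (f : History A O R → β) (n : ℕ) :
    Measurable (fun ω : ℕ → Step A O R => f (pref ω n)) := by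
  have h : Measurable (fun (ω : ℕ → Step A O R) (i : Fin n) => ω i) := by fun_prop
  exact (Measurable.of_discrete (f := fun x : Fin n → Step A O R => f (histOf x))).comp h

lemma integrable_comp_pref (P : Measure (ℕ → Step A O R)) [IsFiniteMeasure P]
    (f : History A O R → ℝ) (n : ℕ) : Integrable (fun ω => f (pref ω n)) P := by
  have hfin : (Set.range fun x : Fin n → Step A O R => f (histOf x)).Finite := Set.finite_range _
  obtain ⟨C, hC⟩ := (hfin.image fun x => ‖x‖).bddAbove
  refine Integrable.of_bound (measurable_comp_pref f n).aestronglyMeasurable C ?_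
  exact Eventually.of_forall fun ω => hC ⟨f (pref ω n), ⟨fun i => ω i, rfl⟩, rfl⟩

section Law

variable (μ : Env A O R) (π : Policy A O R)

lemma map_zero_lawFrom (h : History A O R) :
    (lawFrom μ π h).map (fun ω => ω 0) = stepLaw μ π h := by
  set e := (MeasurableEquiv.piUnique (fun i : Finset.Iic 0 => Step A O R)).symm
  have h1 : (lawFrom μ π h).map (Preorder.frestrictLe 0) = (stepLaw μ π h).map e := by
    rw [lawFrom, Kernel.trajMeasure, Measure.map_comp _ _ (by fun_prop),
      Kernel.traj_map_frestrictLe, Kernel.partialTraj_self, Measure.id_comp]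
  have h2 : (fun ω : ℕ → Step A O R => ω 0) =
      (fun x : (i : Finset.Iic 0) → Step A O R => x ⟨0, by simp⟩) ∘ Preorder.frestrictLe 0 := rfl
  rw [h2, ← Measure.map_map (by fun_prop) (by fun_prop), h1, Measure.map_map (by fun_prop)
    (by fun_prop)]
  have h3 : ((fun x : (i : Finset.Iic 0) → Step A O R => x ⟨0, by simp⟩) ∘ e) = id := by
    funext x
    rfl
  rw [h3, Measure.map_id]

/-- Conditioning on all time-steps but the last one. -/
lemma integral_pref_succ (f : History A O R → ℝ) (n : ℕ) (h : History A O R) :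
    ∫ ω, f (pref ω (n + 1) ++ h) ∂(lawFrom μ π h) =
      ∫ ω, stepMean μ π f (pref ω n ++ h) ∂(lawFrom μ π h) := by
  cases n with
  | zero =>
    simp only [pref_succ, pref_zero, List.nil_append, List.cons_append, integral_const,
      probReal_univ, one_smul]
    rw [stepMean, ← map_zero_lawFrom μ π h, integral_map (measurable_pi_apply 0).aemeasurable]
    exact (Measurable.of_discrete (f := fun s => f (s :: h))).aestronglyMeasurable
  | succ n =>
    have key := Kernel.map_frestrictLe_trajMeasure_compProd_eq_map_trajMeasure
      (X := fun _ => Step A O R) (μ₀ := stepLaw μ π h) (κ := stepKernel μ π h) (a := n)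
    set H : ((i : Finset.Iic n) → Step A O R) → History A O R := fun x =>
      histOf (fun i : Fin (n + 1) => x ⟨i, Finset.mem_Iic.2 (Nat.lt_succ_iff.1 i.2)⟩) ++ h with hH
    have e1 : (fun ω : ℕ → Step A O R => f (pref ω (n + 1 + 1) ++ h)) =
        fun ω => (fun q : ((i : Finset.Iic n) → Step A O R) × Step A O R => f (q.2 :: H q.1))
          (Preorder.frestrictLe (π := fun _ => Step A O R) n ω, ω (n + 1)) := by
      funext ω
      rw [pref_succ]
      rfl
    have hm : Measurable
        (fun q : ((i : Finset.Iic n) → Step A O R) × Step A O R => f (q.2 :: H q.1)) :=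
      Measurable.of_discrete
    change _ = ∫ ω, (fun x => stepMean μ π f (H x)) (Preorder.frestrictLe n ω) ∂(lawFrom μ π h)
    rw [e1, ← integral_map (φ := fun ω : ℕ → Step A O R =>
      (Preorder.frestrictLe (π := fun _ => Step A O R) n ω, ω (n + 1))) (by fun_prop)
      hm.aestronglyMeasurable, ← integral_map (by fun_prop)
      (Measurable.of_discrete (f := fun x => stepMean μ π f (H x))).aestronglyMeasurable]
    unfold lawFrom
    have : IsProbabilityMeasure ((Kernel.trajMeasure (X := fun _ => Step A O R) (stepLaw μ π h)
        (stepKernel μ π h)).map (Preorder.frestrictLe n)) :=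
      Measure.isProbabilityMeasure_map (by fun_prop)
    rw [← key, Measure.integral_compProd Integrable.of_finite]
    rfl

/-- The iterates of `stepMean` are the expectations of functions of finite continuations. -/
theorem integral_pref (f : History A O R → ℝ) (n : ℕ) (h : History A O R) :
    ∫ ω, f (pref ω n ++ h) ∂(lawFrom μ π h) = (stepMean μ π)^[n] f h := by
  induction n generalizing f with
  | zero => simp [pref_zero]
  | succ n ih => rw [integral_pref_succ, ih, Function.iterate_succ_apply]

lemma integral_law_pref (f : History A O R → ℝ) (n : ℕ) :
    ∫ ω, f (pref ω n) ∂(law μ π) = (stepMean μ π)^[n] f [] := by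
  rw [← integral_pref]
  simp [law]

/-! ### Ville's inequality -/

/-- Some prefix of the history (itself included) lies in `B`. -/
def Hits (B : Set (History A O R)) : History A O R → Prop
  | [] => [] ∈ B
  | s :: h => s :: h ∈ B ∨ Hits B h

lemma hits_pref (B : Set (History A O R)) (ω : ℕ → Step A O R) (n : ℕ) :
    Hits B (pref ω n) ↔ ∃ t ≤ n, pref ω t ∈ B := by
  induction n with
  | zero => simp [pref_zero, Hits]
  | succ n ih =>
    rw [pref_succ, Hits, ← pref_succ, ih]
    constructor
    · rintro (h | ⟨t, ht, h⟩)
      exacts [⟨n + 1, le_rfl, h⟩, ⟨t, by omega, h⟩]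
    · rintro ⟨t, ht, h⟩
      rcases Nat.lt_or_ge n t with h' | h'
      · obtain rfl : t = n + 1 := by omega
        exact Or.inl h
      · exact Or.inr ⟨t, h', h⟩

open Classical in
/-- The process `W` stopped when the history enters `B`. -/
def stopped (B : Set (History A O R)) (W : History A O R → ℝ) : History A O R → ℝ
  | [] => W []
  | s :: h => if Hits B h then stopped B W h else W (s :: h)

lemma stopped_of_not_hits {B : Set (History A O R)} (W : History A O R → ℝ) {h : History A O R}
    (hh : ¬ Hits B h) : stopped B W h = W h := by
  cases h with
  | nil => rfl
  | cons s h => rw [stopped, if_neg fun h' => hh (Or.inr h')]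

lemma stopped_nonneg {B : Set (History A O R)} {W : History A O R → ℝ} (hW : ∀ h, 0 ≤ W h)
    (h : History A O R) : 0 ≤ stopped B W h := by
  induction h with
  | nil => exact hW []
  | cons s h ih => rw [stopped]; split_ifs; exacts [ih, hW _]

lemma le_stopped_of_hits {B : Set (History A O R)} {W : History A O R → ℝ} {c : ℝ}
    (hB : ∀ h ∈ B, c ≤ W h) (h : History A O R) (hh : Hits B h) : c ≤ stopped B W h := by
  induction h with
  | nil => exact hB [] hh
  | cons s h ih =>
    rw [stopped]
    split_ifs with h'
    · exact ih h'
    · exact hB _ (hh.resolve_right h')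

/-- **Ville's inequality** for nonnegative supermartingales that are functions of the history. -/
theorem ville {W : History A O R → ℝ} (hW : ∀ h, 0 ≤ W h) (hT : ∀ h, stepMean μ π W h ≤ W h)
    {B : Set (History A O R)} {c : ℝ} (hc : 0 < c) (hB : ∀ h ∈ B, c ≤ W h) :
    law μ π {ω | ∃ t, pref ω t ∈ B} ≤ ENNReal.ofReal (W [] / c) := by
  have hT' : ∀ h, stepMean μ π (stopped B W) h ≤ stopped B W h := by
    intro h
    by_cases hh : Hits B h
    · refine (stepMean_congr_at μ π (g := fun _ => stopped B W h) fun s => ?_).le.trans_eq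
        (stepMean_const _ _ _ _)
      rw [stopped, if_pos hh]
    · rw [stopped_of_not_hits W hh]
      refine (stepMean_congr_at μ π (g := W) fun s => ?_).le.trans (hT h)
      rw [stopped, if_neg hh]
  have hT'' : ∀ n h, (stepMean μ π)^[n] (stopped B W) h ≤ stopped B W h := by
    intro n
    induction n with
    | zero => exact fun h => le_rfl
    | succ n ih =>
      intro h
      rw [Function.iterate_succ_apply']
      exact (stepMean_mono_at μ π fun s => ih _).trans (hT' h)
  have hset : {ω : ℕ → Step A O R | ∃ t, pref ω t ∈ B} = ⋃ n, {ω | Hits B (pref ω n)} := by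
    ext ω
    simp only [Set.mem_ofPred_eq, Set.mem_iUnion, hits_pref]
    exact ⟨fun ⟨t, h⟩ => ⟨t, t, le_rfl, h⟩, fun ⟨_, t, _, h⟩ => ⟨t, h⟩⟩
  have hmono : Monotone fun n => {ω : ℕ → Step A O R | Hits B (pref ω n)} := by
    intro m n hmn ω hω
    simp only [Set.mem_ofPred_eq, hits_pref] at hω ⊢
    obtain ⟨t, ht, h⟩ := hω
    exact ⟨t, ht.trans hmn, h⟩
  rw [hset, hmono.measure_iUnion]
  refine iSup_le fun n => ?_
  have h1 : c * (law μ π).real {ω | c ≤ stopped B W (pref ω n)} ≤ W [] := by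
    refine (mul_meas_ge_le_integral_of_nonneg (Eventually.of_forall fun ω => stopped_nonneg hW _)
      (integrable_comp_pref _ _ n) c).trans ?_
    rw [integral_law_pref]
    exact hT'' n []
  refine (measure_mono (t := {ω | c ≤ stopped B W (pref ω n)}) fun ω hω =>
    le_stopped_of_hits hB _ hω).trans ?_
  rw [← ofReal_measureReal]
  exact ENNReal.ofReal_le_ofReal ((le_div_iff₀' hc).2 h1)

/-- Ville's inequality for a process `Φ` that is a supermartingale only along blocks of time-steps:
`r h` is the number of time-steps left in the block in progress at `h`, and at the start of a block
of length `b + 1` the expectation of `Φ` at its end is at most its current value. -/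
theorem ville_block {Φ : History A O R → ℝ} (hΦ : ∀ h, 0 ≤ Φ h) {r : History A O R → ℕ}
    (hr0 : r [] = 0) (hr : ∀ h k s, r h = k + 1 → r (s :: h) = k)
    (hb : ∀ h, r h = 0 → ∃ b, (∀ s, r (s :: h) = b) ∧ (stepMean μ π)^[b + 1] Φ h ≤ Φ h)
    {B : Set (History A O R)} {c : ℝ} (hc : 0 < c) (hB : ∀ h ∈ B, r h = 0 ∧ c ≤ Φ h) :
    law μ π {ω | ∃ t, pref ω t ∈ B} ≤ ENNReal.ofReal (Φ [] / c) := by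
  have hnn : ∀ n h, 0 ≤ (stepMean μ π)^[n] Φ h := fun n h => by
    rw [← iterate_stepMean_const μ π n 0 h]
    exact iterate_stepMean_mono_at μ π n fun l _ => hΦ _
  have := ville μ π (W := fun h => (stepMean μ π)^[r h] Φ h) (fun h => hnn _ _) ?_ hc
    (B := B) ?_
  · simpa only [hr0, Function.iterate_zero, id_eq] using this
  · intro h
    rcases hk : r h with _ | k
    · obtain ⟨b, hb1, hb2⟩ := hb h hk
      refine (stepMean_congr_at μ π (g := (stepMean μ π)^[b] Φ) fun s => ?_).le.trans ?_
      · simp only [hb1]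
      · rwa [← Function.iterate_succ_apply' (stepMean μ π)]
    · rw [Function.iterate_succ_apply']
      exact (stepMean_congr_at μ π fun s => by simp only [hr h k s hk]).le
  · intro h hh
    obtain ⟨h1, h2⟩ := hB h hh
    simpa only [h1, Function.iterate_zero, id_eq] using h2

end Law

/-! ### Values -/

/-- The expected reward of the next time-step. -/
def meanRew (μ : Env A O R) (π : Policy A O R) (h : History A O R) : ℝ :=
  ∫ s, (s.rew : ℝ) ∂(stepLaw μ π h)

section Values

variable {γ : ℝ} (μ : Env A O R) (π : Policy A O R)

lemma integrable_rew (P : Measure (ℕ → Step A O R)) [IsFiniteMeasure P] (k : ℕ) :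
    Integrable (fun ω => ((ω k).rew : ℝ)) P := by
  have := integrable_comp_pref P
    (fun l => match l with | [] => 0 | s :: _ => (s.rew : ℝ)) (k + 1)
  simpa only [pref_succ] using this

lemma integral_rew (h : History A O R) (k : ℕ) :
    ∫ ω, ((ω k).rew : ℝ) ∂(lawFrom μ π h) = (stepMean μ π)^[k] (meanRew μ π) h := by
  have := integral_pref μ π
    (fun l => match l with | [] => 0 | s :: _ => (s.rew : ℝ)) (k + 1) h
  simp only [pref_succ, List.cons_append, Function.iterate_succ_apply] at this
  exact this

lemma valueN_eq_sum (h : History A O R) (n : ℕ) :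
    valueN γ μ π h n = ∑ k ∈ Finset.range n, γ ^ k * (stepMean μ π)^[k] (meanRew μ π) h := by
  simp only [valueN, ret]
  rw [integral_finsetSum _ fun k _ => (integrable_rew _ k).const_mul _]
  exact Finset.sum_congr rfl fun k _ => by rw [integral_const_mul, integral_rew]

lemma valueN_zero (h : History A O R) : valueN γ μ π h 0 = 0 := by simp [valueN_eq_sum]

/-- The Bellman equation for finite horizons. -/
lemma valueN_succ (h : History A O R) (n : ℕ) :
    valueN γ μ π h (n + 1) =
      meanRew μ π h + γ * stepMean μ π (fun l => valueN γ μ π l n) h := by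
  simp only [valueN_eq_sum]
  rw [Finset.sum_range_succ', stepMean_sum, Finset.mul_sum, add_comm]
  congr 1
  · simp
  · refine Finset.sum_congr rfl fun k _ => ?_
    rw [stepMean_mul, Function.iterate_succ_apply', pow_succ]
    ring

lemma meanRew_policy_congr {μ : Env A O R} {π π' : Policy A O R} {h : History A O R}
    (hπ : π h = π' h) : meanRew μ π h = meanRew μ π' h := by
  simp only [meanRew, stepLaw, hπ]

/-- The `n`-step value depends only on the next `n` actions. -/
lemma valueN_policy_congr {μ : Env A O R} {π π' : Policy A O R} {h : History A O R} {n : ℕ}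
    (hπ : ∀ l : History A O R, l.length < n → π (l ++ h) = π' (l ++ h)) :
    valueN γ μ π h n = valueN γ μ π' h n := by
  induction n generalizing h with
  | zero => rw [valueN_zero, valueN_zero]
  | succ n ih =>
    have h0 : π h = π' h := hπ [] (by simp)
    rw [valueN_succ, valueN_succ, meanRew_policy_congr h0, stepMean_policy_congr h0]
    have h1 : stepMean μ π' (fun l => valueN γ μ π l n) h =
        stepMean μ π' (fun l => valueN γ μ π' l n) h := by
      refine stepMean_congr_at μ π' fun s => ih fun l hl => ?_
      have := hπ (l ++ [s]) (by simpa using hl)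
      simpa using this
    rw [h1]

variable (hR : ∀ r ∈ R, 0 ≤ r ∧ r ≤ 1)

include hR

lemma meanRew_nonneg (h : History A O R) : 0 ≤ meanRew μ π h :=
  integral_nonneg fun s => (hR _ s.rew.2).1

lemma meanRew_le_one (h : History A O R) : meanRew μ π h ≤ 1 := by
  have : meanRew μ π h ≤ ∫ _, (1 : ℝ) ∂(stepLaw μ π h) :=
    integral_mono Integrable.of_finite Integrable.of_finite fun s => (hR _ s.rew.2).2
  simpa using this

lemma iterate_meanRew_mem_Icc (k : ℕ) (h : History A O R) :
    (stepMean μ π)^[k] (meanRew μ π) h ∈ Set.Icc (0 : ℝ) 1 := by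
  constructor
  · rw [← iterate_stepMean_const μ π k 0 h]
    exact iterate_stepMean_mono_at μ π k fun l _ => meanRew_nonneg μ π hR _
  · conv_rhs => rw [← iterate_stepMean_const μ π k 1 h]
    exact iterate_stepMean_mono_at μ π k fun l _ => meanRew_le_one μ π hR _

variable (hγ0 : 0 < γ) (hγ1 : γ < 1)

include hγ0

lemma ret_nonneg (d : ℕ) (ω : ℕ → Step A O R) : 0 ≤ ret γ d ω :=
  Finset.sum_nonneg fun k _ => mul_nonneg (pow_nonneg hγ0.le k) (hR _ (ω k).rew.2).1

lemma valueN_nonneg (h : History A O R) (n : ℕ) : 0 ≤ valueN γ μ π h n := by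
  rw [valueN_eq_sum]
  exact Finset.sum_nonneg fun k _ =>
    mul_nonneg (pow_nonneg hγ0.le k) (iterate_meanRew_mem_Icc μ π hR k h).1

include hγ1

lemma ret_le (d : ℕ) (ω : ℕ → Step A O R) : ret γ d ω ≤ 1 / (1 - γ) := by
  have h1 : ret γ d ω ≤ ∑ k ∈ Finset.range d, γ ^ k := by
    refine Finset.sum_le_sum fun k _ => ?_
    exact mul_le_of_le_one_right (pow_nonneg hγ0.le k) (hR _ (ω k).rew.2).2
  refine h1.trans ?_
  rw [one_div, ← tsum_geometric_of_lt_one hγ0.le hγ1]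
  exact (summable_geometric_of_lt_one hγ0.le hγ1).sum_le_tsum _ fun k _ => pow_nonneg hγ0.le k

lemma hasSum_value (h : History A O R) :
    HasSum (fun k => γ ^ k * (stepMean μ π)^[k] (meanRew μ π) h) (value γ μ π h) := by
  have hs : Summable (fun k => γ ^ k * (stepMean μ π)^[k] (meanRew μ π) h) := by
    refine Summable.of_nonneg_of_le (fun k => mul_nonneg (pow_nonneg hγ0.le k)
      (iterate_meanRew_mem_Icc μ π hR k h).1) (fun k => ?_)
      (summable_geometric_of_lt_one hγ0.le hγ1)
    exact mul_le_of_le_one_right (pow_nonneg hγ0.le k) (iterate_meanRew_mem_Icc μ π hR k h).2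
  convert hs.hasSum
  rw [value]
  refine Tendsto.limUnder_eq ?_
  simp only [valueN_eq_sum]
  exact hs.hasSum.tendsto_sum_nat

lemma tendsto_valueN (h : History A O R) :
    Tendsto (fun n => valueN γ μ π h n) atTop (𝓝 (value γ μ π h)) := by
  simp only [valueN_eq_sum]
  exact (hasSum_value μ π hR hγ0 hγ1 h).tendsto_sum_nat

lemma valueN_le_value (h : History A O R) (n : ℕ) : valueN γ μ π h n ≤ value γ μ π h := by
  rw [valueN_eq_sum]
  exact sum_le_hasSum _ (fun k _ => mul_nonneg (pow_nonneg hγ0.le k)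
      (iterate_meanRew_mem_Icc μ π hR k h).1) (hasSum_value μ π hR hγ0 hγ1 h)

lemma value_nonneg (h : History A O R) : 0 ≤ value γ μ π h :=
  (valueN_nonneg μ π hR hγ0 h 0).trans (valueN_le_value μ π hR hγ0 hγ1 h 0)

lemma valueN_le (h : History A O R) (n : ℕ) : valueN γ μ π h n ≤ 1 / (1 - γ) := by
  have hi : Integrable (fun ω => ret γ n ω) (lawFrom μ π h) := by
    simp only [ret]
    exact integrable_finsetSum _ fun k _ => (integrable_rew _ k).const_mul _
  have := integral_mono hi (integrable_const (1 / (1 - γ)))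
    fun ω => ret_le hR hγ0 hγ1 n ω
  simpa [valueN] using this

lemma value_le (h : History A O R) : value γ μ π h ≤ 1 / (1 - γ) :=
  le_of_tendsto' (tendsto_valueN μ π hR hγ0 hγ1 h) fun n => valueN_le μ π hR hγ0 hγ1 h n

/-- The Bellman equation. -/
lemma value_eq (h : History A O R) :
    value γ μ π h = meanRew μ π h + γ * stepMean μ π (value γ μ π) h := by
  have h1 := (tendsto_valueN μ π hR hγ0 hγ1 h).comp (tendsto_add_atTop_nat 1)
  have h2 : Tendsto (fun n => stepMean μ π (fun l => valueN γ μ π l n) h) atTop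
      (𝓝 (stepMean μ π (value γ μ π) h)) := by
    refine tendsto_integral_of_dominated_convergence (fun _ => 1 / (1 - γ))
      (fun n => Measurable.of_discrete.aestronglyMeasurable) (integrable_const _)
      (fun n => Eventually.of_forall fun s => ?_)
      (Eventually.of_forall fun s => tendsto_valueN μ π hR hγ0 hγ1 _)
    rw [Real.norm_of_nonneg (valueN_nonneg μ π hR hγ0 _ n)]
    exact valueN_le μ π hR hγ0 hγ1 _ n
  refine tendsto_nhds_unique h1 (((h2.const_mul γ).const_add (meanRew μ π h)).congr fun n => ?_)
  exact (valueN_succ μ π h n).symm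

lemma value_le_valueN_add (h : History A O R) (n : ℕ) :
    value γ μ π h ≤ valueN γ μ π h n + γ ^ n * (1 / (1 - γ)) := by
  induction n generalizing h with
  | zero => simpa [valueN_zero] using value_le μ π hR hγ0 hγ1 h
  | succ n ih =>
    rw [value_eq μ π hR hγ0 hγ1, valueN_succ]
    have h1 : stepMean μ π (value γ μ π) h ≤
        stepMean μ π (fun l => valueN γ μ π l n + γ ^ n * (1 / (1 - γ))) h :=
      stepMean_mono_at μ π fun s => ih _
    rw [stepMean_add μ π (fun l => valueN γ μ π l n) (fun _ => γ ^ n * (1 / (1 - γ))),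
      stepMean_const] at h1
    have := mul_le_mul_of_nonneg_left h1 hγ0.le
    rw [pow_succ]
    linarith

end Values

/-! ### Existence of optimal policies -/

section Optimal

variable {γ : ℝ} (μ : Env A O R)

/-- The expected reward of the action `a`, plus `γ` times the expectation of the future value `f`. -/
def actionValue (γ : ℝ) (μ : Env A O R) (f : History A O R → ℝ) (h : History A O R) (a : A) : ℝ :=
  meanRew μ (fun _ => a) h + γ * stepMean μ (fun _ => a) f h

/-- The optimal value for the horizon `n`, by backward induction. -/
def optValueN (γ : ℝ) (μ : Env A O R) : ℕ → History A O R → ℝ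
  | 0 => fun _ => 0
  | n + 1 => fun h => ⨆ a, actionValue γ μ (optValueN γ μ n) h a

lemma actionValue_policy (f : History A O R → ℝ) (π : Policy A O R) (h : History A O R) :
    actionValue γ μ f h (π h) = meanRew μ π h + γ * stepMean μ π f h := by
  rw [actionValue, meanRew_policy_congr (π := fun _ => π h) (π' := π) rfl,
    stepMean_policy_congr (π := fun _ => π h) (π' := π) rfl]

lemma actionValue_mono (hγ0 : 0 < γ) {f g : History A O R → ℝ} (hfg : ∀ l, f l ≤ g l)
    (h : History A O R) (a : A) : actionValue γ μ f h a ≤ actionValue γ μ g h a := by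
  have := mul_le_mul_of_nonneg_left
    (stepMean_mono_at μ (fun _ => a) (h := h) fun s => hfg (s :: h)) hγ0.le
  simp only [actionValue]
  linarith

variable (hR : ∀ r ∈ R, 0 ≤ r ∧ r ≤ 1) (hγ0 : 0 < γ) (hγ1 : γ < 1)

include hR hγ0 hγ1

lemma optValueN_le [Nonempty A] (n : ℕ) (h : History A O R) :
    optValueN γ μ n h ≤ 1 / (1 - γ) := by
  have hg : (0 : ℝ) < 1 - γ := by linarith
  induction n generalizing h with
  | zero => exact (one_div_pos.2 hg).le
  | succ n ih =>
    refine ciSup_le fun a => (actionValue_mono μ hγ0 ih h a).trans ?_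
    rw [actionValue, stepMean_const]
    have := meanRew_le_one μ (fun _ => a) hR h
    calc _ ≤ 1 + γ * (1 / (1 - γ)) := by linarith
      _ = 1 / (1 - γ) := by field_simp; ring

lemma valueN_le_optValueN (π : Policy A O R) (n : ℕ) (h : History A O R) :
    valueN γ μ π h n ≤ optValueN γ μ n h := by
  induction n generalizing h with
  | zero => rw [valueN_zero]; exact le_rfl
  | succ n ih =>
    rw [valueN_succ, ← actionValue_policy]
    exact (actionValue_mono μ hγ0 ih h _).trans
      (le_ciSup (f := actionValue γ μ (optValueN γ μ n) h) (Set.finite_range _).bddAbove (π h))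

/-- Optimal policies exist: a policy which is greedy for the supremum `v` of the finite-horizon
optimal values attains `v`, and no policy exceeds `v`. -/
theorem exists_isOptimal [Nonempty A] : ∃ π : Policy A O R, IsOptimal γ μ π := by
  set v : History A O R → ℝ := fun h => ⨆ n, optValueN γ μ n h with hv
  have hbdd : ∀ h, BddAbove (Set.range fun n => optValueN γ μ n h) := fun h =>
    ⟨1 / (1 - γ), by rintro _ ⟨n, rfl⟩; exact optValueN_le μ hR hγ0 hγ1 n h⟩
  have hle : ∀ n h, optValueN γ μ n h ≤ v h := fun n h => le_ciSup (hbdd h) n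
  have hgreedy : ∀ h, ∃ a, v h ≤ actionValue γ μ v h a := by
    intro h
    obtain ⟨a, ha⟩ := exists_eq_ciSup_of_finite (f := actionValue γ μ v h)
    refine ⟨a, ciSup_le fun n => ?_⟩
    cases n with
    | zero =>
      have h1 := meanRew_nonneg μ (fun _ => a) hR h
      have h2 : stepMean μ (fun _ => a) (fun _ => 0) h ≤ stepMean μ (fun _ => a) v h :=
        stepMean_mono_at μ _ fun s => hle 0 _
      rw [stepMean_const] at h2
      exact add_nonneg h1 (mul_nonneg hγ0.le h2)
    | succ n =>
      rw [ha]
      exact ciSup_mono (Set.finite_range _).bddAbove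
        fun a => actionValue_mono μ hγ0 (hle n) h a
  choose g hg using hgreedy
  have hvg : ∀ n h, v h ≤ valueN γ μ g h n + γ ^ n * (1 / (1 - γ)) := by
    intro n
    induction n with
    | zero =>
      intro h
      simpa [valueN_zero] using ciSup_le fun n => optValueN_le μ hR hγ0 hγ1 n h
    | succ n ih =>
      intro h
      refine (hg h).trans ((actionValue_mono μ hγ0 ih h _).trans ?_)
      rw [actionValue_policy, stepMean_add μ g (fun l => valueN γ μ g l n)
        (fun _ => γ ^ n * (1 / (1 - γ))), stepMean_const, valueN_succ, pow_succ]
      linarith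
  refine ⟨g, fun π' h => ?_⟩
  have h1 : value γ μ π' h ≤ v h := le_of_tendsto' (tendsto_valueN μ π' hR hγ0 hγ1 h)
    fun n => (valueN_le_optValueN μ hR hγ0 hγ1 π' n h).trans (hle n h)
  have h2 : v h ≤ value γ μ g h := by
    have ht : Tendsto (fun n => valueN γ μ g h n + γ ^ n * (1 / (1 - γ))) atTop
        (𝓝 (value γ μ g h + 0 * (1 / (1 - γ)))) :=
      (tendsto_valueN μ g hR hγ0 hγ1 h).add
        ((tendsto_pow_atTop_nhds_zero_of_lt_one hγ0.le hγ1).mul_const _)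
    rw [zero_mul, add_zero] at ht
    exact ge_of_tendsto' ht fun n => hvg n h
  exact h1.trans h2

omit hR hγ0 hγ1 in
lemma IsOptimal.optValue_eq {μ : Env A O R} {π : Policy A O R} (hπ : IsOptimal γ μ π)
    (h : History A O R) : optValue γ μ h = value γ μ π h := by
  have : Nonempty (Policy A O R) := ⟨π⟩
  exact le_antisymm (ciSup_le fun π' => hπ π' h)
    (le_ciSup (f := fun π' => value γ μ π' h)
      ⟨value γ μ π h, by rintro _ ⟨π', rfl⟩; exact hπ π' h⟩ π)

end Optimal

/-! ### The dynamics of the algorithm -/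

/-- Everything that is assumed of the interaction: the ranges of the constants and of the rewards,
and that `π` is the policy of the algorithm for the optimal policies `πs` and the choices `sel`. -/
structure IsRun {N : ℕ} (γ ε δ : ℝ) (ν : Fin N → Env A O R) (π : Policy A O R)
    (πs : Fin N → Policy A O R) (sel : Finset (Fin N) → History A O R → Choice N) : Prop where
  rew : ∀ r ∈ R, 0 ≤ r ∧ r ≤ 1
  γ_pos : 0 < γ
  γ_lt : γ < 1
  ε_pos : 0 < ε
  small : ε * (1 - γ) ≤ 1
  δ_pos : 0 < δ
  δ_lt : δ < 1
  opt : ∀ i, IsOptimal γ (ν i) (πs i)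
  argmax : IsArgmax γ ε ν πs sel
  follow : ∀ (h : History A O R) (hM : (stateAt γ ε δ ν πs sel h).models.Nonempty),
      π h = match currentPhase γ ε ν πs sel (stateAt γ ε δ ν πs sel h) h with
        | some p => πs p.choice.pol h
        | none => πs ((stateAt γ ε δ ν πs sel h).models.min' hM) h

/-- The exploration phase `p` after the further time-step `s`. -/
def Phase.next {N : ℕ} (γ : ℝ) (p : Phase N A O R) (s : Step A O R) : Phase N A O R :=
  { choice := p.choice, start := p.start, elapsed := p.elapsed + 1,
    ret := p.ret + γ ^ p.elapsed * (s.rew : ℝ) }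

section Dynamics

variable {N : ℕ} (γ ε δ : ℝ) (ν : Fin N → Env A O R) (πs : Fin N → Policy A O R)
  (sel : Finset (Fin N) → History A O R → Choice N)

local notation "St" => stateAt γ ε δ ν πs sel

/-- The exploration phase that is in progress or starts at the history `h`. -/
def curPhase (h : History A O R) : Option (Phase N A O R) :=
  currentPhase γ ε ν πs sel (stateAt γ ε δ ν πs sel h) h

local notation "Cur" => curPhase γ ε δ ν πs sel

/-- The exploration phases completed in the history, the newest first. -/
def phases : History A O R → List (Phase N A O R)
  | [] => []
  | s :: h =>
    match curPhase γ ε δ ν πs sel h with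
    | none => phases h
    | some p => if p.elapsed + 1 < phaseLen γ ε then phases h else p.next γ s :: phases h

local notation "Phs" => phases γ ε δ ν πs sel

/-- An exploration phase starts at the history `h`. -/
def Starts (h : History A O R) : Prop :=
  (St h).phase = none ∧ (St h).models.Nonempty ∧ ε / 4 < gap γ ε ν πs (sel (St h).models h) h

/-- The `Δ` of an exploration phase. -/
def Phase.gap (p : Phase N A O R) : ℝ := GeneralRL.gap γ ε ν πs p.choice p.start

/-- The `κ` of an exploration phase. -/
def Phase.bucket (p : Phase N A O R) : ℕ := GeneralRL.bucket ε (p.gap γ ε ν πs)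

/-- The number of time-steps left in the exploration phase in progress, if there is one. -/
def phaseRemaining (h : History A O R) : ℕ :=
  match (St h).phase with
  | none => 0
  | some p => phaseLen γ ε - p.elapsed

variable {γ ε δ ν πs sel}

lemma stateAt_cons_none {h : History A O R} (hc : Cur h = none) (s : Step A O R) :
    St (s :: h) = St h := by
  rw [curPhase] at hc
  simp [stateAt, update, hc]

lemma phases_cons_none {h : History A O R} (hc : Cur h = none) (s : Step A O R) :
    Phs (s :: h) = Phs h := by
  rw [phases, hc]

lemma stateAt_cons_mid {h : History A O R} {p : Phase N A O R} (hc : Cur h = some p)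
    (hp : p.elapsed + 1 < phaseLen γ ε) (s : Step A O R) :
    St (s :: h) = { St h with phase := some (p.next γ s) } := by
  rw [curPhase] at hc
  simp [stateAt, update, hc, hp, Phase.next]

lemma phases_cons_mid {h : History A O R} {p : Phase N A O R} (hc : Cur h = some p)
    (hp : p.elapsed + 1 < phaseLen γ ε) (s : Step A O R) : Phs (s :: h) = Phs h := by
  rw [phases, hc]
  simp [hp]

lemma stateAt_cons_end {h : History A O R} {p : Phase N A O R} (hc : Cur h = some p)
    (hp : ¬ p.elapsed + 1 < phaseLen γ ε) (s : Step A O R) :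
    St (s :: h) = endPhase γ ε δ ν πs (St h) (p.next γ s) := by
  rw [curPhase] at hc
  simp [stateAt, update, hc, hp, Phase.next]

lemma phases_cons_end {h : History A O R} {p : Phase N A O R} (hc : Cur h = some p)
    (hp : ¬ p.elapsed + 1 < phaseLen γ ε) (s : Step A O R) :
    Phs (s :: h) = p.next γ s :: Phs h := by
  rw [phases, hc]
  simp [hp]

lemma Starts.curPhase_eq {h : History A O R} (hs : Starts γ ε δ ν πs sel h) :
    Cur h = some ⟨sel (St h).models h, h, 0, 0⟩ := by
  simp [curPhase, currentPhase, hs.1, hs.2]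

lemma curPhase_of_phase_eq_some {h : History A O R} {p : Phase N A O R}
    (hp : (St h).phase = some p) : Cur h = some p := by
  simp [curPhase, currentPhase, hp]

lemma curPhase_of_not_starts {h : History A O R} (hp : (St h).phase = none)
    (hs : ¬ Starts γ ε δ ν πs sel h) : Cur h = none := by
  have : ¬ ((St h).models.Nonempty ∧ ε / 4 < gap γ ε ν πs (sel (St h).models h) h) :=
    fun h' => hs ⟨hp, h'⟩
  simp [curPhase, currentPhase, hp, this]

/-- `p` is an exploration phase in progress at `h`. -/
structure InPhase (γ ε δ : ℝ) (ν : Fin N → Env A O R) (πs : Fin N → Policy A O R)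
    (sel : Finset (Fin N) → History A O R → Choice N) (h : History A O R)
    (p : Phase N A O R) : Prop where
  starts : Starts γ ε δ ν πs sel p.start
  choice : p.choice = sel (stateAt γ ε δ ν πs sel p.start).models p.start
  models : (stateAt γ ε δ ν πs sel h).models = (stateAt γ ε δ ν πs sel p.start).models
  elapsed : p.elapsed < phaseLen γ ε

/-- `p` is an exploration phase completed before `h`. -/
structure IsCompleted (γ ε δ : ℝ) (ν : Fin N → Env A O R) (πs : Fin N → Policy A O R)
    (sel : Finset (Fin N) → History A O R → Choice N) (h : History A O R)
    (p : Phase N A O R) : Prop where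
  starts : Starts γ ε δ ν πs sel p.start
  choice : p.choice = sel (stateAt γ ε δ ν πs sel p.start).models p.start
  models : (stateAt γ ε δ ν πs sel h).models ⊆ (stateAt γ ε δ ν πs sel p.start).models

open Classical in
lemma models_cons_subset (h : History A O R) (s : Step A O R) :
    (St (s :: h)).models ⊆ (St h).models := by
  rcases hc : Cur h with _ | p
  · rw [stateAt_cons_none hc]
  · by_cases hp : p.elapsed + 1 < phaseLen γ ε
    · rw [stateAt_cons_mid hc hp]
    · rw [stateAt_cons_end hc hp]
      exact Finset.filter_subset _ _

variable (hD : 0 < phaseLen γ ε)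

include hD

lemma inPhase_of_phase {h : History A O R} {p : Phase N A O R} (hp : (St h).phase = some p) :
    InPhase γ ε δ ν πs sel h p ∧ 0 < p.elapsed := by
  induction h generalizing p with
  | nil => simp [stateAt] at hp
  | cons s h ih =>
    rcases hc : Cur h with _ | q
    · have hph : (St h).phase = some p := by rwa [stateAt_cons_none hc] at hp
      rw [curPhase_of_phase_eq_some hph] at hc
      simp at hc
    · by_cases hq : q.elapsed + 1 < phaseLen γ ε
      · have hin : InPhase γ ε δ ν πs sel h q := by
          rcases hph : (St h).phase with _ | q'
          · by_cases hs : Starts γ ε δ ν πs sel h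
            · rw [hs.curPhase_eq, Option.some.injEq] at hc
              subst hc
              exact ⟨hs, rfl, rfl, hD⟩
            · rw [curPhase_of_not_starts hph hs] at hc
              simp at hc
          · rw [curPhase_of_phase_eq_some hph, Option.some.injEq] at hc
            subst hc
            exact (ih hph).1
        rw [stateAt_cons_mid hc hq] at hp
        simp only [Option.some.injEq] at hp
        subst hp
        refine ⟨⟨hin.starts, hin.choice, ?_, hq⟩, Nat.succ_pos _⟩
        rw [stateAt_cons_mid hc hq]
        exact hin.models
      · rw [stateAt_cons_end hc hq] at hp
        simp [endPhase] at hp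

lemma inPhase_of_curPhase {h : History A O R} {p : Phase N A O R} (hc : Cur h = some p) :
    InPhase γ ε δ ν πs sel h p := by
  rcases hph : (St h).phase with _ | q'
  · by_cases hs : Starts γ ε δ ν πs sel h
    · rw [hs.curPhase_eq, Option.some.injEq] at hc
      subst hc
      exact ⟨hs, rfl, rfl, hD⟩
    · rw [curPhase_of_not_starts hph hs] at hc
      simp at hc
  · rw [curPhase_of_phase_eq_some hph, Option.some.injEq] at hc
    subst hc
    exact (inPhase_of_phase hD hph).1

lemma isCompleted_of_mem_phases {h : History A O R} {p : Phase N A O R} (hp : p ∈ Phs h) :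
    IsCompleted γ ε δ ν πs sel h p := by
  induction h with
  | nil => simp [phases] at hp
  | cons s h ih =>
    have hold : p ∈ Phs h → IsCompleted γ ε δ ν πs sel (s :: h) p := fun hp =>
      ⟨(ih hp).starts, (ih hp).choice, (models_cons_subset h s).trans (ih hp).models⟩
    rcases hc : Cur h with _ | q
    · rw [phases_cons_none hc] at hp
      exact hold hp
    · by_cases hq : q.elapsed + 1 < phaseLen γ ε
      · rw [phases_cons_mid hc hq] at hp
        exact hold hp
      · rw [phases_cons_end hc hq, List.mem_cons] at hp
        rcases hp with rfl | hp
        · have hin := inPhase_of_curPhase hD hc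
          exact ⟨hin.starts, hin.choice, (models_cons_subset h s).trans hin.models.subset⟩
        · exact hold hp

lemma phaseRemaining_eq_zero {h : History A O R} (hr : phaseRemaining γ ε δ ν πs sel h = 0) :
    (St h).phase = none := by
  rcases hph : (St h).phase with _ | p
  · rfl
  · have := (inPhase_of_phase hD hph).1.elapsed
    simp only [phaseRemaining, hph] at hr
    omega

omit hD in
lemma phaseRemaining_of_curPhase_eq_some {h : History A O R} {p : Phase N A O R}
    (hc : Cur h = some p) (s : Step A O R) :
    phaseRemaining γ ε δ ν πs sel (s :: h) = phaseLen γ ε - p.elapsed - 1 := by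
  by_cases hq : p.elapsed + 1 < phaseLen γ ε
  · simp only [phaseRemaining, stateAt_cons_mid hc hq, Phase.next]
    omega
  · simp only [phaseRemaining, stateAt_cons_end hc hq, endPhase]
    omega

omit hD in
lemma phaseRemaining_cons {h : History A O R} {k : ℕ}
    (hr : phaseRemaining γ ε δ ν πs sel h = k + 1) (s : Step A O R) :
    phaseRemaining γ ε δ ν πs sel (s :: h) = k := by
  rcases hph : (St h).phase with _ | p
  · simp [phaseRemaining, hph] at hr
  · rw [phaseRemaining_of_curPhase_eq_some (curPhase_of_phase_eq_some hph)]
    simp only [phaseRemaining, hph] at hr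
    omega

omit hD in
/-- The course of an exploration phase that starts at `h`. -/
lemma Starts.curPhase_pref {h : History A O R} (hs : Starts γ ε δ ν πs sel h)
    (ω : ℕ → Step A O R) {k : ℕ} (hk : k < phaseLen γ ε) :
    Cur (pref ω k ++ h) = some ⟨sel (St h).models h, h, k, ret γ k ω⟩ ∧
      (St (pref ω k ++ h)).models = (St h).models ∧ Phs (pref ω k ++ h) = Phs h := by
  induction k with
  | zero =>
    rw [pref_zero, List.nil_append, hs.curPhase_eq]
    simp [ret]
  | succ k ih =>
    obtain ⟨h1, h2, h3⟩ := ih (by omega)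
    rw [pref_succ, List.cons_append]
    refine ⟨curPhase_of_phase_eq_some ?_, ?_, ?_⟩
    · rw [stateAt_cons_mid h1 hk]
      simp [Phase.next, ret, Finset.sum_range_succ]
    · rw [stateAt_cons_mid h1 hk, h2]
    · rw [phases_cons_mid h1 hk, h3]

lemma Starts.phases_pref {h : History A O R} (hs : Starts γ ε δ ν πs sel h)
    (ω : ℕ → Step A O R) :
    Phs (pref ω (phaseLen γ ε) ++ h) =
      ⟨sel (St h).models h, h, phaseLen γ ε, ret γ (phaseLen γ ε) ω⟩ :: Phs h := by
  obtain ⟨k, hk⟩ : ∃ k, phaseLen γ ε = k + 1 := ⟨_, (Nat.succ_pred_eq_of_pos hD).symm⟩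
  obtain ⟨h1, -, h3⟩ := hs.curPhase_pref ω (k := k) (by omega)
  rw [hk, pref_succ, List.cons_append, phases_cons_end h1 (by simp [hk]), h3]
  simp [Phase.next, ret, Finset.sum_range_succ]

omit hD in
/-- During an exploration phase, the chosen policy is followed. -/
lemma IsRun.valueN_of_starts {π : Policy A O R} (run : IsRun γ ε δ ν π πs sel) (μ : Env A O R)
    {h : History A O R} (hs : Starts γ ε δ ν πs sel h) :
    valueN γ μ π h (phaseLen γ ε) =
      valueN γ μ (πs (sel (St h).models h).pol) h (phaseLen γ ε) := by
  have key : ∀ (ω : ℕ → Step A O R) (k : ℕ), k < phaseLen γ ε →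
      π (pref ω k ++ h) = πs (sel (St h).models h).pol (pref ω k ++ h) := by
    intro ω k hk
    obtain ⟨h1, h2, -⟩ := hs.curPhase_pref ω hk
    have hf := run.follow (pref ω k ++ h) (h2 ▸ hs.2.1)
    rw [curPhase] at h1
    rw [hf, h1]
  refine valueN_policy_congr fun l hl => ?_
  rcases eq_or_ne l [] with rfl | hne
  · obtain ⟨h1, hM⟩ : Cur h = some ⟨sel (St h).models h, h, 0, 0⟩ ∧ (St h).models.Nonempty :=
      ⟨hs.curPhase_eq, hs.2.1⟩
    have hf := run.follow h hM
    rw [curPhase] at h1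
    rw [List.nil_append, hf, h1]
  · obtain ⟨ω, hω⟩ := exists_pref_eq l hne
    rw [← hω]
    exact key ω _ hl

end Dynamics

/-! ### Counters and statistics as sums over the completed phases -/

section Sums

open Classical

variable {N : ℕ} (γ ε : ℝ) (ν : Fin N → Env A O R) (πs : Fin N → Policy A O R)

/-- The contribution of a phase to the counter `E(i, κ)`. -/
def Phase.inc (i : Fin N) (κ : ℕ) (p : Phase N A O R) : ℕ :=
  if κ = p.bucket γ ε ν πs ∧ (i = p.choice.up ∨ i = p.choice.lo) then 1 else 0

/-- For a phase `p` with `κ = p.bucket`, the statistic `X` of the model `i` if the return of the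
phase is replaced by `x`, and `0` otherwise. -/
def Phase.dev (i : Fin N) (κ : ℕ) (p : Phase N A O R) (x : ℝ) : ℝ :=
  if κ = p.bucket γ ε ν πs ∧ i = p.choice.up then
    (1 - γ) * (valueN γ (ν i) (πs p.choice.pol) p.start (phaseLen γ ε) - x)
  else if κ = p.bucket γ ε ν πs ∧ i = p.choice.lo then
    (1 - γ) * (x - valueN γ (ν i) (πs p.choice.pol) p.start (phaseLen γ ε))
  else 0

variable (δ : ℝ) (sel : Finset (Fin N) → History A O R → Choice N)

local notation "St" => stateAt γ ε δ ν πs sel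

local notation "Phs" => phases γ ε δ ν πs sel

lemma count_endPhase (σ : State N A O R) (p : Phase N A O R) (i : Fin N) (κ : ℕ) :
    (endPhase γ ε δ ν πs σ p).count i κ = p.inc γ ε ν πs i κ + σ.count i κ := by
  by_cases H : κ = p.bucket γ ε ν πs ∧ (i = p.choice.up ∨ i = p.choice.lo)
  · rw [Phase.inc, if_pos H, add_comm]
    exact if_pos H
  · rw [Phase.inc, if_neg H, zero_add]
    exact if_neg H

lemma stat_endPhase (σ : State N A O R) (p : Phase N A O R) (i : Fin N) (κ : ℕ) :
    (endPhase γ ε δ ν πs σ p).stat i κ = p.dev γ ε ν πs i κ p.ret + σ.stat i κ := by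
  by_cases h1 : κ = p.bucket γ ε ν πs ∧ i = p.choice.up
  · rw [Phase.dev, if_pos h1, add_comm, h1.2]
    exact if_pos ⟨h1.1, rfl⟩
  · rw [Phase.dev, if_neg h1]
    by_cases h2 : κ = p.bucket γ ε ν πs ∧ i = p.choice.lo
    · rw [if_pos h2, add_comm]
      exact (if_neg h1).trans ((if_pos h2).trans (by rw [h2.2]))
    · rw [if_neg h2, zero_add]
      exact (if_neg h1).trans (if_neg h2)

lemma count_stateAt (h : History A O R) (i : Fin N) (κ : ℕ) :
    (St h).count i κ = ((Phs h).map (Phase.inc γ ε ν πs i κ)).sum := by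
  induction h with
  | nil => simp [stateAt, phases]
  | cons s h ih =>
    rcases hc : curPhase γ ε δ ν πs sel h with _ | p
    · rw [stateAt_cons_none hc, phases_cons_none hc, ih]
    · by_cases hp : p.elapsed + 1 < phaseLen γ ε
      · rw [stateAt_cons_mid hc hp, phases_cons_mid hc hp]
        exact ih
      · rw [stateAt_cons_end hc hp, phases_cons_end hc hp, List.map_cons, List.sum_cons, ← ih]
        exact count_endPhase γ ε ν πs δ _ _ i κ

lemma stat_stateAt (h : History A O R) (i : Fin N) (κ : ℕ) :
    (St h).stat i κ = ((Phs h).map fun p => p.dev γ ε ν πs i κ p.ret).sum := by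
  induction h with
  | nil => simp [stateAt, phases]
  | cons s h ih =>
    rcases hc : curPhase γ ε δ ν πs sel h with _ | p
    · rw [stateAt_cons_none hc, phases_cons_none hc, ih]
    · by_cases hp : p.elapsed + 1 < phaseLen γ ε
      · rw [stateAt_cons_mid hc hp, phases_cons_mid hc hp]
        exact ih
      · rw [stateAt_cons_end hc hp, phases_cons_end hc hp, List.map_cons, List.sum_cons, ← ih]
        exact stat_endPhase γ ε ν πs δ _ _ i κ

end Sums

/-! ### Concentration of the statistics -/

section Concentration

variable {N : ℕ} (γ ε δ : ℝ) (ν : Fin N → Env A O R) (πs : Fin N → Policy A O R)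
  (sel : Finset (Fin N) → History A O R → Choice N)

local notation "St" => stateAt γ ε δ ν πs sel

local notation "Phs" => phases γ ε δ ν πs sel

/-- The expectation of the statistic `X(i, κ)` of the phase `p` when `ν i₀` is the true environment
(`0` if `p` does not contribute to it). -/
def Phase.mean (i₀ i : Fin N) (κ : ℕ) (p : Phase N A O R) : ℝ :=
  p.dev γ ε ν πs i κ (valueN γ (ν i₀) (πs p.choice.pol) p.start (phaseLen γ ε))

/-- The centred statistic `X(i, κ) - E X(i, κ)` of the phase `p`. -/
def Phase.noise (i₀ i : Fin N) (κ : ℕ) (p : Phase N A O R) : ℝ :=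
  p.dev γ ε ν πs i κ p.ret - p.mean γ ε ν πs i₀ i κ

/-- The sum of the centred statistics of the completed phases. -/
def noiseSum (i₀ i : Fin N) (κ : ℕ) (h : History A O R) : ℝ :=
  ((Phs h).map (Phase.noise γ ε ν πs i₀ i κ)).sum

variable {γ ε δ ν πs sel}

lemma stat_eq_mean_add_noise (i₀ i : Fin N) (κ : ℕ) (h : History A O R) :
    (St h).stat i κ =
      ((Phs h).map (Phase.mean γ ε ν πs i₀ i κ)).sum + noiseSum γ ε δ ν πs sel i₀ i κ h := by
  rw [stat_stateAt, noiseSum, ← List.sum_map_add]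
  simp [Phase.noise]

/-- As a function of the return of the phase, the centred statistic is affine with slope `±(1 - γ)`,
or `0` if the phase does not contribute to it. -/
lemma noise_eq (i₀ i : Fin N) (κ : ℕ) (p : Phase N A O R) :
    ∃ c : ℝ, c ^ 2 = (1 - γ) ^ 2 * p.inc γ ε ν πs i κ ∧ ∀ x,
      Phase.noise γ ε ν πs i₀ i κ { p with ret := x } =
        c * (x - valueN γ (ν i₀) (πs p.choice.pol) p.start (phaseLen γ ε)) := by
  by_cases h1 : κ = p.bucket γ ε ν πs ∧ i = p.choice.up
  · refine ⟨-(1 - γ), ?_, fun x => ?_⟩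
    · rw [Phase.inc, if_pos ⟨h1.1, Or.inl h1.2⟩]
      push_cast
      ring
    · have h1' : κ = Phase.bucket γ ε ν πs { p with ret := x } ∧
        i = ({ p with ret := x } : Phase N A O R).choice.up := h1
      rw [Phase.noise, Phase.mean, Phase.dev, Phase.dev, if_pos h1', if_pos h1']
      ring
  · by_cases h2 : κ = p.bucket γ ε ν πs ∧ i = p.choice.lo
    · refine ⟨1 - γ, ?_, fun x => ?_⟩
      · rw [Phase.inc, if_pos ⟨h2.1, Or.inr h2.2⟩]
        push_cast
        ring
      · have h1' : ¬ (κ = Phase.bucket γ ε ν πs { p with ret := x } ∧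
          i = ({ p with ret := x } : Phase N A O R).choice.up) := h1
        have h2' : κ = Phase.bucket γ ε ν πs { p with ret := x } ∧
          i = ({ p with ret := x } : Phase N A O R).choice.lo := h2
        rw [Phase.noise, Phase.mean, Phase.dev, Phase.dev, if_neg h1', if_neg h1', if_pos h2',
          if_pos h2']
        ring
    · have h3 : ¬ (κ = p.bucket γ ε ν πs ∧ (i = p.choice.up ∨ i = p.choice.lo)) := by tauto
      refine ⟨0, ?_, fun x => ?_⟩
      · rw [Phase.inc, if_neg h3]
        simp
      · have h1' : ¬ (κ = Phase.bucket γ ε ν πs { p with ret := x } ∧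
          i = ({ p with ret := x } : Phase N A O R).choice.up) := h1
        have h2' : ¬ (κ = Phase.bucket γ ε ν πs { p with ret := x } ∧
          i = ({ p with ret := x } : Phase N A O R).choice.lo) := h2
        rw [Phase.noise, Phase.mean, Phase.dev, Phase.dev, if_neg h1', if_neg h1', if_neg h2',
          if_neg h2']
        ring

lemma measurable_ret (d : ℕ) : Measurable (fun ω : ℕ → Step A O R => ret γ d ω) := by
  refine Finset.measurable_sum _ fun k _ => Measurable.const_mul ?_ _
  exact (Measurable.of_discrete (f := fun s : Step A O R => (s.rew : ℝ))).comp
    (measurable_pi_apply k)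

lemma IsRun.one_sub_pos {π : Policy A O R} (run : IsRun γ ε δ ν π πs sel) : 0 < 1 - γ := by
  linarith [run.γ_lt]

lemma IsRun.horizon_pos {π : Policy A O R} (run : IsRun γ ε δ ν π πs sel) :
    2 ≤ horizon γ ε := by
  have h1 := run.one_sub_pos
  have h2 : 0 < (1 - γ) * ε := mul_pos h1 run.ε_pos
  have h3 : (8 : ℝ) ≤ 8 / ((1 - γ) * ε) := by
    rw [le_div_iff₀ h2]
    nlinarith [run.small]
  have h4 : (2 : ℝ) ≤ Real.log 8 := by
    rw [show (8 : ℝ) = 2 ^ 3 by norm_num, Real.log_pow]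
    push_cast
    linarith [Real.log_two_gt_d9]
  have h5 : Real.log 8 ≤ Real.log (8 / ((1 - γ) * ε)) := Real.log_le_log (by norm_num) h3
  have h6 : 1 ≤ 1 / (1 - γ) := by
    rw [le_div_iff₀ h1]
    linarith [run.γ_pos]
  rw [horizon]
  nlinarith

lemma IsRun.phaseLen_pos {π : Policy A O R} (run : IsRun γ ε δ ν π πs sel) :
    0 < phaseLen γ ε :=
  Nat.ceil_pos.2 (by linarith [run.horizon_pos])

/-- **Hoeffding's lemma** for the return of the next `d` time-steps. -/
lemma integral_exp_ret_le {μ : Env A O R} {π : Policy A O R} (hR : ∀ r ∈ R, 0 ≤ r ∧ r ≤ 1)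
    (hγ0 : 0 < γ) (hγ1 : γ < 1) (h : History A O R) (d : ℕ) (t : ℝ) :
    ∫ ω, Real.exp (t * (ret γ d ω - valueN γ μ π h d)) ∂(lawFrom μ π h) ≤
      Real.exp (t ^ 2 / (8 * (1 - γ) ^ 2)) := by
  have hg : 0 < 1 - γ := by linarith
  have hs := (hasSubgaussianMGF_of_mem_Icc (X := fun ω => ret γ d ω) (μ := lawFrom μ π h)
    (a := 0) (b := 1 / (1 - γ)) (measurable_ret d).aemeasurable
    (Eventually.of_forall fun ω => ⟨ret_nonneg hR hγ0 d ω, ret_le hR hγ0 hγ1 d ω⟩)).mgf_le t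
  rw [mgf] at hs
  refine hs.trans (Real.exp_le_exp.2 (le_of_eq ?_))
  have : ((‖1 / (1 - γ) - 0‖₊ : NNReal) : ℝ) = 1 / (1 - γ) := by
    rw [coe_nnnorm, sub_zero, Real.norm_of_nonneg (one_div_pos.2 hg).le]
  push_cast at this ⊢
  rw [this]
  field_simp
  ring

/-- The exponential process of the centred statistics does not increase in expectation over an
exploration phase. -/
lemma IsRun.iterate_exp_noise_le {π : Policy A O R} (run : IsRun γ ε δ ν π πs sel)
    (i₀ i : Fin N) (κ : ℕ) (θ : ℝ) {h : History A O R} (hs : Starts γ ε δ ν πs sel h) :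
    (stepMean (ν i₀) π)^[phaseLen γ ε]
      (fun l => Real.exp (θ * noiseSum γ ε δ ν πs sel i₀ i κ l - θ ^ 2 / 8 * (St l).count i κ)) h ≤
      Real.exp (θ * noiseSum γ ε δ ν πs sel i₀ i κ h - θ ^ 2 / 8 * (St h).count i κ) := by
  rw [← integral_pref]
  set p : Phase N A O R := ⟨sel (St h).models h, h, phaseLen γ ε, 0⟩ with hp
  obtain ⟨c, hc, hn⟩ := noise_eq (γ := γ) (ε := ε) (ν := ν) (πs := πs) i₀ i κ p
  set V := valueN γ (ν i₀) π h (phaseLen γ ε) with hV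
  have hV' : V = valueN γ (ν i₀) (πs p.choice.pol) p.start (phaseLen γ ε) :=
    run.valueN_of_starts _ hs
  have key : ∀ ω, Real.exp (θ * noiseSum γ ε δ ν πs sel i₀ i κ (pref ω (phaseLen γ ε) ++ h)
        - θ ^ 2 / 8 * (St (pref ω (phaseLen γ ε) ++ h)).count i κ) =
      Real.exp (θ * noiseSum γ ε δ ν πs sel i₀ i κ h - θ ^ 2 / 8 * (St h).count i κ) *
        Real.exp (- (θ ^ 2 / 8 * p.inc γ ε ν πs i κ)) *
          Real.exp (θ * c * (ret γ (phaseLen γ ε) ω - V)) := by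
    intro ω
    rw [noiseSum, count_stateAt, hs.phases_pref run.phaseLen_pos ω, List.map_cons, List.sum_cons,
      List.map_cons, List.sum_cons, ← count_stateAt, ← noiseSum, ← Real.exp_add, ← Real.exp_add]
    have := hn (ret γ (phaseLen γ ε) ω)
    rw [← hV'] at this
    rw [this]
    have h2 : Phase.inc γ ε ν πs i κ ⟨sel (St h).models h, h, phaseLen γ ε,
      ret γ (phaseLen γ ε) ω⟩ = p.inc γ ε ν πs i κ := rfl
    rw [h2]
    push_cast
    ring_nf
  simp only [key]
  rw [integral_const_mul]
  have hmain := integral_exp_ret_le (μ := ν i₀) (π := π) run.rew run.γ_pos run.γ_lt h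
    (phaseLen γ ε) (θ * c)
  have hg := run.one_sub_pos
  have he : (θ * c) ^ 2 / (8 * (1 - γ) ^ 2) = θ ^ 2 / 8 * p.inc γ ε ν πs i κ := by
    rw [mul_pow, hc]
    field_simp
  rw [he] at hmain
  rw [mul_assoc]
  refine mul_le_of_le_one_right (Real.exp_pos _).le ?_
  calc _ ≤ Real.exp (- (θ ^ 2 / 8 * p.inc γ ε ν πs i κ)) *
        Real.exp (θ ^ 2 / 8 * p.inc γ ε ν πs i κ) :=
      mul_le_mul_of_nonneg_left hmain (Real.exp_pos _).le
    _ = 1 := by rw [← Real.exp_add]; simp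

/-- Ville's inequality for the exponential process of the centred statistics. -/
lemma IsRun.noise_tail {π : Policy A O R} (run : IsRun γ ε δ ν π πs sel)
    (i₀ i : Fin N) (κ : ℕ) (θ : ℝ) {c : ℝ} (hc : 0 < c) {B : Set (History A O R)}
    (hB : ∀ h ∈ B, (St h).phase = none ∧
      c ≤ Real.exp (θ * noiseSum γ ε δ ν πs sel i₀ i κ h - θ ^ 2 / 8 * (St h).count i κ)) :
    law (ν i₀) π {ω | ∃ t, pref ω t ∈ B} ≤ ENNReal.ofReal (1 / c) := by
  have hD := run.phaseLen_pos
  have := ville_block (ν i₀) π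
    (Φ := fun l => Real.exp (θ * noiseSum γ ε δ ν πs sel i₀ i κ l
      - θ ^ 2 / 8 * (St l).count i κ)) (fun h => (Real.exp_pos _).le)
    (r := phaseRemaining γ ε δ ν πs sel) rfl (fun h k s hr => phaseRemaining_cons hr s) ?_ hc
    (B := B) ?_
  · simpa [noiseSum, phases, stateAt] using this
  · intro h hr
    have hph := phaseRemaining_eq_zero hD hr
    by_cases hs : Starts γ ε δ ν πs sel h
    · refine ⟨phaseLen γ ε - 1, fun s => ?_, ?_⟩
      · rw [phaseRemaining_of_curPhase_eq_some hs.curPhase_eq]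
        rfl
      · rw [Nat.sub_add_cancel hD]
        exact run.iterate_exp_noise_le i₀ i κ θ hs
    · have hcur := curPhase_of_not_starts hph hs
      refine ⟨0, fun s => ?_, ?_⟩
      · simp only [phaseRemaining, stateAt_cons_none hcur, hph]
      · rw [zero_add, Function.iterate_one]
        refine (stepMean_congr_at (ν i₀) π (g := fun _ => Real.exp
          (θ * noiseSum γ ε δ ν πs sel i₀ i κ h - θ ^ 2 / 8 * (St h).count i κ))
          fun s => ?_).le.trans_eq (stepMean_const _ _ _ _)
        simp only [noiseSum, phases_cons_none hcur, stateAt_cons_none hcur]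
  · intro h hh
    obtain ⟨h1, h2⟩ := hB h hh
    exact ⟨by simp only [phaseRemaining, h1], h2⟩

/-! ### All tests together -/

lemma kappas_card_pos : 0 < (kappas γ ε).card := by simp [kappas]

lemma delta1_pos (hN : 0 < N) (hδ : 0 < δ) : 0 < delta1 N γ ε δ := by
  have h1 : (0 : ℝ) < (kappas γ ε).card := by exact_mod_cast kappas_card_pos
  have h2 : (0 : ℝ) < N := by exact_mod_cast hN
  rw [delta1]
  positivity

lemma delta1_le (hN : 0 < N) (hδ : 0 < δ) (hδ1 : δ < 1) : delta1 N γ ε δ ≤ 1 / 32 := by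
  have h1 : (1 : ℝ) ≤ (kappas γ ε).card := by exact_mod_cast kappas_card_pos
  have h2 : (1 : ℝ) ≤ (N : ℝ) ^ (3 / 2 : ℝ) :=
    Real.one_le_rpow (by exact_mod_cast hN) (by norm_num)
  rw [delta1]
  have h3 : (32 : ℝ) ≤ 32 * (kappas γ ε).card * (N : ℝ) ^ (3 / 2 : ℝ) := by nlinarith
  rw [div_le_div_iff₀ (by linarith) (by norm_num)]
  linarith

lemma one_lt_alpha (hN : 0 < N) : 1 < alpha N := by
  have h2 : (1 : ℝ) ≤ √(N : ℝ) := Real.one_le_sqrt.2 (by exact_mod_cast hN)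
  rw [alpha, lt_div_iff₀ (by linarith)]
  linarith

lemma alphaSeq_pos (hN : 0 < N) (j : ℕ) : 0 < alphaSeq N j :=
  Nat.ceil_pos.2 (pow_pos (by linarith [one_lt_alpha hN]) j)

lemma hasSum_inv_alpha (hN : 0 < N) : HasSum (fun j => (alpha N)⁻¹ ^ j) (4 * √(N : ℝ)) := by
  have h2 : (1 : ℝ) ≤ √(N : ℝ) := Real.one_le_sqrt.2 (by exact_mod_cast hN)
  have h1 := one_lt_alpha hN
  have := hasSum_geometric_of_lt_one (inv_nonneg.2 (by linarith : 0 ≤ alpha N))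
    (inv_lt_one_of_one_lt₀ h1)
  convert this using 1
  rw [alpha]
  field_simp
  ring

/-- The sum of the centred statistics is large, up to the sign `s`, at a test of model `i`. -/
def BadTest (γ ε δ : ℝ) (ν : Fin N → Env A O R) (πs : Fin N → Policy A O R)
    (sel : Finset (Fin N) → History A O R → Choice N) (s : ℝ) (i₀ i : Fin N) (κ j : ℕ) :
    Set (History A O R) :=
  {h | (stateAt γ ε δ ν πs sel h).phase = none ∧
    (stateAt γ ε δ ν πs sel h).count i κ = alphaSeq N j ∧
    √(2 * (alphaSeq N j : ℝ) * Real.log ((alphaSeq N j : ℝ) / delta1 N γ ε δ)) ≤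
      s * noiseSum γ ε δ ν πs sel i₀ i κ h}

lemma IsRun.prob_badTest_le {π : Policy A O R} (run : IsRun γ ε δ ν π πs sel)
    {s : ℝ} (hs : s ^ 2 = 1) (i₀ i : Fin N) (κ j : ℕ) :
    law (ν i₀) π {ω | ∃ t, pref ω t ∈ BadTest γ ε δ ν πs sel s i₀ i κ j} ≤
      ENNReal.ofReal (delta1 N γ ε δ * (alpha N)⁻¹ ^ j) := by
  have hN : 0 < N := Fin.pos i
  set n : ℝ := (alphaSeq N j : ℝ) with hn
  have hn1 : 1 ≤ n := by rw [hn]; exact_mod_cast alphaSeq_pos hN j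
  have hd := delta1_pos (γ := γ) (ε := ε) hN run.δ_pos
  have hd1 := delta1_le (γ := γ) (ε := ε) hN run.δ_pos run.δ_lt
  set L := Real.log (n / delta1 N γ ε δ) with hL
  have hL0 : 0 ≤ L := by
    refine Real.log_nonneg ?_
    rw [le_div_iff₀ hd]
    linarith
  have hnp : 0 < n := by linarith
  have hnd : 0 < n / delta1 N γ ε δ := div_pos hnp hd
  -- the exponent `θ` for which `θ` times the threshold is `2 L` and `θ² n / 8` is `L / 4`
  refine (run.noise_tail i₀ i κ (θ := s * √(2 * L / n)) hnd fun h hh => ⟨hh.1, ?_⟩).trans ?_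
  · obtain ⟨-, h2, h3⟩ := hh
    rw [h2, ← hn]
    rw [← hn, ← hL] at h3
    have e1 : n / delta1 N γ ε δ = Real.exp L := (Real.exp_log hnd).symm
    rw [e1]
    refine Real.exp_le_exp.2 ?_
    rw [mul_pow, hs, Real.sq_sqrt (by positivity)]
    have e2 : √(2 * L / n) * √(2 * n * L) = 2 * L := by
      rw [← Real.sqrt_mul (by positivity), show 2 * L / n * (2 * n * L) = (2 * L) ^ 2 by
        field_simp, Real.sqrt_sq (by positivity)]
    have e3 := mul_le_mul_of_nonneg_left h3 (Real.sqrt_nonneg (2 * L / n))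
    rw [e2] at e3
    have e4 : 1 * (2 * L / n) / 8 * n = L / 4 := by
      field_simp
      ring
    rw [e4]
    nlinarith
  · refine ENNReal.ofReal_le_ofReal ?_
    rw [one_div_div, div_eq_mul_inv, inv_pow]
    have ha : 0 < alpha N ^ j := pow_pos (by linarith [one_lt_alpha hN]) j
    exact mul_le_mul_of_nonneg_left (inv_anti₀ ha (Nat.le_ceil _)) hd.le

/-- The union bound over the tests of one model; the sum over `j` is a geometric series, and it is
where the factor `N ^ (3 / 2)` in `delta1` comes from. -/
lemma IsRun.prob_badTests_le {π : Policy A O R} (run : IsRun γ ε δ ν π πs sel)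
    {s : ℝ} (hs : s ^ 2 = 1) (i₀ i : Fin N) :
    law (ν i₀) π {ω | ∃ κ ∈ kappas γ ε, ∃ j t, pref ω t ∈ BadTest γ ε δ ν πs sel s i₀ i κ j} ≤
      ENNReal.ofReal (δ / (8 * N)) := by
  have hN : 0 < N := Fin.pos i
  have hN' : (0 : ℝ) < N := by exact_mod_cast hN
  have hd := delta1_pos (γ := γ) (ε := ε) hN run.δ_pos
  have ha : 0 ≤ (alpha N)⁻¹ := inv_nonneg.2 (by linarith [one_lt_alpha hN])
  have hset : {ω : ℕ → Step A O R | ∃ κ ∈ kappas γ ε, ∃ j t,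
      pref ω t ∈ BadTest γ ε δ ν πs sel s i₀ i κ j} =
      ⋃ κ ∈ kappas γ ε, ⋃ j, {ω | ∃ t, pref ω t ∈ BadTest γ ε δ ν πs sel s i₀ i κ j} := by
    ext ω
    simp only [Set.mem_ofPred_eq, Set.mem_iUnion, exists_prop]
  rw [hset]
  have h1 : ∀ κ, law (ν i₀) π (⋃ j, {ω | ∃ t, pref ω t ∈ BadTest γ ε δ ν πs sel s i₀ i κ j}) ≤
      ENNReal.ofReal (delta1 N γ ε δ * (4 * √(N : ℝ))) := by
    intro κ
    have hsum := (hasSum_inv_alpha hN).mul_left (delta1 N γ ε δ)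
    rw [← hsum.tsum_eq, ENNReal.ofReal_tsum_of_nonneg (fun j => by positivity) hsum.summable]
    exact (measure_iUnion_le _).trans (ENNReal.tsum_le_tsum fun j => run.prob_badTest_le hs _ _ _ _)
  refine (measure_biUnion_finset_le _ _).trans ((Finset.sum_le_sum fun κ _ => h1 κ).trans ?_)
  rw [Finset.sum_const, nsmul_eq_mul, ← ENNReal.ofReal_natCast, ← ENNReal.ofReal_mul (by positivity)]
  refine ENNReal.ofReal_le_ofReal (le_of_eq ?_)
  have hK : (0 : ℝ) < (kappas γ ε).card := by exact_mod_cast kappas_card_pos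
  have hpow : (N : ℝ) ^ (3 / 2 : ℝ) = N * √(N : ℝ) := by
    rw [show (3 / 2 : ℝ) = 1 + 1 / 2 by norm_num, Real.rpow_add hN', Real.rpow_one,
      Real.sqrt_eq_rpow]
  have hsq : 0 < √(N : ℝ) := Real.sqrt_pos.2 hN'
  rw [delta1, hpow]
  field_simp
  ring

end Concentration

/-! ### Exploitation: an error makes an exploration phase likely -/

section Exploitation

variable {N : ℕ} (γ ε δ : ℝ) (ν : Fin N → Env A O R) (π : Policy A O R)
  (πs : Fin N → Policy A O R) (sel : Finset (Fin N) → History A O R → Choice N)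

local notation "St" => stateAt γ ε δ ν πs sel

/-- The largest `Δ` over the triples in the current model class. -/
def maxGap (h : History A O R) : ℝ := gap γ ε ν πs (sel (St h).models h) h

local notation "Gap" => maxGap γ ε δ ν πs sel

open Classical in
/-- The sum of the `Δ` of the exploration phases started in the history. -/
def gapSum : History A O R → ℝ
  | [] => 0
  | _ :: h => gapSum h + if Starts γ ε δ ν πs sel h then maxGap γ ε δ ν πs sel h else 0

open Classical in
/-- The expectation of the `Δ` of the first exploration phase that starts within the next `n`
time-steps, when `ν i₀` is the true environment. -/
def firstGap (i₀ : Fin N) : ℕ → History A O R → ℝ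
  | 0 => fun _ => 0
  | n + 1 => fun h =>
    if Starts γ ε δ ν πs sel h then maxGap γ ε δ ν πs sel h
    else stepMean (ν i₀) π (firstGap i₀ n) h

/-- The policy is not `ε`-optimal at the history `h`, where it exploits although the true
environment `ν i₀` is still in the model class. -/
def IsFailure (i₀ : Fin N) (h : History A O R) : Prop :=
  curPhase γ ε δ ν πs sel h = none ∧ i₀ ∈ (St h).models ∧
    ε < optValue γ (ν i₀) h - value γ (ν i₀) π h

variable {γ ε δ ν π πs sel}

lemma phase_eq_none_of_curPhase {h : History A O R} (hc : curPhase γ ε δ ν πs sel h = none) :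
    (St h).phase = none ∧ ¬ Starts γ ε δ ν πs sel h := by
  constructor
  · rcases hph : (St h).phase with _ | p
    · rfl
    · rw [curPhase_of_phase_eq_some hph] at hc
      simp at hc
  · intro hs
    rw [hs.curPhase_eq] at hc
    simp at hc

/-- The choice of the effective horizon. -/
lemma IsRun.pow_phaseLen_le (run : IsRun γ ε δ ν π πs sel) :
    γ ^ phaseLen γ ε * (1 / (1 - γ)) ≤ ε / 8 := by
  have hg := run.one_sub_pos
  have hε := run.ε_pos
  have hpos : 0 < 8 / ((1 - γ) * ε) := by positivity
  have h1 : γ ^ phaseLen γ ε ≤ Real.exp (-(1 - γ)) ^ phaseLen γ ε := by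
    refine pow_le_pow_left₀ run.γ_pos.le ?_ _
    linarith [Real.add_one_le_exp (-(1 - γ))]
  have h2 : Real.exp (-(1 - γ)) ^ phaseLen γ ε ≤ (1 - γ) * ε / 8 := by
    rw [← Real.exp_nat_mul]
    have h3 : horizon γ ε ≤ phaseLen γ ε := Nat.le_ceil _
    have h4 : Real.log (8 / ((1 - γ) * ε)) = (1 - γ) * horizon γ ε := by
      rw [horizon]
      field_simp
    have h5 : (1 - γ) * ε / 8 = Real.exp (- Real.log (8 / ((1 - γ) * ε))) := by
      rw [Real.exp_neg, Real.exp_log hpos, inv_div]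
    rw [h5, h4]
    refine Real.exp_le_exp.2 ?_
    nlinarith
  calc γ ^ phaseLen γ ε * (1 / (1 - γ)) ≤ (1 - γ) * ε / 8 * (1 / (1 - γ)) :=
        mul_le_mul_of_nonneg_right (h1.trans h2) (one_div_pos.2 hg).le
    _ = ε / 8 := by field_simp

lemma IsRun.gap_le (run : IsRun γ ε δ ν π πs sel) (c : Choice N) (h : History A O R) :
    (1 - γ) * gap γ ε ν πs c h ≤ 1 := by
  have hg := run.one_sub_pos
  have h1 := valueN_le (ν c.up) (πs c.pol) run.rew run.γ_pos run.γ_lt h (phaseLen γ ε)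
  have h2 := valueN_nonneg (ν c.lo) (πs c.pol) run.rew run.γ_pos h (phaseLen γ ε)
  rw [le_div_iff₀ hg] at h1
  rw [gap]
  nlinarith

/-- All models of the class agree up to `Δ` on the values of all candidate policies, so that the
candidate policies are almost equally good in the true environment. -/
lemma IsRun.value_sub_valueN_le (run : IsRun γ ε δ ν π πs sel) {i₀ j : Fin N} {h : History A O R}
    (hi : i₀ ∈ (St h).models) (hj : j ∈ (St h).models) :
    value γ (ν i₀) (πs i₀) h - valueN γ (ν i₀) (πs j) h (phaseLen γ ε) ≤ 2 * Gap h + ε / 4 := by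
  have hmax := (run.argmax (St h).models h ⟨i₀, hi⟩).2
  have h1 := value_le_valueN_add (ν i₀) (πs i₀) run.rew run.γ_pos run.γ_lt h (phaseLen γ ε)
  have h2 := hmax ⟨i₀, j, i₀⟩ hi hj hi
  have h3 := valueN_le_value (ν j) (πs i₀) run.rew run.γ_pos run.γ_lt h (phaseLen γ ε)
  have h4 := run.opt j (πs i₀) h
  have h5 := value_le_valueN_add (ν j) (πs j) run.rew run.γ_pos run.γ_lt h (phaseLen γ ε)
  have h6 := hmax ⟨j, i₀, j⟩ hj hi hj
  have h7 := run.pow_phaseLen_le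
  simp only [maxGap]
  rw [gap] at h2 h6
  dsimp only at h2 h6
  linarith

/-- The loss of the actual policy at the start of an exploration phase. -/
lemma IsRun.value_sub_value_le_of_starts (run : IsRun γ ε δ ν π πs sel) {i₀ : Fin N}
    {h : History A O R} (hi : i₀ ∈ (St h).models) (hs : Starts γ ε δ ν πs sel h) :
    value γ (ν i₀) (πs i₀) h - value γ (ν i₀) π h ≤ 3 * Gap h := by
  have h1 := run.value_sub_valueN_le hi (run.argmax (St h).models h hs.2.1).1.2.2
  rw [← run.valueN_of_starts (ν i₀) hs] at h1
  have h2 := valueN_le_value (ν i₀) π run.rew run.γ_pos run.γ_lt h (phaseLen γ ε)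
  have h3 : ε / 4 < Gap h := hs.2.2
  linarith

lemma IsRun.maxGap_le_of_not_starts {h : History A O R}
    (hph : (St h).phase = none) (hM : (St h).models.Nonempty)
    (hs : ¬ Starts γ ε δ ν πs sel h) : Gap h ≤ ε / 4 :=
  not_lt.1 fun h' => hs ⟨hph, hM, h'⟩

open Classical in
lemma firstGap_succ (i₀ : Fin N) (n : ℕ) (h : History A O R) :
    firstGap γ ε δ ν π πs sel i₀ (n + 1) h = if Starts γ ε δ ν πs sel h then Gap h
      else stepMean (ν i₀) π (firstGap γ ε δ ν π πs sel i₀ n) h := rfl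

lemma firstGap_nonneg (hε : 0 < ε) (i₀ : Fin N) (n : ℕ) (h : History A O R) :
    0 ≤ firstGap γ ε δ ν π πs sel i₀ n h := by
  induction n generalizing h with
  | zero => exact le_rfl
  | succ n ih =>
    rw [firstGap_succ]
    split_ifs with hs
    · have : ε / 4 < Gap h := hs.2.2
      linarith
    · rw [← stepMean_const (ν i₀) π 0 h]
      exact stepMean_mono_at _ _ fun s => ih _

/-- Until the next exploration phase starts, the policy is the optimal policy of the first model; the
actual policy can lose against it only from then on, or after the horizon `n`. -/
lemma IsRun.value_min_sub_value_le (run : IsRun γ ε δ ν π πs sel) {i₀ : Fin N}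
    {M : Finset (Fin N)} (hi : i₀ ∈ M) (n : ℕ) {h : History A O R}
    (hph : (St h).phase = none) (hM : (St h).models = M) :
    value γ (ν i₀) (πs (M.min' ⟨i₀, hi⟩)) h - value γ (ν i₀) π h ≤
      3 * firstGap γ ε δ ν π πs sel i₀ n h + γ ^ n * (1 / (1 - γ)) := by
  induction n generalizing h with
  | zero =>
    have h1 := value_le (ν i₀) (πs (M.min' ⟨i₀, hi⟩)) run.rew run.γ_pos run.γ_lt h
    have h2 := value_nonneg (ν i₀) π run.rew run.γ_pos run.γ_lt h
    simp only [firstGap, pow_zero]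
    linarith
  | succ n ih =>
    rw [firstGap_succ]
    split_ifs with hs
    · have h1 := run.value_sub_value_le_of_starts (hM ▸ hi) hs
      have h2 := run.opt i₀ (πs (M.min' ⟨i₀, hi⟩)) h
      have h3 : 0 ≤ γ ^ (n + 1) * (1 / (1 - γ)) :=
        mul_nonneg (pow_nonneg run.γ_pos.le _) (one_div_pos.2 run.one_sub_pos).le
      linarith
    · have hc := curPhase_of_not_starts hph hs
      have hπ : π h = πs (M.min' ⟨i₀, hi⟩) h := by
        have hf := run.follow h (by rw [hM]; exact ⟨i₀, hi⟩)
        rw [curPhase] at hc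
        rw [hf, hc]
        simp only [hM]
      rw [value_eq (ν i₀) π run.rew run.γ_pos run.γ_lt,
        value_eq (ν i₀) (πs _) run.rew run.γ_pos run.γ_lt, meanRew_policy_congr hπ.symm,
        stepMean_policy_congr hπ.symm]
      have h1 : stepMean (ν i₀) π (value γ (ν i₀) (πs (M.min' ⟨i₀, hi⟩))) h ≤
          stepMean (ν i₀) π (fun l => value γ (ν i₀) π l +
            (3 * firstGap γ ε δ ν π πs sel i₀ n l + γ ^ n * (1 / (1 - γ)))) h := by
        refine stepMean_mono_at _ _ fun s => ?_
        have := ih (h := s :: h) (by rw [stateAt_cons_none hc, hph])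
          (by rw [stateAt_cons_none hc, hM])
        linarith
      rw [stepMean_add (ν i₀) π (value γ (ν i₀) π), stepMean_add (ν i₀) π
        (fun l => 3 * firstGap γ ε δ ν π πs sel i₀ n l) (fun _ => γ ^ n * (1 / (1 - γ))),
        stepMean_const, stepMean_mul] at h1
      have h2 : 0 ≤ stepMean (ν i₀) π (firstGap γ ε δ ν π πs sel i₀ n) h := by
        rw [← stepMean_const (ν i₀) π 0 h]
        exact stepMean_mono_at _ _ fun s => firstGap_nonneg run.ε_pos _ _ _
      have h3 := mul_le_mul_of_nonneg_left h1 run.γ_pos.le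
      have h4 := run.γ_lt
      rw [pow_succ]
      nlinarith

/-- A failure makes an exploration phase within the next `phaseLen γ ε` time-steps likely. -/
lemma IsFailure.le_firstGap (run : IsRun γ ε δ ν π πs sel) {i₀ : Fin N} {h : History A O R}
    (hf : IsFailure γ ε δ ν π πs sel i₀ h) :
    ε / 24 ≤ firstGap γ ε δ ν π πs sel i₀ (phaseLen γ ε) h := by
  obtain ⟨hc, hi, herr⟩ := hf
  obtain ⟨hph, hs⟩ := phase_eq_none_of_curPhase hc
  rw [(run.opt i₀).optValue_eq] at herr
  have h1 := run.value_min_sub_value_le hi (phaseLen γ ε) hph rfl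
  have h2 := run.value_sub_valueN_le hi ((St h).models.min'_mem ⟨i₀, hi⟩)
  have h3 := valueN_le_value (ν i₀) (πs ((St h).models.min' ⟨i₀, hi⟩)) run.rew run.γ_pos run.γ_lt
    h (phaseLen γ ε)
  have h4 := IsRun.maxGap_le_of_not_starts hph ⟨i₀, hi⟩ hs
  have h5 := run.pow_phaseLen_le
  linarith

lemma exp_neg_quarter_le {x : ℝ} (hx0 : 0 ≤ x) (hx1 : x ≤ 1) :
    Real.exp (-(x / 4)) ≤ 1 - 7 / 32 * x := by
  have h1 := Real.quadratic_le_exp_of_nonneg (x := x / 4) (by linarith)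
  rw [Real.exp_neg, inv_le_iff_one_le_mul₀ (Real.exp_pos _)]
  have h2 : 0 ≤ 1 - 7 / 32 * x := by linarith
  refine le_trans ?_ (mul_le_mul_of_nonneg_left h1 h2)
  nlinarith [mul_nonneg hx0 hx0, mul_nonneg hx0 (sub_nonneg.2 hx1),
    mul_nonneg (mul_nonneg hx0 hx0) (sub_nonneg.2 hx1)]

open Classical in
lemma gapSum_le_cons (hε : 0 < ε) (h : History A O R) (s : Step A O R) :
    gapSum γ ε δ ν πs sel h ≤ gapSum γ ε δ ν πs sel (s :: h) := by
  rw [gapSum]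
  split_ifs with hs
  · have : ε / 4 < Gap h := hs.2.2
    linarith
  · linarith

/-- The Laplace transform of the sum of the `Δ` over the next `n` time-steps is controlled by the
expectation of the first one. -/
lemma IsRun.iterate_exp_gapSum_le (run : IsRun γ ε δ ν π πs sel) (i₀ : Fin N) (n : ℕ)
    (h : History A O R) :
    (stepMean (ν i₀) π)^[n] (fun l => Real.exp (-((1 - γ) * gapSum γ ε δ ν πs sel l / 4))) h ≤
      Real.exp (-((1 - γ) * gapSum γ ε δ ν πs sel h / 4)) *
        (1 - 7 / 32 * ((1 - γ) * firstGap γ ε δ ν π πs sel i₀ n h)) := by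
  have hg := run.one_sub_pos
  have hmono : ∀ l : History A O R, ∀ n,
      (stepMean (ν i₀) π)^[n] (fun l => Real.exp (-((1 - γ) * gapSum γ ε δ ν πs sel l / 4))) l ≤
        Real.exp (-((1 - γ) * gapSum γ ε δ ν πs sel l / 4)) := by
    intro l n
    rw [← iterate_stepMean_const (ν i₀) π n (Real.exp (-((1 - γ) * gapSum γ ε δ ν πs sel l / 4))) l]
    refine iterate_stepMean_mono_at _ _ n fun l' hl => Real.exp_le_exp.2 ?_
    clear hl
    have : gapSum γ ε δ ν πs sel l ≤ gapSum γ ε δ ν πs sel (l' ++ l) := by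
      induction l' with
      | nil => exact le_rfl
      | cons s l' ih => exact ih.trans (gapSum_le_cons run.ε_pos _ s)
    nlinarith
  induction n generalizing h with
  | zero => simp [firstGap]
  | succ n ih =>
    rw [Function.iterate_succ_apply']
    by_cases hs : Starts γ ε δ ν πs sel h
    · have h1 : ∀ s, (stepMean (ν i₀) π)^[n]
          (fun l => Real.exp (-((1 - γ) * gapSum γ ε δ ν πs sel l / 4))) (s :: h) ≤
          Real.exp (-((1 - γ) * gapSum γ ε δ ν πs sel h / 4)) *
            Real.exp (-((1 - γ) * Gap h / 4)) := by
        intro s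
        refine (hmono _ n).trans_eq ?_
        rw [gapSum, if_pos hs, ← Real.exp_add]
        ring_nf
      refine (stepMean_mono_at (ν i₀) π (g := fun _ => _) h1).trans ?_
      rw [stepMean_const, firstGap_succ, if_pos hs]
      have h2 : 0 ≤ Gap h := by
        have : ε / 4 < Gap h := hs.2.2
        linarith [run.ε_pos]
      exact mul_le_mul_of_nonneg_left
        (exp_neg_quarter_le (mul_nonneg hg.le h2) (run.gap_le _ h)) (Real.exp_pos _).le
    · rw [firstGap_succ, if_neg hs]
      have h1 : ∀ s, (stepMean (ν i₀) π)^[n]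
          (fun l => Real.exp (-((1 - γ) * gapSum γ ε δ ν πs sel l / 4))) (s :: h) ≤
          Real.exp (-((1 - γ) * gapSum γ ε δ ν πs sel h / 4)) *
            (1 - 7 / 32 * (1 - γ) * firstGap γ ε δ ν π πs sel i₀ n (s :: h)) := by
        intro s
        refine (ih (s :: h)).trans_eq ?_
        rw [gapSum, if_neg hs, add_zero]
        ring
      refine (stepMean_mono_at (ν i₀) π (g := fun l =>
        Real.exp (-((1 - γ) * gapSum γ ε δ ν πs sel h / 4)) *
          (1 - 7 / 32 * (1 - γ) * firstGap γ ε δ ν π πs sel i₀ n l)) h1).trans_eq ?_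
      rw [stepMean_mul,
        stepMean_sub (ν i₀) π (fun _ => 1)
          (fun l => 7 / 32 * (1 - γ) * firstGap γ ε δ ν π πs sel i₀ n l),
        stepMean_const, stepMean_mul]
      ring

/-! ### Failure blocks -/

variable (γ ε δ ν π πs sel)

open Classical in
/-- The number of time-steps left in the current failure block: a block of `phaseLen γ ε` time-steps
that starts at the first failure outside of the preceding blocks. -/
def failRemaining (i₀ : Fin N) : History A O R → ℕ
  | [] => 0
  | _ :: h =>
    if failRemaining i₀ h = 0 then
      if IsFailure γ ε δ ν π πs sel i₀ h then phaseLen γ ε - 1 else 0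
    else failRemaining i₀ h - 1

open Classical in
/-- The number of failure blocks started in the history. -/
def failBlocks (i₀ : Fin N) : History A O R → ℕ
  | [] => 0
  | _ :: h => failBlocks i₀ h +
    if failRemaining γ ε δ ν π πs sel i₀ h = 0 ∧ IsFailure γ ε δ ν π πs sel i₀ h then 1 else 0

variable {γ ε δ ν π πs sel}

lemma failBlocks_append {i₀ : Fin N} {h : History A O R}
    (h0 : failRemaining γ ε δ ν π πs sel i₀ h = 0) (hf : IsFailure γ ε δ ν π πs sel i₀ h)
    (k : ℕ) (hk : k < phaseLen γ ε) (l : History A O R) (hl : l.length = k + 1) :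
    failRemaining γ ε δ ν π πs sel i₀ (l ++ h) = phaseLen γ ε - (k + 1) ∧
      failBlocks γ ε δ ν π πs sel i₀ (l ++ h) = failBlocks γ ε δ ν π πs sel i₀ h + 1 := by
  induction k generalizing l with
  | zero =>
    obtain ⟨s, rfl⟩ := List.length_eq_one_iff.1 hl
    simp only [List.cons_append, List.nil_append]
    rw [failRemaining, failBlocks, if_pos h0, if_pos hf, if_pos ⟨h0, hf⟩]
    simp
  | succ k ih =>
    obtain ⟨s, l, rfl⟩ := List.exists_cons_of_length_eq_add_one hl
    obtain ⟨h1, h2⟩ := ih (by omega) l (by simpa using hl)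
    have h3 : failRemaining γ ε δ ν π πs sel i₀ (l ++ h) ≠ 0 := by omega
    rw [List.cons_append, failRemaining, failBlocks, if_neg h3, if_neg fun h' => h3 h'.1, h1, h2]
    omega

/-- The number of failure blocks is controlled by the `Δ` of the exploration phases: with high
probability, the sum of the `Δ` is not much smaller than its conditional expectations add up to. -/
lemma IsRun.failBlocks_tail (run : IsRun γ ε δ ν π πs sel) (i₀ : Fin N) {c : ℝ} (hc : 0 < c) :
    law (ν i₀) π {ω | ∃ t, failRemaining γ ε δ ν π πs sel i₀ (pref ω t) = 0 ∧
      c ≤ Real.exp (7 * (1 - γ) * ε / 768 * failBlocks γ ε δ ν π πs sel i₀ (pref ω t) -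
        (1 - γ) * gapSum γ ε δ ν πs sel (pref ω t) / 4)} ≤ ENNReal.ofReal (1 / c) := by
  have hD := run.phaseLen_pos
  have hg := run.one_sub_pos
  -- `7 / 768 = 7 / 32 * (1 / 24)`: the decrease over a block, by `IsRun.iterate_exp_gapSum_le` and
  -- `IsFailure.le_firstGap`
  set η := 7 * (1 - γ) * ε / 768 with hη
  have := ville_block (ν i₀) π
    (Φ := fun l => Real.exp (η * failBlocks γ ε δ ν π πs sel i₀ l -
      (1 - γ) * gapSum γ ε δ ν πs sel l / 4)) (fun h => (Real.exp_pos _).le)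
    (r := failRemaining γ ε δ ν π πs sel i₀) rfl (fun h k s hr => ?_) ?_ hc
    (B := {h | failRemaining γ ε δ ν π πs sel i₀ h = 0 ∧
      c ≤ Real.exp (η * failBlocks γ ε δ ν π πs sel i₀ h -
        (1 - γ) * gapSum γ ε δ ν πs sel h / 4)}) (fun h hh => hh)
  · simpa [failBlocks, gapSum] using this
  · rw [failRemaining, if_neg (by omega)]
    omega
  · intro h hr
    by_cases hf : IsFailure γ ε δ ν π πs sel i₀ h
    · refine ⟨phaseLen γ ε - 1, fun s => ?_, ?_⟩
      · rw [failRemaining, if_pos hr, if_pos hf]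
      · rw [Nat.sub_add_cancel hD]
        have h1 : ∀ l : History A O R, l.length = phaseLen γ ε →
            Real.exp (η * failBlocks γ ε δ ν π πs sel i₀ (l ++ h) -
              (1 - γ) * gapSum γ ε δ ν πs sel (l ++ h) / 4) =
            Real.exp (η * (failBlocks γ ε δ ν π πs sel i₀ h + 1)) *
              Real.exp (-((1 - γ) * gapSum γ ε δ ν πs sel (l ++ h) / 4)) := by
          intro l hl
          have := (failBlocks_append hr hf (phaseLen γ ε - 1) (by omega) l (by omega)).2
          rw [this, ← Real.exp_add]
          push_cast
          ring_nf
        rw [iterate_stepMean_congr_at (ν i₀) π (phaseLen γ ε)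
          (g := fun l => Real.exp (η * (failBlocks γ ε δ ν π πs sel i₀ h + 1)) *
              Real.exp (-((1 - γ) * gapSum γ ε δ ν πs sel l / 4))) h1, iterate_stepMean_mul]
        have h2 := run.iterate_exp_gapSum_le i₀ (phaseLen γ ε) h
        have h3 := hf.le_firstGap run
        have h4 : 1 - 7 / 32 * ((1 - γ) * firstGap γ ε δ ν π πs sel i₀ (phaseLen γ ε) h) ≤
            Real.exp (-η) := by
          have := Real.add_one_le_exp (-η)
          nlinarith
        calc _ ≤ Real.exp (η * (failBlocks γ ε δ ν π πs sel i₀ h + 1)) *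
              (Real.exp (-((1 - γ) * gapSum γ ε δ ν πs sel h / 4)) * Real.exp (-η)) :=
              mul_le_mul_of_nonneg_left (h2.trans
                (mul_le_mul_of_nonneg_left h4 (Real.exp_pos _).le)) (Real.exp_pos _).le
          _ = _ := by
              rw [← Real.exp_add, ← Real.exp_add]
              ring_nf
    · refine ⟨0, fun s => ?_, ?_⟩
      · rw [failRemaining, if_pos hr, if_neg hf]
      · rw [zero_add, Function.iterate_one, ← stepMean_const (ν i₀) π
          (Real.exp (η * failBlocks γ ε δ ν π πs sel i₀ h -
            (1 - γ) * gapSum γ ε δ ν πs sel h / 4)) h]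
        refine stepMean_mono_at _ _ fun s => Real.exp_le_exp.2 ?_
        rw [failBlocks, if_neg fun h' => hf h'.2, add_zero]
        have := mul_le_mul_of_nonneg_left
          (gapSum_le_cons (γ := γ) (δ := δ) (ν := ν) (πs := πs) (sel := sel) run.ε_pos h s) hg.le
        linarith

/-! ### Counting time-steps -/

open Classical in
/-- The number of proper prefixes of the history that satisfy `P`. -/
def visits (P : History A O R → Prop) : History A O R → ℕ
  | [] => 0
  | _ :: h => visits P h + if P h then 1 else 0

/-- All failures lie in failure blocks. -/
lemma visits_failure_le (hD : 0 < phaseLen γ ε) (i₀ : Fin N) (h : History A O R) :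
    visits (IsFailure γ ε δ ν π πs sel i₀) h + failRemaining γ ε δ ν π πs sel i₀ h ≤
      phaseLen γ ε * failBlocks γ ε δ ν π πs sel i₀ h := by
  induction h with
  | nil => simp [visits, failRemaining]
  | cons s h ih =>
    rw [visits, failRemaining, failBlocks]
    by_cases h0 : failRemaining γ ε δ ν π πs sel i₀ h = 0
    · by_cases hf : IsFailure γ ε δ ν π πs sel i₀ h
      · rw [if_pos h0, if_pos hf, if_pos hf, if_pos ⟨h0, hf⟩, mul_add]
        omega
      · rw [if_pos h0, if_neg hf, if_neg hf, if_neg fun h' => hf h'.2, add_zero, add_zero,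
          add_zero]
        omega
    · have h1 : ¬ (failRemaining γ ε δ ν π πs sel i₀ h = 0 ∧
          IsFailure γ ε δ ν π πs sel i₀ h) := fun h' => h0 h'.1
      rw [if_neg h0, if_neg h1, add_zero]
      split_ifs <;> omega

/-- Exploration takes place only in the completed phases and in the one in progress. -/
lemma visits_explore_le (hD : 0 < phaseLen γ ε) (h : History A O R) :
    visits (fun h => curPhase γ ε δ ν πs sel h ≠ none) h ≤
      phaseLen γ ε * ((phases γ ε δ ν πs sel h).length + 1) := by
  have key : visits (fun h => curPhase γ ε δ ν πs sel h ≠ none) h ≤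
      phaseLen γ ε * (phases γ ε δ ν πs sel h).length +
        match (St h).phase with | none => 0 | some p => p.elapsed := by
    induction h with
    | nil => simp [visits]
    | cons s h ih =>
      rw [visits]
      rcases hc : curPhase γ ε δ ν πs sel h with _ | p
      · rw [phases_cons_none hc, stateAt_cons_none hc]
        simpa [hc] using ih
      · have h1 : (match (St h).phase with | none => 0 | some p => p.elapsed) = p.elapsed := by
          rcases hph : (St h).phase with _ | q
          · by_cases hs : Starts γ ε δ ν πs sel h
            · rw [hs.curPhase_eq, Option.some.injEq] at hc
              subst hc
              rfl
            · rw [curPhase_of_not_starts hph hs] at hc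
              simp at hc
          · rw [curPhase_of_phase_eq_some hph, Option.some.injEq] at hc
            subst hc
            rfl
        rw [h1] at ih
        rw [if_pos (by simp)]
        have hlt := (inPhase_of_curPhase hD hc).elapsed
        by_cases hq : p.elapsed + 1 < phaseLen γ ε
        · rw [phases_cons_mid hc hq, stateAt_cons_mid hc hq]
          simp only [Phase.next]
          omega
        · rw [phases_cons_end hc hq, stateAt_cons_end hc hq, List.length_cons, mul_add]
          simp only [endPhase]
          omega
  refine key.trans ?_
  rw [mul_add]
  rcases hph : (St h).phase with _ | p
  · simp
  · have := (inPhase_of_phase hD hph).1.elapsed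
    simp only
    omega

lemma encard_le_of_visits_le {P : History A O R → Prop} {ω : ℕ → Step A O R} {m : ℕ}
    (hm : ∀ t, visits P (pref ω t) ≤ m) : {t | P (pref ω t)}.encard ≤ m := by
  classical
  have hv : ∀ t, visits P (pref ω t) = ((Finset.range t).filter fun k => P (pref ω k)).card := by
    intro t
    induction t with
    | zero => simp [pref_zero, visits]
    | succ t ih =>
      rw [pref_succ, visits, ih, Finset.range_add_one, Finset.filter_insert]
      split_ifs
      · rw [Finset.card_insert_of_notMem (by simp)]
      · rfl
  by_contra! hlt
  obtain ⟨T, hT, hcard⟩ := Set.exists_subset_encard_eq (Order.add_one_le_of_lt hlt)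
  have hfin : T.Finite := Set.finite_of_encard_eq_coe (k := m + 1) (by simpa using hcard)
  obtain ⟨b, hb⟩ := hfin.bddAbove
  have h1 := hm (b + 1)
  rw [hv] at h1
  have h2 : T ⊆ ((Finset.range (b + 1)).filter fun k => P (pref ω k)) := by
    intro t ht
    simp only [Finset.coe_filter, Finset.mem_range, Set.mem_ofPred_eq]
    exact ⟨Nat.lt_succ_of_le (hb ht), hT ht⟩
  have h3 := Set.encard_le_encard h2
  rw [hcard, Set.encard_coe_eq_coe_finsetCard] at h3
  have h4 : m + 1 ≤ ((Finset.range (b + 1)).filter fun k => P (pref ω k)).card := by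
    exact_mod_cast h3
  omega

lemma visits_le_add {P Q Q' : History A O R → Prop} (ω : ℕ → Step A O R)
    (hPQ : ∀ t, P (pref ω t) → Q (pref ω t) ∨ Q' (pref ω t)) (t : ℕ) :
    visits P (pref ω t) ≤ visits Q (pref ω t) + visits Q' (pref ω t) := by
  induction t with
  | zero => simp [pref_zero, visits]
  | succ t ih =>
    rw [pref_succ, visits, visits, visits]
    have := hPQ t
    by_cases hP : P (pref ω t)
    · rcases this hP with hQ | hQ
      · simp only [hP, hQ, if_true]
        omega
      · simp only [hP, hQ, if_true]
        omega
    · simp only [hP, if_false]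
      omega

end Exploitation

/-! ### The number of exploration phases -/

section Exploration

variable {N : ℕ} (γ ε δ : ℝ) (ν : Fin N → Env A O R) (π : Policy A O R)
  (πs : Fin N → Policy A O R) (sel : Finset (Fin N) → History A O R → Choice N)

local notation "St" => stateAt γ ε δ ν πs sel

local notation "Phs" => phases γ ε δ ν πs sel

/-- The event that no test is disturbed by a large deviation: the centred statistics of no model are
very negative, and those of the true environment `ν i₀` are not very positive. -/
structure IsTypical (i₀ : Fin N) (ω : ℕ → Step A O R) : Prop where
  lower : ∀ i, ∀ κ ∈ kappas γ ε, ∀ j t, pref ω t ∉ BadTest γ ε δ ν πs sel (-1) i₀ i κ j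
  upper : ∀ κ ∈ kappas γ ε, ∀ j t, pref ω t ∉ BadTest γ ε δ ν πs sel 1 i₀ i₀ κ j

/-- The sum of the expectations of the statistics `X(i, κ)` of the completed phases. -/
def meanSum (i₀ i : Fin N) (κ : ℕ) (h : History A O R) : ℝ :=
  ((Phs h).map (Phase.mean γ ε ν πs i₀ i κ)).sum

variable {γ ε δ ν π πs sel}

lemma Starts.up_ne_lo (hε : 0 < ε) {h : History A O R} (hs : Starts γ ε δ ν πs sel h) :
    (sel (St h).models h).up ≠ (sel (St h).models h).lo := by
  intro heq
  have h1 := hs.2.2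
  rw [GeneralRL.gap, heq, sub_self] at h1
  linarith

lemma IsCompleted.lt_gap {h : History A O R} {p : Phase N A O R}
    (hp : IsCompleted γ ε δ ν πs sel h p) : ε / 4 < p.gap γ ε ν πs := by
  rw [Phase.gap, hp.choice]
  exact hp.starts.2.2

/-- The defining property of `κ`. -/
lemma two_pow_bucket (hε : 0 < ε) {p : Phase N A O R} (hp : ε / 4 < p.gap γ ε ν πs) :
    ε * 2 ^ p.bucket γ ε ν πs / 4 ≤ p.gap γ ε ν πs ∧
      p.gap γ ε ν πs ≤ ε * 2 ^ p.bucket γ ε ν πs / 2 := by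
  set Δ := p.gap γ ε ν πs with hΔ
  have h1 : 1 ≤ 4 * Δ / ε := by
    rw [le_div_iff₀ hε]
    linarith
  have h2 : ⌊4 * Δ / ε⌋₊ ≠ 0 := (Nat.floor_pos.2 h1).ne'
  have hb : p.bucket γ ε ν πs = Nat.log 2 ⌊4 * Δ / ε⌋₊ := rfl
  rw [hb]
  set k := Nat.log 2 ⌊4 * Δ / ε⌋₊
  constructor
  · have h3 : ((2 ^ k : ℕ) : ℝ) ≤ 4 * Δ / ε :=
      (Nat.cast_le.2 (Nat.pow_log_le_self 2 h2)).trans (Nat.floor_le (by linarith))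
    push_cast at h3
    rw [le_div_iff₀ hε] at h3
    linarith
  · have h3 : 4 * Δ / ε < ((2 ^ (k + 1) : ℕ) : ℝ) := by
      refine (Nat.lt_floor_add_one _).trans_le ?_
      exact_mod_cast Nat.lt_pow_succ_log_self (by norm_num) _
    push_cast at h3
    rw [div_lt_iff₀ hε, pow_succ] at h3
    linarith

lemma IsRun.bucket_mem_kappas (run : IsRun γ ε δ ν π πs sel) {p : Phase N A O R}
    (hp : ε / 4 < p.gap γ ε ν πs) : p.bucket γ ε ν πs ∈ kappas γ ε := by
  have hg := run.one_sub_pos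
  have hε := run.ε_pos
  have h1 := (two_pow_bucket hε hp).1
  have h2 : (1 - γ) * p.gap γ ε ν πs ≤ 1 := run.gap_le _ _
  set k := p.bucket γ ε ν πs
  rw [kappas, Finset.mem_range, Nat.lt_succ_iff]
  refine Nat.le_floor ?_
  have hy : 0 < ε * (1 - γ) := mul_pos hε hg
  have h3 : (2 : ℝ) ^ k ≤ 4 * (1 / (ε * (1 - γ))) := by
    rw [mul_one_div, le_div_iff₀ hy]
    nlinarith
  have h4 : (k : ℝ) = Real.logb 2 (2 ^ k) := by
    rw [Real.logb_pow, Real.logb_self_eq_one (by norm_num), mul_one]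
  have h5 : Real.logb 2 4 = 2 := by
    rw [show (4 : ℝ) = 2 ^ 2 by norm_num, Real.logb_pow, Real.logb_self_eq_one (by norm_num)]
    norm_num
  rw [h4]
  refine (Real.logb_le_logb_of_le (by norm_num) (by positivity) h3).trans_eq ?_
  rw [Real.logb_mul (by norm_num) (by positivity), h5, add_comm]

lemma mem_models_endPhase {σ : State N A O R} {p : Phase N A O R} {i : Fin N} :
    i ∈ (endPhase γ ε δ ν πs σ p).models ↔ i ∈ σ.models ∧
      ¬ Fails γ ε δ (endPhase γ ε δ ν πs σ p).count (endPhase γ ε δ ν πs σ p).stat i := by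
  simp [endPhase]

lemma IsRun.mem_kappas_of_count_pos (run : IsRun γ ε δ ν π πs sel) {h : History A O R} {i : Fin N}
    {κ : ℕ} (hc : 0 < (St h).count i κ) : κ ∈ kappas γ ε := by
  rw [count_stateAt] at hc
  obtain ⟨x, hx, hx0⟩ : ∃ x ∈ (Phs h).map (Phase.inc γ ε ν πs i κ), x ≠ 0 := by
    by_contra! hall
    exact hc.ne' (List.sum_eq_zero hall)
  obtain ⟨p, hp, rfl⟩ := List.mem_map.1 hx
  have hκ : κ = p.bucket γ ε ν πs := by
    by_contra hne
    exact hx0 (if_neg fun h' => hne h'.1)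
  rw [hκ]
  exact run.bucket_mem_kappas (isCompleted_of_mem_phases run.phaseLen_pos hp).lt_gap

lemma mean_self (i₀ : Fin N) (κ : ℕ) (p : Phase N A O R) :
    p.mean γ ε ν πs i₀ i₀ κ = 0 := by
  rw [Phase.mean, Phase.dev]
  simp

lemma stat_self (i₀ : Fin N) (κ : ℕ) (h : History A O R) :
    (St h).stat i₀ κ = noiseSum γ ε δ ν πs sel i₀ i₀ κ h := by
  rw [stat_eq_mean_add_noise i₀, List.sum_eq_zero, zero_add]
  intro x hx
  obtain ⟨p, -, rfl⟩ := List.mem_map.1 hx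
  exact mean_self i₀ κ p

/-- The true environment survives all tests. -/
lemma IsTypical.mem_models (run : IsRun γ ε δ ν π πs sel) {i₀ : Fin N} {ω : ℕ → Step A O R}
    (hω : IsTypical γ ε δ ν πs sel i₀ ω) (t : ℕ) : i₀ ∈ (St (pref ω t)).models := by
  induction t with
  | zero => simp [pref_zero, stateAt]
  | succ t ih =>
    have hpos := alphaSeq_pos (Fin.pos i₀)
    rcases hc : curPhase γ ε δ ν πs sel (pref ω t) with _ | p
    · rwa [pref_succ, stateAt_cons_none hc]
    · by_cases hq : p.elapsed + 1 < phaseLen γ ε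
      · rwa [pref_succ, stateAt_cons_mid hc hq]
      · have hend := stateAt_cons_end hc hq (ω t)
        rw [← pref_succ] at hend
        rw [hend, mem_models_endPhase, ← hend]
        refine ⟨ih, ?_⟩
        rintro ⟨κ, j, h1, h2⟩
        refine hω.upper κ (run.mem_kappas_of_count_pos (by rw [h1]; exact hpos j)) j (t + 1)
          ⟨by rw [hend]; rfl, h1, ?_⟩
        rw [one_mul, ← stat_self, ← h1]
        exact h2

/-- A model in the class has passed all its tests so far. -/
lemma stat_lt_of_mem_models (hN : 0 < N) {h : History A O R} {i : Fin N} (hi : i ∈ (St h).models)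
    {κ j : ℕ} (hc : (St h).count i κ = alphaSeq N j) :
    (St h).stat i κ <
      √(2 * (alphaSeq N j : ℝ) * Real.log ((alphaSeq N j : ℝ) / delta1 N γ ε δ)) := by
  induction h with
  | nil =>
    have := alphaSeq_pos hN j
    simp only [stateAt] at hc
    omega
  | cons s h ih =>
    rcases hcur : curPhase γ ε δ ν πs sel h with _ | p
    · rw [stateAt_cons_none hcur] at hi hc ⊢
      exact ih hi hc
    · by_cases hq : p.elapsed + 1 < phaseLen γ ε
      · rw [stateAt_cons_mid hcur hq] at hi hc ⊢
        exact ih hi hc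
      · rw [stateAt_cons_end hcur hq] at hi hc ⊢
        have h2 := (mem_models_endPhase.1 hi).2
        by_contra hle
        refine h2 ⟨κ, j, hc, ?_⟩
        rw [hc]
        exact not_lt.1 hle

lemma IsTypical.neg_noiseSum_lt {i₀ : Fin N} {ω : ℕ → Step A O R}
    (hω : IsTypical γ ε δ ν πs sel i₀ ω) (t : ℕ) {i : Fin N} {κ j : ℕ} (hκ : κ ∈ kappas γ ε)
    (hc : (St (pref ω t)).count i κ = alphaSeq N j) :
    - noiseSum γ ε δ ν πs sel i₀ i κ (pref ω t) <
      √(2 * (alphaSeq N j : ℝ) * Real.log ((alphaSeq N j : ℝ) / delta1 N γ ε δ)) := by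
  have hnone : ∀ t, (St (pref ω t)).phase = none → (St (pref ω t)).count i κ = alphaSeq N j →
      - noiseSum γ ε δ ν πs sel i₀ i κ (pref ω t) <
      √(2 * (alphaSeq N j : ℝ) * Real.log ((alphaSeq N j : ℝ) / delta1 N γ ε δ)) := by
    intro t hph hc
    by_contra hle
    exact hω.lower i κ hκ j t ⟨hph, hc, by rw [neg_one_mul]; exact not_lt.1 hle⟩
  induction t with
  | zero => exact hnone 0 (by simp [pref_zero, stateAt]) hc
  | succ t ih =>
    rcases hcur : curPhase γ ε δ ν πs sel (pref ω t) with _ | p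
    · refine hnone _ ?_ hc
      rw [pref_succ, stateAt_cons_none hcur]
      exact (phase_eq_none_of_curPhase hcur).1
    · by_cases hq : p.elapsed + 1 < phaseLen γ ε
      · rw [pref_succ, stateAt_cons_mid hcur hq] at hc
        rw [pref_succ, noiseSum, phases_cons_mid hcur hq]
        exact ih hc
      · refine hnone _ ?_ hc
        rw [pref_succ, stateAt_cons_end hcur hq]
        rfl

/-- As the chosen triple maximises `Δ`, the value of its policy in any model of the class, such as the
true environment, lies between the values in the lower and in the upper model. -/
lemma IsRun.value_between (run : IsRun γ ε δ ν π πs sel) {i₀ : Fin N} {h : History A O R}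
    (hi : i₀ ∈ (St h).models) :
    valueN γ (ν (sel (St h).models h).lo) (πs (sel (St h).models h).pol) h (phaseLen γ ε) ≤
        valueN γ (ν i₀) (πs (sel (St h).models h).pol) h (phaseLen γ ε) ∧
      valueN γ (ν i₀) (πs (sel (St h).models h).pol) h (phaseLen γ ε) ≤
        valueN γ (ν (sel (St h).models h).up) (πs (sel (St h).models h).pol) h (phaseLen γ ε) := by
  obtain ⟨⟨h1, h2, h3⟩, hmax⟩ := run.argmax (St h).models h ⟨i₀, hi⟩
  have h4 := hmax ⟨i₀, (sel (St h).models h).lo, (sel (St h).models h).pol⟩ hi h2 h3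
  have h5 := hmax ⟨(sel (St h).models h).up, i₀, (sel (St h).models h).pol⟩ h1 hi h3
  simp only [GeneralRL.gap] at h4 h5
  constructor <;> linarith

/-- The expectations of the two statistics recorded by a phase are nonnegative and add up to
`(1 - γ) Δ`. -/
lemma IsCompleted.mean_bounds (run : IsRun γ ε δ ν π πs sel) {i₀ : Fin N} {h : History A O R}
    (hi : i₀ ∈ (St h).models) {p : Phase N A O R} (hp : IsCompleted γ ε δ ν πs sel h p) :
    (∀ i κ, p.mean γ ε ν πs i₀ i κ ≤
      (1 - γ) * (ε * 2 ^ κ / 2) * p.inc γ ε ν πs i κ) ∧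
    (∀ κ, ∑ i, p.mean γ ε ν πs i₀ i κ =
      if p.bucket γ ε ν πs = κ then (1 - γ) * p.gap γ ε ν πs else 0) ∧
    (∀ κ, ∑ i, p.inc γ ε ν πs i κ = if p.bucket γ ε ν πs = κ then 2 else 0) := by
  have hne : p.choice.up ≠ p.choice.lo := by
    rw [hp.choice]
    exact hp.starts.up_ne_lo run.ε_pos
  have hbet := run.value_between (hp.models hi)
  rw [← hp.choice] at hbet
  have hb := (two_pow_bucket run.ε_pos hp.lt_gap).2
  have hgap : p.gap γ ε ν πs = valueN γ (ν p.choice.up) (πs p.choice.pol) p.start (phaseLen γ ε) -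
    valueN γ (ν p.choice.lo) (πs p.choice.pol) p.start (phaseLen γ ε) := rfl
  have hg := run.one_sub_pos
  have hup : p.mean γ ε ν πs i₀ p.choice.up (p.bucket γ ε ν πs) =
      (1 - γ) * (valueN γ (ν p.choice.up) (πs p.choice.pol) p.start (phaseLen γ ε) -
        valueN γ (ν i₀) (πs p.choice.pol) p.start (phaseLen γ ε)) := by
    rw [Phase.mean, Phase.dev, if_pos ⟨rfl, rfl⟩]
  have hlo : p.mean γ ε ν πs i₀ p.choice.lo (p.bucket γ ε ν πs) =
      (1 - γ) * (valueN γ (ν i₀) (πs p.choice.pol) p.start (phaseLen γ ε) -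
        valueN γ (ν p.choice.lo) (πs p.choice.pol) p.start (phaseLen γ ε)) := by
    rw [Phase.mean, Phase.dev, if_neg fun h' => hne h'.2.symm, if_pos ⟨rfl, rfl⟩]
  have hother : ∀ i κ, ¬ (κ = p.bucket γ ε ν πs ∧ (i = p.choice.up ∨ i = p.choice.lo)) →
      p.mean γ ε ν πs i₀ i κ = 0 := by
    intro i κ hno
    rw [Phase.mean, Phase.dev, if_neg fun h' => hno ⟨h'.1, Or.inl h'.2⟩,
      if_neg fun h' => hno ⟨h'.1, Or.inr h'.2⟩]
  refine ⟨fun i κ => ?_, fun κ => ?_, fun κ => ?_⟩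
  · by_cases hin : κ = p.bucket γ ε ν πs ∧ (i = p.choice.up ∨ i = p.choice.lo)
    · rw [Phase.inc, if_pos hin]
      obtain ⟨rfl, rfl | rfl⟩ := hin
      · rw [hup, Nat.cast_one, mul_one]
        exact mul_le_mul_of_nonneg_left (by linarith) hg.le
      · rw [hlo, Nat.cast_one, mul_one]
        exact mul_le_mul_of_nonneg_left (by linarith) hg.le
    · rw [hother i κ hin, Phase.inc, if_neg hin]
      simp
  · split_ifs with hκ
    · subst hκ
      rw [← Finset.sum_subset (Finset.subset_univ {p.choice.up, p.choice.lo}),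
        Finset.sum_pair hne, hup, hlo, hgap]
      · ring
      · intro i _ hi
        refine hother i _ fun h' => hi ?_
        simpa using h'.2
    · exact Finset.sum_eq_zero fun i _ => hother i κ fun h' => hκ h'.1.symm
  · split_ifs with hκ
    · subst hκ
      rw [← Finset.sum_subset (Finset.subset_univ {p.choice.up, p.choice.lo}),
        Finset.sum_pair hne, Phase.inc, Phase.inc, if_pos ⟨rfl, Or.inl rfl⟩,
        if_pos ⟨rfl, Or.inr rfl⟩]
      intro i _ hi
      refine if_neg fun h' => hi ?_
      simpa using h'.2
    · exact Finset.sum_eq_zero fun i _ => if_neg fun h' => hκ h'.1.symm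

/-- Between two consecutive tests the counter grows by a factor of at most about `alpha N`. -/
lemma le_alpha_mul_add_one (hN : 0 < N) {m n : ℕ} (h : ∀ j, m < alphaSeq N j → n ≤ alphaSeq N j) :
    (n : ℝ) ≤ alpha N * m + 1 := by
  have ha := one_lt_alpha hN
  have hex : ∃ j, m < alphaSeq N j := by
    obtain ⟨j, hj⟩ := pow_unbounded_of_one_lt (m : ℝ) ha
    exact ⟨j, by exact_mod_cast hj.trans_le (Nat.le_ceil _)⟩
  have h1 := h _ (Nat.find_spec hex)
  rcases hf : Nat.find hex with _ | j
  · rw [hf] at h1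
    have h2 : (n : ℝ) ≤ 1 := by
      have : alphaSeq N 0 = 1 := by simp [alphaSeq]
      rw [this] at h1
      exact_mod_cast h1
    have : 0 ≤ alpha N * m := mul_nonneg (by linarith) (Nat.cast_nonneg m)
    linarith
  · have h2 : ¬ m < alphaSeq N j := Nat.find_min hex (by omega)
    rw [hf] at h1
    have h3 : alpha N ^ j ≤ m := (Nat.le_ceil _).trans (by exact_mod_cast not_lt.1 h2)
    have h4 : (alphaSeq N (j + 1) : ℝ) < alpha N ^ (j + 1) + 1 :=
      Nat.ceil_lt_add_one (pow_nonneg (by linarith) _)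
    have h5 : (n : ℝ) ≤ alphaSeq N (j + 1) := by exact_mod_cast h1
    rw [pow_succ] at h4
    nlinarith

/-- The sum of the expectations is small at the last test that the model has passed, and afterwards
it grows by at most `(1 - γ) ε 2 ^ κ / 2` with each phase. -/
lemma IsTypical.exists_last_test (run : IsRun γ ε δ ν π πs sel) {i₀ : Fin N}
    {ω : ℕ → Step A O R} (hω : IsTypical γ ε δ ν πs sel i₀ ω) (t : ℕ) (i : Fin N) {κ : ℕ}
    (hκ : κ ∈ kappas γ ε) :
    ∃ m ≤ (St (pref ω t)).count i κ,
      (∀ j, m < alphaSeq N j → (St (pref ω t)).count i κ ≤ alphaSeq N j) ∧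
      meanSum γ ε δ ν πs sel i₀ i κ (pref ω t) ≤
        2 * √(2 * (m : ℝ) * Real.log (m / delta1 N γ ε δ)) +
          ((St (pref ω t)).count i κ - m : ℝ) * ((1 - γ) * (ε * 2 ^ κ / 2)) := by
  have hN := Fin.pos i₀
  have hx : 0 ≤ (1 - γ) * (ε * 2 ^ κ / 2) := by
    have := run.one_sub_pos
    have := run.ε_pos
    positivity
  induction t with
  | zero => exact ⟨0, Nat.zero_le _, by simp [pref_zero, stateAt, meanSum, phases]⟩
  | succ t ih =>
    obtain ⟨m, hm1, hm2, hm3⟩ := ih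
    rcases hc : curPhase γ ε δ ν πs sel (pref ω t) with _ | p
    · rw [pref_succ, stateAt_cons_none hc, meanSum, phases_cons_none hc]
      exact ⟨m, hm1, hm2, hm3⟩
    · by_cases hq : p.elapsed + 1 < phaseLen γ ε
      · rw [pref_succ, stateAt_cons_mid hc hq, meanSum, phases_cons_mid hc hq]
        exact ⟨m, hm1, hm2, hm3⟩
      · have hcount : (St (pref ω (t + 1))).count i κ =
            (p.next γ (ω t)).inc γ ε ν πs i κ + (St (pref ω t)).count i κ := by
          rw [pref_succ, stateAt_cons_end hc hq]
          exact count_endPhase γ ε ν πs δ _ _ i κ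
        have hmean : meanSum γ ε δ ν πs sel i₀ i κ (pref ω (t + 1)) =
            (p.next γ (ω t)).mean γ ε ν πs i₀ i κ +
              meanSum γ ε δ ν πs sel i₀ i κ (pref ω t) := by
          rw [meanSum, pref_succ, phases_cons_end hc hq]
          rfl
        have hcomp : IsCompleted γ ε δ ν πs sel (pref ω (t + 1)) (p.next γ (ω t)) := by
          refine isCompleted_of_mem_phases run.phaseLen_pos ?_
          rw [pref_succ, phases_cons_end hc hq]
          exact List.mem_cons_self
        have hb := (hcomp.mean_bounds run (hω.mem_models run (t + 1))).1 i κ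
        rw [hcount, hmean]
        by_cases hin : κ = (p.next γ (ω t)).bucket γ ε ν πs ∧
            (i = (p.next γ (ω t)).choice.up ∨ i = (p.next γ (ω t)).choice.lo)
        · have hinc : (p.next γ (ω t)).inc γ ε ν πs i κ = 1 := if_pos hin
          rw [hinc] at hb ⊢
          rw [Nat.cast_one, mul_one] at hb
          have hi : i ∈ (St (pref ω t)).models := by
            have hph := inPhase_of_curPhase run.phaseLen_pos hc
            have hsel := (run.argmax _ p.start hph.starts.2.1).1
            rw [← hph.choice, ← hph.models] at hsel
            rcases hin.2 with h' | h'
            · rw [h']; exact hsel.1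
            · rw [h']; exact hsel.2.1
          by_cases htest : ∃ j, (St (pref ω t)).count i κ = alphaSeq N j
          · obtain ⟨j, hj⟩ := htest
            refine ⟨(St (pref ω t)).count i κ, by omega, fun j' hj' => by omega, ?_⟩
            have h1 := stat_lt_of_mem_models hN hi hj
            have h2 := hω.neg_noiseSum_lt t hκ hj
            have h3 := stat_eq_mean_add_noise (γ := γ) (ε := ε) (δ := δ) (ν := ν) (πs := πs)
              (sel := sel) i₀ i κ (pref ω t)
            rw [← meanSum] at h3
            rw [← hj] at h1 h2
            push_cast
            linarith
          · refine ⟨m, by omega, fun j hj => ?_, ?_⟩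
            · have h1 := hm2 j hj
              have h2 : (St (pref ω t)).count i κ ≠ alphaSeq N j := fun h' => htest ⟨j, h'⟩
              omega
            · push_cast
              linarith
        · have hinc : (p.next γ (ω t)).inc γ ε ν πs i κ = 0 := if_neg hin
          rw [hinc] at hb ⊢
          rw [Nat.cast_zero, mul_zero] at hb
          rw [zero_add]
          exact ⟨m, hm1, hm2, by linarith⟩

/-- The number of completed phases with a given `κ`. -/
def phaseCount (γ ε δ : ℝ) (ν : Fin N → Env A O R) (πs : Fin N → Policy A O R)
    (sel : Finset (Fin N) → History A O R → Choice N) (κ : ℕ) (h : History A O R) : ℕ :=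
  ((phases γ ε δ ν πs sel h).map fun p => if p.bucket γ ε ν πs = κ then 1 else 0).sum

/-- Twice the threshold of a test, linearised in the counter `n` by the inequality between the
arithmetic and the geometric mean. -/
lemma sqrt_threshold_le {m n E : ℕ} (hmn : m ≤ n) (hnE : n ≤ E) {d x : ℝ} (hd0 : 0 < d)
    (hd1 : d ≤ 1) (hx : 0 < x) (hE : 0 < E) :
    2 * √(2 * (m : ℝ) * Real.log (m / d)) ≤ n * x / 32 + 64 * Real.log (E / d) / x := by
  have hE' : (1 : ℝ) ≤ E := by exact_mod_cast hE
  have hL : 0 ≤ Real.log (E / d) := Real.log_nonneg (by rw [le_div_iff₀ hd0]; linarith)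
  have hmn' : (m : ℝ) ≤ n := by exact_mod_cast hmn
  have hmE : (m : ℝ) ≤ E := by exact_mod_cast hmn.trans hnE
  have h1 : (m : ℝ) * Real.log (m / d) ≤ n * Real.log (E / d) := by
    rcases Nat.eq_zero_or_pos m with rfl | hm
    · simpa using mul_nonneg (Nat.cast_nonneg n) hL
    · have hm' : (0 : ℝ) < m := by exact_mod_cast hm
      have h2 : Real.log (m / d) ≤ Real.log (E / d) :=
        Real.log_le_log (by positivity) (by gcongr)
      calc (m : ℝ) * Real.log (m / d) ≤ m * Real.log (E / d) :=
            mul_le_mul_of_nonneg_left h2 hm'.le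
        _ ≤ _ := mul_le_mul_of_nonneg_right hmn' hL
  set L := Real.log (E / d)
  have hn0 : (0 : ℝ) ≤ n := Nat.cast_nonneg n
  have h3 : 0 ≤ n * x / 32 + 64 * L / x := by positivity
  have h4 : √(2 * (m : ℝ) * Real.log (m / d)) ≤ (n * x / 32 + 64 * L / x) / 2 := by
    refine Real.sqrt_le_iff.2 ⟨by linarith, ?_⟩
    have h5 : (n * x / 32) * (64 * L / x) = 2 * (n * L) := by
      field_simp
      ring
    nlinarith [sq_nonneg (n * x / 32 - 64 * L / x)]
  linarith

/-- For a single model this fails, but then there are no exploration phases at all. -/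
lemma alpha_sub_one_le (hN : 2 ≤ N) : alpha N - 1 ≤ 7 / 32 := by
  have h1 : (1.4 : ℝ) ≤ √(N : ℝ) := by
    refine Real.le_sqrt_of_sq_le ?_
    have : (2 : ℝ) ≤ N := by exact_mod_cast hN
    norm_num
    linarith
  rw [alpha, sub_le_iff_le_add, div_le_iff₀ (by linarith)]
  linarith

lemma delta1_le_one (hN : 0 < N) (hδ : 0 < δ) (hδ1 : δ < 1) : delta1 N γ ε δ ≤ 1 :=
  (delta1_le hN hδ hδ1).trans (by norm_num)

lemma sum_sum_map_comm {α ι M : Type*} [AddCommMonoid M] (l : List α) (s : Finset ι)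
    (f : ι → α → M) : ∑ i ∈ s, (l.map (f i)).sum = (l.map fun a => ∑ i ∈ s, f i a).sum := by
  induction l with
  | nil => simp
  | cons a l ih => simp [Finset.sum_add_distrib, ih]

/-- The number of phases with a given `κ`, up to the logarithm of that number itself. -/
lemma IsTypical.phaseCount_le_log (run : IsRun γ ε δ ν π πs sel) {i₀ : Fin N}
    {ω : ℕ → Step A O R} (hω : IsTypical γ ε δ ν πs sel i₀ ω) (t : ℕ) {κ : ℕ}
    (hκ : κ ∈ kappas γ ε) (hE : 0 < phaseCount γ ε δ ν πs sel κ (pref ω t)) :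
    (phaseCount γ ε δ ν πs sel κ (pref ω t) : ℝ) ≤
      16896 * N * Real.log (phaseCount γ ε δ ν πs sel κ (pref ω t) / delta1 N γ ε δ) /
        (ε ^ 2 * (1 - γ) ^ 2 * 4 ^ κ) := by
  have hN := Fin.pos i₀
  have hg := run.one_sub_pos
  have hε := run.ε_pos
  have hd := delta1_pos (γ := γ) (ε := ε) hN run.δ_pos
  have hd1 := delta1_le_one (γ := γ) (ε := ε) hN run.δ_pos run.δ_lt
  set h := pref ω t
  set E := phaseCount γ ε δ ν πs sel κ h with hEdef
  set x := (1 - γ) * (ε * 2 ^ κ) / 4 with hxdef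
  have hx : 0 < x := by positivity
  have hcomp : ∀ p ∈ Phs h, IsCompleted γ ε δ ν πs sel h p :=
    fun p hp => isCompleted_of_mem_phases run.phaseLen_pos hp
  have hi := hω.mem_models run t
  -- a phase with this `κ` exists, so that `x ≤ 1` and there are at least two models
  obtain ⟨p, hp, hpκ⟩ : ∃ p ∈ Phs h, p.bucket γ ε ν πs = κ := by
    by_contra! hall
    refine hE.ne' (List.sum_eq_zero fun y hy => ?_)
    obtain ⟨p, hp, rfl⟩ := List.mem_map.1 hy
    exact if_neg (hall p hp)
  have hx1 : x ≤ 1 := by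
    have h1 := (two_pow_bucket hε (hcomp p hp).lt_gap).1
    have h2 : (1 - γ) * p.gap γ ε ν πs ≤ 1 := run.gap_le _ _
    rw [hpκ] at h1
    have := mul_le_mul_of_nonneg_left h1 hg.le
    rw [hxdef]
    linarith
  have hN2 : 2 ≤ N := by
    have hne := (hcomp p hp).starts.up_ne_lo hε
    by_contra hlt
    obtain rfl : N = 1 := by omega
    exact hne (Subsingleton.elim _ _)
  -- the sums over all models
  have hcount : ∑ i, (St h).count i κ = 2 * E := by
    simp only [count_stateAt]
    rw [sum_sum_map_comm, hEdef, phaseCount, ← List.sum_map_mul_left]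
    refine congrArg List.sum (List.map_congr_left fun q hq => ?_)
    rw [((hcomp q hq).mean_bounds run hi).2.2 κ]
    split_ifs <;> rfl
  have hmean : x * E ≤ ∑ i, meanSum γ ε δ ν πs sel i₀ i κ h := by
    simp only [meanSum]
    rw [sum_sum_map_comm, hEdef, phaseCount, Nat.cast_list_sum, ← List.sum_map_mul_left,
      List.map_map]
    refine List.sum_le_sum fun q hq => ?_
    rw [((hcomp q hq).mean_bounds run hi).2.1 κ]
    simp only [Function.comp]
    have h1 := (two_pow_bucket hε (hcomp q hq).lt_gap).1
    split_ifs with hqκ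
    · rw [hqκ] at h1
      have := mul_le_mul_of_nonneg_left h1 hg.le
      rw [hxdef]
      push_cast
      linarith
    · simp
  have hnE : ∀ i, (St h).count i κ ≤ E := by
    intro i
    rw [count_stateAt, hEdef, phaseCount]
    refine List.sum_le_sum fun q _ => ?_
    rw [Phase.inc]
    by_cases hq : κ = q.bucket γ ε ν πs
    · rw [if_pos hq.symm]
      split_ifs <;> simp
    · rw [if_neg fun h' => hq h'.1]
      exact Nat.zero_le _
  set L := Real.log (E / delta1 N γ ε δ) with hL
  have hbound : ∀ i, meanSum γ ε δ ν πs sel i₀ i κ h ≤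
      ((St h).count i κ : ℝ) * (x / 32 + 7 / 16 * x) + (64 * L / x + 2 * x) := by
    intro i
    obtain ⟨m, hm1, hm2, hm3⟩ := hω.exists_last_test run t i hκ
    have h1 := sqrt_threshold_le hm1 (hnE i) hd hd1 hx hE
    have h2 := le_alpha_mul_add_one hN hm2
    have h3 := alpha_sub_one_le hN2
    have hm1' : (m : ℝ) ≤ (St h).count i κ := by exact_mod_cast hm1
    have h4 : ((St h).count i κ : ℝ) - m ≤ 7 / 32 * (St h).count i κ + 1 := by
      have : (alpha N - 1) * m ≤ 7 / 32 * m :=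
        mul_le_mul_of_nonneg_right h3 (Nat.cast_nonneg m)
      linarith
    have h5 := mul_le_mul_of_nonneg_right h4 (by positivity : 0 ≤ 2 * x)
    have h6 : (1 - γ) * (ε * 2 ^ κ / 2) = 2 * x := by rw [hxdef]; ring
    rw [h6] at hm3
    linarith
  have hsum := hmean.trans (Finset.sum_le_sum fun i _ => hbound i)
  rw [Finset.sum_add_distrib, ← Finset.sum_mul, ← Nat.cast_sum, hcount, Finset.sum_const,
    Finset.card_univ, Fintype.card_fin, nsmul_eq_mul] at hsum
  push_cast at hsum
  -- `hsum : x E ≤ 2 E (15 / 32) x + N (64 L / x + 2 x)`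
  have hE1 : (1 : ℝ) ≤ E := by exact_mod_cast hE
  have hL1 : 1 ≤ L := by
    have h32 : (32 : ℝ) ≤ E / delta1 N γ ε δ := by
      rw [le_div_iff₀ hd]
      linarith [delta1_le (γ := γ) (ε := ε) hN run.δ_pos run.δ_lt]
    rw [hL, Real.le_log_iff_exp_le (by linarith)]
    linarith [Real.exp_one_lt_d9]
  have hN' : (0 : ℝ) < N := by exact_mod_cast hN
  have h1 : x * E ≤ N * (1024 * L / x + 32 * x) := by
    have : (N : ℝ) * (1024 * L / x + 32 * x) = 16 * (N * (64 * L / x + 2 * x)) := by ring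
    rw [this]
    linarith
  have h2 : x * (x * E) ≤ N * (1056 * L) := by
    have h3 := mul_le_mul_of_nonneg_left h1 hx.le
    have h4 : x * (N * (1024 * L / x + 32 * x)) = N * (1024 * L + 32 * x ^ 2) := by
      field_simp
    rw [h4] at h3
    have h5 : x ^ 2 ≤ 1 := by nlinarith
    refine h3.trans (mul_le_mul_of_nonneg_left ?_ hN'.le)
    linarith
  have h3 : ε ^ 2 * (1 - γ) ^ 2 * 4 ^ κ = 16 * (x * x) := by
    rw [hxdef, show (4 : ℝ) = 2 ^ 2 by norm_num, ← pow_mul, mul_comm 2 κ, pow_mul]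
    ring
  rw [h3, le_div_iff₀ (by positivity)]
  linarith

end Exploration

/-! ### The number of errors -/

/-- The logarithm in the definition of `Emax` and `Gmax`. -/
def logTerm (N : ℕ) (γ ε δ : ℝ) : ℝ :=
  Real.log (2 ^ 9 * N / (ε ^ 2 * (1 - γ) ^ 2 * delta1 N γ ε δ))

section Errors

variable {N : ℕ} {γ ε δ : ℝ} {ν : Fin N → Env A O R} {π : Policy A O R}
  {πs : Fin N → Policy A O R} {sel : Finset (Fin N) → History A O R → Choice N}

local notation "St" => stateAt γ ε δ ν πs sel

local notation "Phs" => phases γ ε δ ν πs sel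

lemma three_le_card_kappas (hy0 : 0 < ε * (1 - γ)) (hy1 : ε * (1 - γ) ≤ 1) :
    3 ≤ (kappas γ ε).card := by
  have h1 : 0 ≤ Real.logb 2 (1 / (ε * (1 - γ))) :=
    Real.logb_nonneg (by norm_num) (by rwa [le_div_iff₀ hy0, one_mul])
  have h2 : 2 ≤ ⌊Real.logb 2 (1 / (ε * (1 - γ))) + 2⌋₊ := Nat.le_floor (by push_cast; linarith)
  rw [kappas, Finset.card_range]
  omega

lemma delta1_le_div (hN : 0 < N) (hδ : 0 < δ) (hy0 : 0 < ε * (1 - γ)) (hy1 : ε * (1 - γ) ≤ 1) :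
    delta1 N γ ε δ ≤ δ / 96 := by
  have h1 : (3 : ℝ) ≤ (kappas γ ε).card := by exact_mod_cast three_le_card_kappas hy0 hy1
  have h2 : (1 : ℝ) ≤ (N : ℝ) ^ (3 / 2 : ℝ) :=
    Real.one_le_rpow (by exact_mod_cast hN) (by norm_num)
  rw [delta1]
  refine div_le_div_of_nonneg_left hδ.le (by norm_num) ?_
  nlinarith

lemma le_logTerm_arg (hN : 0 < N) (hδ : 0 < δ) (hy0 : 0 < ε * (1 - γ)) (hy1 : ε * (1 - γ) ≤ 1) :
    49152 / δ ≤ 2 ^ 9 * N / (ε ^ 2 * (1 - γ) ^ 2 * delta1 N γ ε δ) := by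
  have h1 := delta1_pos (γ := γ) (ε := ε) hN hδ
  have h2 := delta1_le_div hN hδ hy0 hy1
  have h3 : (1 : ℝ) ≤ N := by exact_mod_cast hN
  have h4 : ε ^ 2 * (1 - γ) ^ 2 ≤ 1 := by
    rw [← mul_pow]
    exact pow_le_one₀ hy0.le hy1
  have h5 : 0 < ε ^ 2 * (1 - γ) ^ 2 := by rw [← mul_pow]; positivity
  have h6 : ε ^ 2 * (1 - γ) ^ 2 * delta1 N γ ε δ ≤ δ / 96 := by nlinarith
  calc 49152 / δ = 2 ^ 9 * 1 / (δ / 96) := by field_simp; norm_num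
    _ ≤ _ := by gcongr

lemma logTerm_ge (hN : 0 < N) (hδ : 0 < δ) (hδ1 : δ < 1) (hy0 : 0 < ε * (1 - γ))
    (hy1 : ε * (1 - γ) ≤ 1) : 21 / 2 ≤ logTerm N γ ε δ ∧ Real.log (8 / δ) ≤ logTerm N γ ε δ := by
  have h := le_logTerm_arg hN hδ hy0 hy1
  constructor
  · have h1 : (49152 : ℝ) ≤ 49152 / δ := by
      rw [le_div_iff₀ hδ]
      linarith
    have h2 : (21 / 2 : ℝ) ≤ Real.log 49152 := by
      have h3 : Real.log (49152 : ℝ) = 15 * Real.log 2 + Real.log (3 / 2) := by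
        rw [show (49152 : ℝ) = 2 ^ 15 * (3 / 2) by norm_num,
          Real.log_mul (by norm_num) (by norm_num), Real.log_pow]
        norm_num
      have h4 := Real.one_sub_inv_le_log_of_pos (show (0 : ℝ) < 3 / 2 by norm_num)
      rw [h3]
      norm_num at h4
      linarith [Real.log_two_gt_d9]
    exact h2.trans (Real.log_le_log (by norm_num) (h1.trans h))
  · refine Real.log_le_log (by positivity) (le_trans ?_ h)
    gcongr
    norm_num

/-- The number of phases with a given `κ`. -/
lemma IsTypical.phaseCount_le (run : IsRun γ ε δ ν π πs sel) {i₀ : Fin N}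
    {ω : ℕ → Step A O R} (hω : IsTypical γ ε δ ν πs sel i₀ ω) (t : ℕ) {κ : ℕ}
    (hκ : κ ∈ kappas γ ε) :
    (phaseCount γ ε δ ν πs sel κ (pref ω t) : ℝ) ≤
      45056 * N * logTerm N γ ε δ / (ε ^ 2 * (1 - γ) ^ 2) * (1 / 4) ^ κ := by
  have hN := Fin.pos i₀
  have hN' : (0 : ℝ) < N := by exact_mod_cast hN
  have hg := run.one_sub_pos
  have hε := run.ε_pos
  have hd := delta1_pos (γ := γ) (ε := ε) hN run.δ_pos
  have hΛ := (logTerm_ge hN run.δ_pos run.δ_lt (mul_pos hε hg) run.small).1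
  have hy : 0 < ε ^ 2 * (1 - γ) ^ 2 := by positivity
  rcases Nat.eq_zero_or_pos (phaseCount γ ε δ ν πs sel κ (pref ω t)) with h0 | hE
  · rw [h0]
    have : 0 < logTerm N γ ε δ := by linarith
    push_cast
    positivity
  have h1 := hω.phaseCount_le_log run t hκ hE
  set E := phaseCount γ ε δ ν πs sel κ (pref ω t)
  have hE' : (0 : ℝ) < E := by exact_mod_cast hE
  set L := Real.log (E / delta1 N γ ε δ) with hL
  have hexp : Real.exp L = E / delta1 N γ ε δ := Real.exp_log (by positivity)
  have hL0 : 0 < L := by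
    by_contra hle
    have : 16896 * N * L / (ε ^ 2 * (1 - γ) ^ 2 * 4 ^ κ) ≤ 0 :=
      div_nonpos_of_nonpos_of_nonneg (by nlinarith) (by positivity)
    linarith
  -- the bound `E ≤ b L` with `L = log (E / δ₁)` is solved for `L` by means of `L ≤ exp (L / 2)`
  have h2 : (E : ℝ) ≤ 16896 * N / (ε ^ 2 * (1 - γ) ^ 2) * L := by
    refine h1.trans ?_
    have h4 : (1 : ℝ) ≤ 4 ^ κ := one_le_pow₀ (by norm_num)
    calc 16896 * N * L / (ε ^ 2 * (1 - γ) ^ 2 * 4 ^ κ)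
        ≤ 16896 * N * L / (ε ^ 2 * (1 - γ) ^ 2 * 1) := by gcongr
      _ = _ := by ring
  have h3 : L ≤ Real.exp (L / 2) := by
    have := Real.quadratic_le_exp_of_nonneg (x := L / 2) (by linarith)
    nlinarith [sq_nonneg (L - 4)]
  -- `33 = 16896 / 2 ^ 9`
  have h4 : Real.exp (L / 2) ≤ 33 * (2 ^ 9 * N / (ε ^ 2 * (1 - γ) ^ 2 * delta1 N γ ε δ)) := by
    have h5 : Real.exp (L / 2) * Real.exp (L / 2) = E / delta1 N γ ε δ := by
      rw [← Real.exp_add, add_halves, hexp]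
    have h6 : Real.exp (L / 2) * Real.exp (L / 2) ≤
        16896 * N / (ε ^ 2 * (1 - γ) ^ 2) * Real.exp (L / 2) / delta1 N γ ε δ := by
      rw [h5]
      gcongr
      exact h2.trans (mul_le_mul_of_nonneg_left h3 (by positivity))
    have h7 : 16896 * N / (ε ^ 2 * (1 - γ) ^ 2) * Real.exp (L / 2) / delta1 N γ ε δ =
        33 * (2 ^ 9 * N / (ε ^ 2 * (1 - γ) ^ 2 * delta1 N γ ε δ)) * Real.exp (L / 2) := by
      field_simp
      norm_num
    rw [h7] at h6
    exact le_of_mul_le_mul_right h6 (Real.exp_pos _)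
  have h5 : L / 2 ≤ 7 / 2 + logTerm N γ ε δ := by
    have h6 := (Real.le_log_iff_exp_le (by positivity)).2 h4
    rw [Real.log_mul (by norm_num) (by positivity)] at h6
    have h7 : Real.log 33 ≤ 7 / 2 := by
      rw [show (33 : ℝ) = 2 ^ 5 * (33 / 32) by norm_num,
        Real.log_mul (by norm_num) (by norm_num), Real.log_pow]
      have := Real.log_le_sub_one_of_pos (show (0 : ℝ) < 33 / 32 by norm_num)
      push_cast
      linarith [Real.log_two_lt_d9]
    rw [logTerm]
    linarith
  have h6 : L ≤ 8 / 3 * logTerm N γ ε δ := by linarith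
  calc (E : ℝ) ≤ 16896 * N * L / (ε ^ 2 * (1 - γ) ^ 2 * 4 ^ κ) := h1
    _ ≤ 16896 * N * (8 / 3 * logTerm N γ ε δ) / (ε ^ 2 * (1 - γ) ^ 2 * 4 ^ κ) := by gcongr
    _ = _ := by
      rw [one_div, inv_pow]
      field_simp
      norm_num

lemma sum_pow_le {r : ℝ} (hr0 : 0 ≤ r) (hr1 : r < 1) (s : Finset ℕ) :
    ∑ k ∈ s, r ^ k ≤ (1 - r)⁻¹ := by
  rw [← tsum_geometric_of_lt_one hr0 hr1]
  exact (summable_geometric_of_lt_one hr0 hr1).sum_le_tsum _ fun k _ => pow_nonneg hr0 k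

/-- The sum over the phases, sorted by `κ`. -/
lemma IsRun.sum_phases_le (run : IsRun γ ε δ ν π πs sel) (h : History A O R)
    {f : Phase N A O R → ℝ} {F : ℕ → ℝ}
    (hf : ∀ p, ε / 4 < p.gap γ ε ν πs → f p ≤ F (p.bucket γ ε ν πs)) :
    ((Phs h).map f).sum ≤ ∑ κ ∈ kappas γ ε, F κ * phaseCount γ ε δ ν πs sel κ h := by
  have h1 : ∀ κ, F κ * phaseCount γ ε δ ν πs sel κ h =
      ((Phs h).map fun p => if p.bucket γ ε ν πs = κ then F κ else 0).sum := by
    intro κ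
    rw [phaseCount, Nat.cast_list_sum, ← List.sum_map_mul_left, List.map_map]
    refine congrArg List.sum (List.map_congr_left fun p _ => ?_)
    simp only [Function.comp]
    split_ifs <;> simp
  simp only [h1]
  rw [sum_sum_map_comm]
  refine List.sum_le_sum fun p hp => ?_
  have hgap := (isCompleted_of_mem_phases run.phaseLen_pos hp).lt_gap
  rw [Finset.sum_ite_eq, if_pos (run.bucket_mem_kappas hgap)]
  exact hf p hgap

lemma IsTypical.length_phases_le (run : IsRun γ ε δ ν π πs sel) {i₀ : Fin N}
    {ω : ℕ → Step A O R} (hω : IsTypical γ ε δ ν πs sel i₀ ω) (t : ℕ) :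
    ((Phs (pref ω t)).length : ℝ) ≤
      45056 * N * logTerm N γ ε δ / (ε ^ 2 * (1 - γ) ^ 2) * (4 / 3) := by
  have hN := Fin.pos i₀
  have hN' : (0 : ℝ) < N := by exact_mod_cast hN
  have hg := run.one_sub_pos
  have hε := run.ε_pos
  have hΛ := (logTerm_ge hN run.δ_pos run.δ_lt (mul_pos hε hg) run.small).1
  have hΛ0 : 0 < logTerm N γ ε δ := by linarith
  have h1 := run.sum_phases_le (pref ω t) (f := fun _ => 1) (F := fun _ => 1) fun _ _ => le_rfl
  rw [List.map_const', List.sum_replicate, nsmul_eq_mul, mul_one] at h1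
  refine h1.trans ((Finset.sum_le_sum fun κ hκ => (one_mul _).trans_le
    (hω.phaseCount_le run t hκ)).trans ?_)
  rw [← Finset.mul_sum]
  refine mul_le_mul_of_nonneg_left ((sum_pow_le (by norm_num) (by norm_num) _).trans_eq ?_)
    (by positivity)
  norm_num

lemma IsRun.gapSum_le (run : IsRun γ ε δ ν π πs sel) (h : History A O R) :
    (1 - γ) * gapSum γ ε δ ν πs sel h ≤
      (1 - γ) * ((Phs h).map fun p => p.gap γ ε ν πs).sum + 1 := by
  have key : gapSum γ ε δ ν πs sel h = ((Phs h).map fun p => p.gap γ ε ν πs).sum +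
      match (St h).phase with | none => 0 | some p => p.gap γ ε ν πs := by
    induction h with
    | nil => simp [gapSum, phases, stateAt]
    | cons s h ih =>
      have hnext : ∀ p : Phase N A O R,
          (p.next γ s).gap γ ε ν πs = p.gap γ ε ν πs := fun p => rfl
      have hcur : ∀ p, curPhase γ ε δ ν πs sel h = some p →
          gapSum γ ε δ ν πs sel (s :: h) =
            ((Phs h).map fun p => p.gap γ ε ν πs).sum + p.gap γ ε ν πs := by
        intro p hc
        rw [gapSum, ih]
        rcases hph : (St h).phase with _ | q
        · by_cases hs : Starts γ ε δ ν πs sel h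
          · rw [hs.curPhase_eq, Option.some.injEq] at hc
            subst hc
            rw [if_pos hs]
            simp only [add_zero]
            rfl
          · rw [curPhase_of_not_starts hph hs] at hc
            simp at hc
        · have hns : ¬ Starts γ ε δ ν πs sel h := fun hs => by
            rw [hs.1] at hph
            simp at hph
          rw [curPhase_of_phase_eq_some hph, Option.some.injEq] at hc
          rw [if_neg hns, hc, add_zero]
      rcases hc : curPhase γ ε δ ν πs sel h with _ | p
      · rw [gapSum, if_neg (phase_eq_none_of_curPhase hc).2, stateAt_cons_none hc,
          phases_cons_none hc, ih, add_zero]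
      · rw [hcur p hc]
        by_cases hq : p.elapsed + 1 < phaseLen γ ε
        · rw [stateAt_cons_mid hc hq, phases_cons_mid hc hq]
          simp only [hnext]
        · rw [stateAt_cons_end hc hq, phases_cons_end hc hq, List.map_cons, List.sum_cons, hnext]
          simp only [endPhase, add_zero]
          rw [add_comm]
  rw [key, mul_add]
  have : (1 - γ) * (match (St h).phase with | none => 0 | some p => p.gap γ ε ν πs) ≤ 1 := by
    rcases (St h).phase with _ | p
    · simp
    · exact run.gap_le _ _
  linarith

lemma IsTypical.gapSum_le (run : IsRun γ ε δ ν π πs sel) {i₀ : Fin N}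
    {ω : ℕ → Step A O R} (hω : IsTypical γ ε δ ν πs sel i₀ ω) (t : ℕ) :
    (1 - γ) * gapSum γ ε δ ν πs sel (pref ω t) ≤
      45056 * N * logTerm N γ ε δ / (ε * (1 - γ)) + 1 := by
  have hN := Fin.pos i₀
  have hN' : (0 : ℝ) < N := by exact_mod_cast hN
  have hg := run.one_sub_pos
  have hε := run.ε_pos
  have hΛ := (logTerm_ge hN run.δ_pos run.δ_lt (mul_pos hε hg) run.small).1
  have hΛ0 : 0 < logTerm N γ ε δ := by linarith
  have h1 := run.sum_phases_le (pref ω t) (f := fun p => p.gap γ ε ν πs)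
    (F := fun κ => ε * 2 ^ κ / 2) fun p hp => (two_pow_bucket hε hp).2
  have h2 : ∑ κ ∈ kappas γ ε, ε * 2 ^ κ / 2 * phaseCount γ ε δ ν πs sel κ (pref ω t) ≤
      45056 * N * logTerm N γ ε δ / (ε ^ 2 * (1 - γ) ^ 2) * ε := by
    calc _ ≤ ∑ κ ∈ kappas γ ε,
          45056 * N * logTerm N γ ε δ / (ε ^ 2 * (1 - γ) ^ 2) * (ε / 2) * (1 / 2) ^ κ := by
          refine Finset.sum_le_sum fun κ hκ => ?_
          have h3 := mul_le_mul_of_nonneg_left (hω.phaseCount_le run t hκ)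
            (by positivity : 0 ≤ ε * 2 ^ κ / 2)
          refine h3.trans_eq ?_
          have h4 : (2 : ℝ) ^ κ * (1 / 4) ^ κ = (1 / 2) ^ κ := by
            rw [← mul_pow]
            norm_num
          rw [← h4]
          ring
      _ ≤ 45056 * N * logTerm N γ ε δ / (ε ^ 2 * (1 - γ) ^ 2) * (ε / 2) * 2 := by
          rw [← Finset.mul_sum]
          refine mul_le_mul_of_nonneg_left
            ((sum_pow_le (by norm_num) (by norm_num) _).trans_eq ?_) (by positivity)
          norm_num
      _ = _ := by ring
  have h3 := mul_le_mul_of_nonneg_left (h1.trans h2) hg.le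
  have h4 : (1 - γ) * (45056 * N * logTerm N γ ε δ / (ε ^ 2 * (1 - γ) ^ 2) * ε) =
      45056 * N * logTerm N γ ε δ / (ε * (1 - γ)) := by
    field_simp
  rw [h4] at h3
  linarith [run.gapSum_le (h := pref ω t)]

/-- The bound on the number of failure blocks, outside of the exceptional event of
`IsRun.failBlocks_tail`. -/
lemma IsTypical.failBlocks_le (run : IsRun γ ε δ ν π πs sel) {i₀ : Fin N}
    {ω : ℕ → Step A O R} (hω : IsTypical γ ε δ ν πs sel i₀ ω)
    (hfail : ∀ t, failRemaining γ ε δ ν π πs sel i₀ (pref ω t) = 0 →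
      Real.exp (7 * (1 - γ) * ε / 768 * failBlocks γ ε δ ν π πs sel i₀ (pref ω t) -
        (1 - γ) * gapSum γ ε δ ν πs sel (pref ω t) / 4) < 8 / δ) (t : ℕ) :
    (failBlocks γ ε δ ν π πs sel i₀ (pref ω t) : ℝ) ≤
      1236100 * N * logTerm N γ ε δ / (ε ^ 2 * (1 - γ) ^ 2) := by
  have hN := Fin.pos i₀
  have hN' : (1 : ℝ) ≤ N := by exact_mod_cast hN
  have hg := run.one_sub_pos
  have hε := run.ε_pos
  have hδ := run.δ_pos
  obtain ⟨hΛ, hlog⟩ := logTerm_ge hN run.δ_pos run.δ_lt (mul_pos hε hg) run.small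
  have hend : ∀ k t, failRemaining γ ε δ ν π πs sel i₀ (pref ω t) = k →
      failRemaining γ ε δ ν π πs sel i₀ (pref ω (t + k)) = 0 ∧
        failBlocks γ ε δ ν π πs sel i₀ (pref ω (t + k)) =
          failBlocks γ ε δ ν π πs sel i₀ (pref ω t) := by
    intro k
    induction k with
    | zero => exact fun t ht => ⟨ht, rfl⟩
    | succ k ih =>
      intro t ht
      have h1 : failRemaining γ ε δ ν π πs sel i₀ (pref ω (t + 1)) = k := by
        rw [pref_succ, failRemaining, if_neg (by omega)]
        omega
      have h2 : failBlocks γ ε δ ν π πs sel i₀ (pref ω (t + 1)) =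
          failBlocks γ ε δ ν π πs sel i₀ (pref ω t) := by
        rw [pref_succ, failBlocks, if_neg fun h' => by omega, add_zero]
      have := ih (t + 1) h1
      rw [h2, add_assoc, add_comm 1 k] at this
      exact this
  obtain ⟨h1, h2⟩ := hend _ t rfl
  have h3 := hfail _ h1
  rw [h2] at h3
  set T := t + failRemaining γ ε δ ν π πs sel i₀ (pref ω t)
  have h4 := (Real.lt_log_iff_exp_lt (by positivity)).2 h3
  have h5 := hω.gapSum_le run T
  set G : ℝ := (failBlocks γ ε δ ν π πs sel i₀ (pref ω t) : ℝ)
  set Λ := logTerm N γ ε δ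
  set y := ε * (1 - γ) with hy
  have hy0 : 0 < y := mul_pos hε hg
  have hy1 : y ≤ 1 := run.small
  have h6 : 7 * (1 - γ) * ε / 768 * G = 7 / 768 * (y * G) := by rw [hy]; ring
  rw [h6] at h4
  have h7 : 7 / 768 * (y * G) ≤ 11264 * N * Λ / y + (1 / 4 + Λ) := by
    have : 45056 * N * Λ / y = 4 * (11264 * N * Λ / y) := by ring
    rw [this] at h5
    linarith
  have h8 : ε ^ 2 * (1 - γ) ^ 2 = y * y := by rw [hy]; ring
  rw [h8, le_div_iff₀ (by positivity)]
  have h9 := mul_le_mul_of_nonneg_left h7 hy0.le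
  have h10 : y * (11264 * N * Λ / y + (1 / 4 + Λ)) = 11264 * N * Λ + y * (1 / 4 + Λ) := by
    field_simp
  rw [h10] at h9
  have h11 : y * (1 / 4 + Λ) ≤ 1 / 4 + Λ := mul_le_of_le_one_left (by linarith) hy1
  have h12 : Λ ≤ N * Λ := le_mul_of_one_le_left (by linarith) hN'
  linarith

/-- The bounds on the numbers of failure blocks and of exploration phases contain only one factor
`logTerm N γ ε δ ≥ 21 / 2`, which makes up for their constants being larger than those of the error
bound. -/
lemma IsRun.phaseLen_mul_lt (run : IsRun γ ε δ ν π πs sel) (hN : 0 < N) {G E : ℝ}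
    (hG : G ≤ 1236100 * N * logTerm N γ ε δ / (ε ^ 2 * (1 - γ) ^ 2))
    (hE : E ≤ 45056 * N * logTerm N γ ε δ / (ε ^ 2 * (1 - γ) ^ 2) * (4 / 3)) :
    phaseLen γ ε * (G + (E + 1)) < errorBound N γ ε δ := by
  have hN' : (1 : ℝ) ≤ N := by exact_mod_cast hN
  have hg := run.one_sub_pos
  have hε := run.ε_pos
  have hΛ := (logTerm_ge hN run.δ_pos run.δ_lt (mul_pos hε hg) run.small).1
  have hK : (3 : ℝ) ≤ (kappas γ ε).card := by
    exact_mod_cast three_le_card_kappas (mul_pos hε hg) run.small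
  have hd := run.horizon_pos
  have hD : (phaseLen γ ε : ℝ) ≤ 3 / 2 * horizon γ ε := by
    have : (phaseLen γ ε : ℝ) < horizon γ ε + 1 := Nat.ceil_lt_add_one (by linarith)
    linarith
  have hy : 0 < ε ^ 2 * (1 - γ) ^ 2 := by positivity
  have hy1 : ε ^ 2 * (1 - γ) ^ 2 ≤ 1 := by
    rw [← mul_pow]
    exact pow_le_one₀ (mul_pos hε hg).le run.small
  set Λ := logTerm N γ ε δ with hΛdef
  set q := N / (ε ^ 2 * (1 - γ) ^ 2) with hq
  have hq1 : 1 ≤ q := by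
    rw [hq, le_div_iff₀ hy]
    linarith
  have h1 : G + (E + 1) ≤ 1296176 * (q * Λ) := by
    have e1 : 1236100 * N * Λ / (ε ^ 2 * (1 - γ) ^ 2) = 1236100 * (q * Λ) := by rw [hq]; ring
    have e2 : 45056 * N * Λ / (ε ^ 2 * (1 - γ) ^ 2) * (4 / 3) = 45056 * 4 / 3 * (q * Λ) := by
      rw [hq]; ring
    rw [e1] at hG
    rw [e2] at hE
    have : 1 ≤ q * Λ := one_le_mul_of_one_le_of_one_le hq1 (by linarith)
    linarith
  have h2 : q * Λ ≤ 2 / 21 * (q * Λ ^ 2) := by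
    have h3 : 0 ≤ q * Λ := mul_nonneg (by linarith) (by linarith)
    have : q * Λ ^ 2 = q * Λ * Λ := by ring
    rw [this]
    nlinarith
  have h3 : 262144 * (q * Λ ^ 2) ≤ Gmax N γ ε δ + Emax N γ ε δ := by
    have e1 : Gmax N γ ε δ + Emax N γ ε δ = 65536 * ((kappas γ ε).card + 1) * (q * Λ ^ 2) := by
      rw [Gmax, Emax, hq, hΛdef, logTerm]
      ring
    rw [e1]
    refine mul_le_mul_of_nonneg_right ?_ (by positivity)
    linarith
  have h4 : 0 < q * Λ ^ 2 := by
    have : 0 < Λ := by linarith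
    positivity
  rw [errorBound]
  calc (phaseLen γ ε : ℝ) * (G + (E + 1)) ≤ phaseLen γ ε * (1296176 * (q * Λ)) :=
        mul_le_mul_of_nonneg_left h1 (Nat.cast_nonneg _)
    _ ≤ 3 / 2 * horizon γ ε * (1296176 * (2 / 21 * (q * Λ ^ 2))) := by
        refine mul_le_mul hD (mul_le_mul_of_nonneg_left h2 (by norm_num)) ?_ (by linarith)
        exact mul_nonneg (by norm_num) (mul_nonneg (by linarith) (by linarith))
    _ < horizon γ ε * (262144 * (q * Λ ^ 2)) := by
        have : 0 < horizon γ ε * (q * Λ ^ 2) := mul_pos (by linarith) h4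
        linarith
    _ ≤ _ := mul_le_mul_of_nonneg_left h3 (by linarith)

lemma IsTypical.errorCount_lt (run : IsRun γ ε δ ν π πs sel) {i₀ : Fin N}
    {ω : ℕ → Step A O R} (hω : IsTypical γ ε δ ν πs sel i₀ ω)
    (hfail : ∀ t, failRemaining γ ε δ ν π πs sel i₀ (pref ω t) = 0 →
      Real.exp (7 * (1 - γ) * ε / 768 * failBlocks γ ε δ ν π πs sel i₀ (pref ω t) -
        (1 - γ) * gapSum γ ε δ ν πs sel (pref ω t) / 4) < 8 / δ) :
    (errorCount γ ε (ν i₀) π ω : ℝ≥0∞) < ENNReal.ofReal (errorBound N γ ε δ) := by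
  have hN := Fin.pos i₀
  have hD := run.phaseLen_pos
  -- an error is either a failure or made during exploration
  have hvis : ∀ t, (visits (fun h => ε < optValue γ (ν i₀) h - value γ (ν i₀) π h)
      (pref ω t) : ℝ) < errorBound N γ ε δ := by
    intro t
    have h1 := visits_le_add ω (Q := IsFailure γ ε δ ν π πs sel i₀)
      (Q' := fun h => curPhase γ ε δ ν πs sel h ≠ none)
      (P := fun h => ε < optValue γ (ν i₀) h - value γ (ν i₀) π h) (fun t ht => by
        by_cases hc : curPhase γ ε δ ν πs sel (pref ω t) = none
        · exact Or.inl ⟨hc, hω.mem_models run t, ht⟩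
        · exact Or.inr hc) t
    have h2 := visits_failure_le (γ := γ) (ε := ε) (δ := δ) (ν := ν) (π := π) (πs := πs)
      (sel := sel) hD i₀ (pref ω t)
    have h3 := visits_explore_le (γ := γ) (ε := ε) (δ := δ) (ν := ν) (πs := πs)
      (sel := sel) hD (pref ω t)
    refine lt_of_le_of_lt ?_ (run.phaseLen_mul_lt hN (hω.failBlocks_le run hfail t)
      (hω.length_phases_le run t))
    have h4 : visits (fun h => ε < optValue γ (ν i₀) h - value γ (ν i₀) π h) (pref ω t) ≤
        phaseLen γ ε * (failBlocks γ ε δ ν π πs sel i₀ (pref ω t) +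
          ((Phs (pref ω t)).length + 1)) := by
      rw [mul_add]
      omega
    exact_mod_cast h4
  have hpos : 0 < errorBound N γ ε δ := (Nat.cast_nonneg _).trans_lt (hvis 0)
  set m := ⌈errorBound N γ ε δ⌉₊ - 1 with hm
  have hm1 : ⌈errorBound N γ ε δ⌉₊ = m + 1 := by
    have := Nat.ceil_pos.2 hpos
    omega
  have h1 : errorCount γ ε (ν i₀) π ω ≤ (m : ℕ∞) := by
    refine encard_le_of_visits_le (P := fun h => ε < optValue γ (ν i₀) h - value γ (ν i₀) π h)
      fun t => ?_
    have h2 := Nat.lt_ceil.2 (hvis t)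
    omega
  have h2 : (m : ℝ) < errorBound N γ ε δ := Nat.lt_ceil.1 (by omega)
  calc (errorCount γ ε (ν i₀) π ω : ℝ≥0∞) ≤ ((m : ℕ∞) : ℝ≥0∞) := by exact_mod_cast h1
    _ = ENNReal.ofReal m := by simp
    _ < _ := (ENNReal.ofReal_lt_ofReal_iff hpos).2 h2

/-- The error bound holds with probability at least `1 - 3 δ / 8`. -/
theorem IsRun.prob_errorCount_le (run : IsRun γ ε δ ν π πs sel) (i₀ : Fin N) :
    law (ν i₀) π {ω | ENNReal.ofReal (errorBound N γ ε δ) ≤ (errorCount γ ε (ν i₀) π ω : ℝ≥0∞)} ≤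
      ENNReal.ofReal (3 * δ / 8) := by
  have hN := Fin.pos i₀
  have hN' : (1 : ℝ) ≤ N := by exact_mod_cast hN
  have hδ := run.δ_pos
  set B₁ : Set (ℕ → Step A O R) := ⋃ i ∈ (Finset.univ : Finset (Fin N)),
    {ω | ∃ κ ∈ kappas γ ε, ∃ j t, pref ω t ∈ BadTest γ ε δ ν πs sel (-1) i₀ i κ j}
  set B₂ : Set (ℕ → Step A O R) :=
    {ω | ∃ κ ∈ kappas γ ε, ∃ j t, pref ω t ∈ BadTest γ ε δ ν πs sel 1 i₀ i₀ κ j}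
  set B₃ : Set (ℕ → Step A O R) := {ω | ∃ t, failRemaining γ ε δ ν π πs sel i₀ (pref ω t) = 0 ∧
      8 / δ ≤ Real.exp (7 * (1 - γ) * ε / 768 * failBlocks γ ε δ ν π πs sel i₀ (pref ω t) -
        (1 - γ) * gapSum γ ε δ ν πs sel (pref ω t) / 4)}
  have h1 : law (ν i₀) π B₁ ≤ ENNReal.ofReal (δ / 8) := by
    refine (measure_biUnion_finset_le _ _).trans ((Finset.sum_le_sum fun i _ =>
      run.prob_badTests_le (by norm_num : (-1 : ℝ) ^ 2 = 1) i₀ i).trans ?_)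
    rw [Finset.sum_const, Finset.card_univ, Fintype.card_fin, nsmul_eq_mul,
      ← ENNReal.ofReal_natCast, ← ENNReal.ofReal_mul (by positivity)]
    refine ENNReal.ofReal_le_ofReal (le_of_eq ?_)
    field_simp
  have h2 : law (ν i₀) π B₂ ≤ ENNReal.ofReal (δ / 8) := by
    refine (run.prob_badTests_le (by norm_num : (1 : ℝ) ^ 2 = 1) i₀ i₀).trans
      (ENNReal.ofReal_le_ofReal ?_)
    exact div_le_div_of_nonneg_left hδ.le (by norm_num) (by linarith)
  have h3 : law (ν i₀) π B₃ ≤ ENNReal.ofReal (δ / 8) := by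
    have := run.failBlocks_tail i₀ (c := 8 / δ) (by positivity)
    rwa [one_div_div] at this
  have hsub : {ω | ENNReal.ofReal (errorBound N γ ε δ) ≤ (errorCount γ ε (ν i₀) π ω : ℝ≥0∞)} ⊆
      B₁ ∪ B₂ ∪ B₃ := by
    intro ω hω
    by_contra hno
    simp only [Set.mem_union, not_or] at hno
    obtain ⟨⟨hn1, hn2⟩, hn3⟩ := hno
    refine absurd hω (not_le.2 (IsTypical.errorCount_lt run ⟨fun i κ hκ j t ht => hn1 ?_,
      fun κ hκ j t ht => hn2 ⟨κ, hκ, j, t, ht⟩⟩ fun t ht => ?_))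
    · exact Set.mem_biUnion (Finset.mem_coe.2 (Finset.mem_univ i)) ⟨κ, hκ, j, t, ht⟩
    · by_contra hle
      exact hn3 ⟨t, ht, not_lt.1 hle⟩
  calc _ ≤ law (ν i₀) π (B₁ ∪ B₂ ∪ B₃) := measure_mono hsub
    _ ≤ law (ν i₀) π B₁ + law (ν i₀) π B₂ + law (ν i₀) π B₃ :=
      (measure_union_le _ _).trans (add_le_add_left (measure_union_le _ _) _)
    _ ≤ ENNReal.ofReal (δ / 8) + ENNReal.ofReal (δ / 8) + ENNReal.ofReal (δ / 8) := by gcongr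
    _ = _ := by
      rw [← ENNReal.ofReal_add (by positivity) (by positivity),
        ← ENNReal.ofReal_add (by positivity) (by positivity)]
      ring_nf

end Errors

/-! ### The algorithm is well defined -/

lemma exists_isArgmax {N : ℕ} (hN : 0 < N) (γ ε : ℝ) (ν : Fin N → Env A O R)
    (πs : Fin N → Policy A O R) : ∃ sel, IsArgmax γ ε ν πs sel := by
  have h : ∀ (M : Finset (Fin N)) (h : History A O R), ∃ c : Choice N, M.Nonempty →
      (c.up ∈ M ∧ c.lo ∈ M ∧ c.pol ∈ M) ∧
      ∀ c' : Choice N, c'.up ∈ M → c'.lo ∈ M → c'.pol ∈ M →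
        gap γ ε ν πs c' h ≤ gap γ ε ν πs c h := by
    intro M h
    by_cases hM : M.Nonempty
    · obtain ⟨⟨a, b, c⟩, hmem, hmax⟩ := (M ×ˢ M ×ˢ M).exists_max_image
        (fun q => gap γ ε ν πs ⟨q.1, q.2.1, q.2.2⟩ h) (hM.product (hM.product hM))
      simp only [Finset.mem_product] at hmem
      refine ⟨⟨a, b, c⟩, fun _ => ⟨hmem, fun c' h1 h2 h3 => ?_⟩⟩
      exact hmax (c'.up, c'.lo, c'.pol) (by simp [h1, h2, h3])
    · exact ⟨⟨⟨0, hN⟩, ⟨0, hN⟩, ⟨0, hN⟩⟩, fun h' => absurd h' hM⟩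
  choose sel hsel using h
  exact ⟨sel, hsel⟩

theorem exists_isMERL [Nonempty A] (hR : ∀ r ∈ R, 0 ≤ r ∧ r ≤ 1) {γ ε δ : ℝ} (hγ0 : 0 < γ)
    (hγ1 : γ < 1) {N : ℕ} (hN : 0 < N) (ν : Fin N → Env A O R) :
    ∃ π : Policy A O R, IsMERL γ ε δ ν π := by
  classical
  choose πs hπs using fun i => exists_isOptimal (ν i) hR hγ0 hγ1
  obtain ⟨sel, hsel⟩ := exists_isArgmax hN γ ε ν πs
  refine ⟨fun h => if hM : (stateAt γ ε δ ν πs sel h).models.Nonempty then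
      match currentPhase γ ε ν πs sel (stateAt γ ε δ ν πs sel h) h with
        | some p => πs p.choice.pol h
        | none => πs ((stateAt γ ε δ ν πs sel h).models.min' hM) h
    else Classical.arbitrary A, πs, sel, hπs, hsel, fun h hM => ?_⟩
  exact dif_pos hM

/-! ### The order of magnitude of the error bound -/

/-- The order of magnitude of the error bound, up to universal constants. -/
theorem errorBound_le {N : ℕ} {γ ε δ : ℝ} (hN : 0 < N) (hγ0 : 0 < γ) (hγ1 : γ < 1)
    (hε : 0 < ε) (hy : ε * (1 - γ) ≤ 1 / 2) (hδ : 0 < δ) (hδ1 : δ < 1) :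
    errorBound N γ ε δ ≤
      2 ^ 30 * (N / (ε ^ 2 * (1 - γ) ^ 3) * Real.log (N / (δ * ε * (1 - γ))) ^ 2) *
        Real.log (1 / (ε * (1 - γ))) ^ 2 := by
  have hg : 0 < 1 - γ := by linarith
  have hN' : (1 : ℝ) ≤ N := by exact_mod_cast hN
  set y := ε * (1 - γ) with hydef
  have hy0 : 0 < y := mul_pos hε hg
  have hl2 := Real.log_two_gt_d9
  set ly := Real.log (1 / y) with hly
  have hly2 : Real.log 2 ≤ ly := by
    refine Real.log_le_log (by norm_num) ?_
    rw [le_div_iff₀ hy0]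
    linarith
  have hlN : 0 ≤ Real.log N := Real.log_nonneg hN'
  have hlδ : 0 ≤ Real.log (1 / δ) := Real.log_nonneg (by rw [le_div_iff₀ hδ]; linarith)
  set P := Real.log (N / (δ * ε * (1 - γ))) with hP
  have hPeq : P = Real.log N + Real.log (1 / δ) + ly := by
    rw [hP, hly, ← Real.log_mul (by positivity) (by positivity),
      ← Real.log_mul (by positivity) (by positivity)]
    congr 1
    rw [hydef]
    field_simp
  -- the horizon
  have hhor : horizon γ ε ≤ 1 / (1 - γ) * (4 * ly) := by
    rw [horizon]
    refine mul_le_mul_of_nonneg_left ?_ (one_div_pos.2 hg).le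
    have h1 : 8 / ((1 - γ) * ε) = 2 ^ 3 * (1 / y) := by rw [hydef]; field_simp; norm_num
    rw [h1, Real.log_mul (by norm_num) (by positivity), Real.log_pow]
    push_cast
    linarith
  -- the number of values of `κ`
  have hK : ((kappas γ ε).card : ℝ) ≤ ly / Real.log 2 + 3 := by
    have h1 : Real.logb 2 (1 / y) = ly / Real.log 2 := rfl
    have h2 : 0 ≤ Real.logb 2 (1 / y) + 2 := by
      rw [h1]
      have : 0 ≤ ly / Real.log 2 := div_nonneg (by linarith) (by linarith)
      linarith
    rw [kappas, Finset.card_range, Nat.cast_add, Nat.cast_one, ← h1]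
    linarith [Nat.floor_le h2]
  have hdiv : ly / Real.log 2 ≤ 3 / 2 * ly := by
    rw [div_le_iff₀ (by linarith)]
    nlinarith
  have hK1 : ((kappas γ ε).card : ℝ) + 1 ≤ 8 * ly := by linarith
  have hK0 : (0 : ℝ) < (kappas γ ε).card := by exact_mod_cast kappas_card_pos
  -- the logarithm
  have hΛ0 : 0 ≤ logTerm N γ ε δ := by
    linarith [(logTerm_ge hN hδ hδ1 hy0 (by linarith)).1]
  have hΛ : logTerm N γ ε δ ≤ 21 * P := by
    have hpow : (0 : ℝ) < (N : ℝ) ^ (3 / 2 : ℝ) := by positivity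
    have h1 : 2 ^ 9 * N / (ε ^ 2 * (1 - γ) ^ 2 * delta1 N γ ε δ) =
        2 ^ 14 * (kappas γ ε).card * (N * (N : ℝ) ^ (3 / 2 : ℝ)) * (1 / y) ^ 2 * (1 / δ) := by
      rw [delta1, hydef]
      field_simp
      norm_num
    have h2 : logTerm N γ ε δ = 14 * Real.log 2 + Real.log (kappas γ ε).card +
        (Real.log N + 3 / 2 * Real.log N) + 2 * ly + Real.log (1 / δ) := by
      rw [logTerm, h1, Real.log_mul (by positivity) (by positivity),
        Real.log_mul (by positivity) (by positivity), Real.log_mul (by positivity) (by positivity),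
        Real.log_mul (by positivity) (by positivity), Real.log_mul (by positivity) (by positivity),
        Real.log_pow, Real.log_pow, Real.log_rpow (by positivity), ← hly]
      push_cast
      ring
    have h3 : Real.log (kappas γ ε).card ≤ 3 / 2 * ly + 2 := by
      have := Real.log_le_sub_one_of_pos hK0
      linarith
    have h4 : (2 : ℝ) ≤ 3 * ly := by linarith
    rw [h2, hPeq]
    have h5 : Real.log 2 * 14 ≤ 14 * ly := by linarith
    nlinarith
  -- the product
  have hE : errorBound N γ ε δ = horizon γ ε *
      (65536 * ((kappas γ ε).card + 1) * (N / (ε ^ 2 * (1 - γ) ^ 2)) * logTerm N γ ε δ ^ 2) := by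
    rw [errorBound, Gmax, Emax, logTerm]
    ring
  have hly0 : 0 ≤ ly := by linarith
  rw [hE]
  calc _ ≤ 1 / (1 - γ) * (4 * ly) *
        (65536 * (8 * ly) * (N / (ε ^ 2 * (1 - γ) ^ 2)) * (21 * P) ^ 2) := by
        gcongr
    _ = 924844032 * (N / (ε ^ 2 * (1 - γ) ^ 3) * P ^ 2) * ly ^ 2 := by
        field_simp
        ring
    _ ≤ _ := by
        gcongr
        norm_num

end GeneralRL

end

open GeneralRL in
theorem theorem1 {A O : Type*} [Finite A] [Nonempty A] [Finite O] (R : Finset ℝ)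
    (hR : ∀ r ∈ R, 0 ≤ r ∧ r ≤ 1)
    (γ ε δ : ℝ) (hγ0 : 0 < γ) (hγ1 : γ < 1) (hε0 : 0 < ε) (hε1 : ε * (1 - γ) ≤ 1)
    (hδ0 : 0 < δ) (hδ1 : δ < 1)
    (N : ℕ) (hN : 0 < N) (ν : Fin N → Env A O R) :
    -- the algorithm is well defined
    (∃ π : Policy A O R, IsMERL γ ε δ ν π) ∧
    -- the bound, whichever model is the true environment
    (∀ π : Policy A O R, IsMERL γ ε δ ν π →
      (∀ i : Fin N,
        law (ν i) π {ω | ENNReal.ofReal (errorBound N γ ε δ) ≤ (errorCount γ ε (ν i) π ω : ℝ≥0∞)}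
          ≤ ENNReal.ofReal δ) ∧
      HasSampleComplexity γ ε δ ν π (errorBound N γ ε δ)) ∧
    -- its order of magnitude, with a universal constant
    (∃ C : ℝ, 0 < C ∧ ∀ (N' : ℕ) (γ' ε' δ' : ℝ), 0 < N' → 0 < γ' → γ' < 1 → 0 < ε' →
      ε' * (1 - γ') ≤ 1 / 2 → 0 < δ' → δ' < 1 →
        errorBound N' γ' ε' δ' ≤
          C * (N' / (ε' ^ 2 * (1 - γ') ^ 3) * Real.log (N' / (δ' * ε' * (1 - γ'))) ^ 2) *
            Real.log (1 / (ε' * (1 - γ'))) ^ 2) := by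
  refine ⟨exists_isMERL hR hγ0 hγ1 hN ν, fun π hπ => ?_, 2 ^ 30, by norm_num, ?_⟩
  · obtain ⟨πs, sel, hopt, hsel, hfollow⟩ := hπ
    have run : IsRun γ ε δ ν π πs sel :=
      ⟨hR, hγ0, hγ1, hε0, hε1, hδ0, hδ1, hopt, hsel, hfollow⟩
    refine ⟨fun i => (run.prob_errorCount_le i).trans (ENNReal.ofReal_le_ofReal (by linarith)),
      fun i => ?_⟩
    refine (measure_mono fun ω hω => ?_).trans_lt ((run.prob_errorCount_le i).trans_lt
      ((ENNReal.ofReal_lt_ofReal_iff hδ0).2 (by linarith)))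
    rw [Set.mem_ofPred_eq] at hω ⊢
    exact hω.le
  · intro N' γ' ε' δ' hN' hγ0' hγ1' hε' hy' hδ0' hδ1'
    exact errorBound_le hN' hγ0' hγ1' hε' hy' hδ0' hδ1'
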